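/- Setting. Let $d\ge 1$, $k\ge 0$ be integers and let $\mathbb V=\mathbb V_{\mathbb R}+i\mathbb V_{\mathbb R}$ be a separable complex Hilbert space, the complexification of a real Hilbert space $\mathbb V_{\mathbb R}$. Write $(f\otimes g)h=\langle h,g\rangle f$. Let $\mu$ be a finite real measure on the unit sphere $\mathbb S\subset\mathbb R^d$ with values in the positive trace class operators on $\mathbb V$ (real: each $\mu(B)$ commutes with complex conjugation), with trace measure $\|\mu\|_{\rm tr}(B)=\|\mu(B)\|_{\rm tr}$. In polar coordinates $x=u\theta$ on $\mathbb R^d\setminus\{0\}$, $u>0$, $\theta\in\mathbb S$, put $\nu(du,d\theta)=du\,\mu(d\theta)$. Let $W=W_{\mathbb R}+iW_{\mathbb I}$, where $W_{\mathbb R},W_{\mathbb I}$ are independent centered Gaussian $\mathbb V_{\mathbb R}$-valued processes indexed by the bounded Borel sets of $\mathbb R^d\setminus\{0\}$ with $\mathbb E[W_{\mathbb R}(B)\otimes W_{\mathbb R}(C)]=\mathbb E[W_{\mathbb I}(B)\otimes W_{\mathbb I}(C)]=\tfrac12\nu(B\cap C)$. For an operator valued integrand $f$, $\int f\,dW$ denotes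 the $L^2$-extension of $\int \sum_i 1_{B_i}T_i\,dW=\sum_i T_iW(B_i)$ ($T_i$ bounded operators). Let $\mathcal H$ be a bounded linear operator on $\mathbb V$ and $\epsilon>0$ with $\Re(\mathrm{sp}(\mathcal H))\subset(\epsilon,k+1)$; $u^{\mathcal H}:=\exp(\log(u)\mathcal H)$. Let $\mathcal A(\theta)$, $\theta\in\mathbb S$, be bounded linear operators on $\mathbb V$, Borel measurable in $\theta$, with $\int_{\mathbb S}\|\mathcal A(\theta)\|_{\rm op}^2\,\|\mu\|_{\rm tr}(d\theta)<\infty$. Let $\Lambda_k$ be the set of finitely supported complex measures $\lambda=\sum_i c_i\delta_{t_i}$ on $\mathbb R^d$ that annihilate all polynomials of degree $\le k$. Put $g(\lambda)=\sum_i c_ig(t_i)$, $\widehat\lambda(x)=\sum_i c_ie^{i\langle x,t_i\rangle}$ and $s+r\cdot\lambda=\sum_i c_i\delta_{s+rt_i}$. Let $S_c(\Lambda_k,\mathbb V)$ be the space of linear maps $f:\Lambda_k\to\mathbb V$ of the form $f(\lambda)=g(\lambda)$ with $g:\mathbb R^d\to\mathbb V$ continuous, with the topology of locally uniform convergence of such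 representations $g$ (taken modulo polynomials of degree $\le k$). Proposition. (i) For all $s\in\mathbb R^d$ the stochastic integral $$X(s)=\int_0^\infty\!\!\int_{\mathbb S}e^{iu\langle s,\theta\rangle}(1\wedge u)^{k+1}u^{-(\mathcal H+1/2)}\mathcal A(\theta)\,W(du,d\theta)$$ exists and is almost surely unique, and $X=\{X(s)\}$ is a (strictly) stationary, centered, $\mathbb V$-valued Gaussian random field. (ii) $X$ has a version all of whose paths are, for every $\gamma\in(0,1\wedge\epsilon)$, $\gamma$-Hölder continuous on bounded subsets of $\mathbb R^d$. (iii) There is a random element $Y$ of $S_c(\Lambda_k,\mathbb V)$ with $$Y(\lambda)=\int_0^\infty\!\!\int_{\mathbb S}\widehat\lambda(u\theta)\,u^{-\mathcal H-1/2}\mathcal A(\theta)\,W(du,d\theta)\quad\text{a.s., for every }\lambda\in\Lambda_k,$$ such that for every version of $X$ with continuous paths (again denoted $X$) and every $s_0\in\mathbb R^d$, $$\{r^{-\mathcal H}X(s_0+r\cdot\lambda),\ \lambda\in\Lambda_k\}\ \stackrel{d}{\longrightarrow}\ \{Y(\lambda),\ \lambda\in\Lambda_k\}\quad\text{in } S_c(\Lambda_k,\mathbb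 V),\ \text{as } r\downarrow0.$$ The process $Y$ is $\mathcal H$-self-similar, that is, $\{Y(c\cdot\lambda)\}$ and $\{c^{\mathcal H}Y(\lambda)\}$ have the same finite-dimensional distributions for every $c>0$. It is an intrinsic random function of order $k$, that is, linear in $\lambda$, centered, square integrable, and $\mathbb E[Y(w+\lambda)\otimes Y(w+\lambda')]=\mathbb E[Y(\lambda)\otimes Y(\lambda')]$ for all $w\in\mathbb R^d$ and $\lambda,\lambda'\in\Lambda_k$. Moreover $Y$ is not almost surely zero unless $X$ is. -/

import Mathlib

open MeasureTheory ProbabilityTheory Filter Topology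
open scoped ENNReal NNReal

noncomputable section

namespace TangentField

/-! ### Finitely supported measures, the classes `Λ_k` -/

/-- The Euclidean space `ℝ^d`. -/
abbrev Eucl (d : ℕ) : Type := EuclideanSpace ℝ (Fin d)

/-- Complex measures on `ℝ^d` with finite support: `l = ∑ c_i δ_{t_i}` is the finitely supported
function `t_i ↦ c_i`. -/
abbrev FinMeas (d : ℕ) : Type := Eucl d →₀ ℂ

/-- The integral `∫ g dl = ∑ c_i g(t_i)` of a function `g` with values in a complex vector space. -/
abbrev integ {d : ℕ} {V : Type*} [AddCommGroup V] [Module ℂ V] (g : Eucl d → V) :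
    FinMeas d →ₗ[ℂ] V :=
  Finsupp.linearCombination ℂ g

/-- The value of a complex polynomial in `d` variables at a point of `ℝ^d`. -/
def polyEval {d : ℕ} (p : MvPolynomial (Fin d) ℂ) (t : Eucl d) : ℂ :=
  MvPolynomial.eval (fun i => (t i : ℂ)) p

/-- `Λ_k`: the finitely supported measures that annihilate all polynomials of degree `≤ k`. -/
def Lam (k d : ℕ) : Submodule ℂ (FinMeas d) where
  carrier := {l | ∀ p : MvPolynomial (Fin d) ℂ, p.totalDegree ≤ k → integ (polyEval p) l = 0}
  zero_mem' := fun p _ => map_zero _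
  add_mem' := fun {a b} ha hb p hp => by rw [map_add, ha p hp, hb p hp, add_zero]
  smul_mem' := fun c a ha p hp => by rw [map_smul, ha p hp, smul_zero]

/-- The measure `s + r · l`, the image of `l` under `t ↦ s + r t`. -/
def affineFin {d : ℕ} (s : Eucl d) (r : ℝ) : FinMeas d →ₗ[ℂ] FinMeas d :=
  Finsupp.lmapDomain ℂ ℂ (fun t => s + r • t)

theorem integ_affineFin {d : ℕ} {V : Type*} [AddCommGroup V] [Module ℂ V] (g : Eucl d → V)
    (s : Eucl d) (r : ℝ) (l : FinMeas d) :
    integ g (affineFin s r l) = integ (fun t => g (s + r • t)) l := by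
  simp only [integ, affineFin, Finsupp.lmapDomain_apply]
  exact Finsupp.linearCombination_mapDomain ℂ _ l

/-- The polynomial `p(s + r t)` in the variable `t`. -/
def affinePoly {d : ℕ} (s : Eucl d) (r : ℝ) (p : MvPolynomial (Fin d) ℂ) :
    MvPolynomial (Fin d) ℂ :=
  MvPolynomial.bind₁
    (fun i => MvPolynomial.C (s i : ℂ) + MvPolynomial.C (r : ℂ) * MvPolynomial.X i) p

theorem polyEval_affinePoly {d : ℕ} (s : Eucl d) (r : ℝ) (p : MvPolynomial (Fin d) ℂ)
    (t : Eucl d) : polyEval (affinePoly s r p) t = polyEval p (s + r • t) := by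
  unfold polyEval affinePoly
  rw [MvPolynomial.eval, MvPolynomial.eval₂Hom_bind₁]
  congr 1
  ext i <;> simp

theorem totalDegree_affinePoly {d : ℕ} (s : Eucl d) (r : ℝ) (p : MvPolynomial (Fin d) ℂ) :
    (affinePoly s r p).totalDegree ≤ p.totalDegree := by
  unfold affinePoly
  rw [MvPolynomial.bind₁, MvPolynomial.aeval_def, MvPolynomial.eval₂_eq]
  refine MvPolynomial.totalDegree_finsetSum_le fun m hm => ?_
  refine (MvPolynomial.totalDegree_mul _ _).trans ?_
  rw [MvPolynomial.algebraMap_eq, MvPolynomial.totalDegree_C, zero_add]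
  refine (MvPolynomial.totalDegree_finsetProd _ _).trans ?_
  refine le_trans (Finset.sum_le_sum fun i _ => ?_) (MvPolynomial.le_totalDegree hm)
  refine (MvPolynomial.totalDegree_pow _ _).trans ?_
  refine (Nat.mul_le_mul_left _ (?_ : _ ≤ 1)).trans (mul_one _).le
  refine (MvPolynomial.totalDegree_add _ _).trans (max_le ?_ ?_)
  · simp
  · refine (MvPolynomial.totalDegree_mul _ _).trans ?_
    simp

/-- `Λ_k` is stable under `l ↦ s + r · l`. -/
def affine {k d : ℕ} (s : Eucl d) (r : ℝ) : Lam k d →ₗ[ℂ] Lam k d :=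
  (affineFin s r).restrict (fun l hl p hp => by
    rw [integ_affineFin]
    have h := hl (affinePoly s r p) ((totalDegree_affinePoly s r p).trans hp)
    have e : polyEval (affinePoly s r p) = fun t => polyEval p (s + r • t) :=
      funext (polyEval_affinePoly s r p)
    rwa [e] at h)

/-- The Fourier transform `x ↦ ∫ e^{i⟨x,t⟩} l(dt)`. -/
def fourier {d : ℕ} (l : FinMeas d) (x : Eucl d) : ℂ :=
  integ (fun t => Complex.exp (Complex.I * (inner ℝ x t : ℝ))) l

/-! ### The path space `S_c(Λ_k, V)` -/

section PathSpace

variable (k d : ℕ) (V : Type*) [NormedAddCommGroup V] [NormedSpace ℂ V]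

/-- `S_c(Λ_k, V)`: the linear maps `f : Λ_k → V` that have a continuous representation
`g : ℝ^d → V`, that is `f(l) = ∫ g dl` for all `l ∈ Λ_k`. -/
def PathSpace : Type _ :=
  {f : Lam k d →ₗ[ℂ] V // ∃ g : C(Eucl d, V), ∀ l : Lam k d, f l = integ g l}

variable {k d V}

/-- Evaluation of an element of `S_c(Λ_k, V)` at `l ∈ Λ_k`. -/
def PathSpace.eval (f : PathSpace k d V) (l : Lam k d) : V := f.1 l

/-- The element `l ↦ ∫ g dl` of `S_c(Λ_k, V)` represented by the continuous function `g`. -/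
def ofRep (g : C(Eucl d, V)) : PathSpace k d V :=
  ⟨(integ g).domRestrict (Lam k d), g, fun _ => rfl⟩

/-- The topology of `S_c(Λ_k, V)`: locally uniform convergence of representations. Two
representations of the same element differ by a polynomial of degree `≤ k`, and `S_c(Λ_k, V)` has
the quotient topology of `C(ℝ^d, V)` (with its topology of locally uniform convergence)
under `ofRep`. By `PathSpace.isEmbedding_normalized` below, this is the topology of locally
uniform convergence of the representations `t ↦ f(δ_t - ∑ c_j(t) δ_{t_j})` that are normalized to
vanish at suitable points `t_j`. -/
instance : TopologicalSpace (PathSpace k d V) :=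
  TopologicalSpace.coinduced ofRep inferInstance

instance : MeasurableSpace (PathSpace k d V) := borel _

instance : BorelSpace (PathSpace k d V) := ⟨rfl⟩

/-- Suppose that `λ_t = δ_t - ∑ c_j(t) δ_{t_j} ∈ Λ_k` for all `t`, with polynomials `c_j` of degree
`≤ k`. Then `f ↦ (t ↦ f(λ_t))` is an embedding of `S_c(Λ_k, V)` into `C(ℝ^d, V)`. -/
theorem PathSpace.isEmbedding_normalized {ι : Type*} [Fintype ι] (p : ι → Eucl d)
    (c : ι → MvPolynomial (Fin d) ℂ) (hc : ∀ j, (c j).totalDegree ≤ k)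
    (hmem : ∀ t : Eucl d,
      Finsupp.single t 1 - ∑ j, Finsupp.single (p j) (polyEval (c j) t) ∈ Lam k d)
    (J : PathSpace k d V → C(Eucl d, V)) (hJ : ∀ f t, J f t = f.eval ⟨_, hmem t⟩) :
    IsEmbedding J := by
  have hpoly : ∀ j, Continuous (polyEval (c j)) := fun j =>
    (MvPolynomial.continuous_eval (c j)).comp (by fun_prop)
  have key : ∀ (g : C(Eucl d, V)) (t : Eucl d),
      J (ofRep g) t = g t - ∑ j, polyEval (c j) t • g (p j) := by
    intro g t
    rw [hJ]
    simp [PathSpace.eval, ofRep, integ]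
  have hcont : Continuous J := by
    refine continuous_coinduced_dom.2 ?_
    refine ContinuousMap.continuous_of_continuous_uncurry _ ?_
    have : (Function.uncurry fun g t => (J ∘ ofRep) g t) =
        fun q : C(Eucl d, V) × Eucl d => q.1 q.2 - ∑ j, polyEval (c j) q.2 • q.1 (p j) := by
      funext q
      exact key q.1 q.2
    rw [this]
    have h1 : ∀ j, Continuous fun q : C(Eucl d, V) × Eucl d => polyEval (c j) q.2 :=
      fun j => (hpoly j).comp continuous_snd
    have h2 : ∀ j, Continuous fun q : C(Eucl d, V) × Eucl d => q.1 (p j) :=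
      fun j => (continuous_eval_const (p j)).comp continuous_fst
    have h3 : Continuous fun q : C(Eucl d, V) × Eucl d => q.1 q.2 := ContinuousEval.continuous_eval
    exact h3.sub (continuous_finsetSum _ fun j _ => (h1 j).smul (h2 j))
  have hleft : Function.LeftInverse (ofRep : C(Eucl d, V) → PathSpace k d V) J := by
    intro f
    obtain ⟨g, hg⟩ := f.2
    have hf : f = ofRep g := Subtype.ext (LinearMap.ext hg)
    rw [hf]
    refine Subtype.ext (LinearMap.ext fun l => ?_)
    have e : ⇑(J (ofRep g)) = fun t => g t - ∑ j, polyEval (c j) t • g (p j) :=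
      funext (key g)
    have h0 : ∀ j, integ (polyEval (c j)) (l : FinMeas d) = 0 := fun j => l.2 (c j) (hc j)
    change integ (⇑(J (ofRep g))) (l : FinMeas d) = integ (⇑g) (l : FinMeas d)
    rw [e]
    simp only [integ, Finsupp.linearCombination_apply, Finsupp.sum] at h0 ⊢
    simp only [smul_sub, Finset.sum_sub_distrib, Finset.smul_sum]
    rw [Finset.sum_comm]
    simp only [smul_smul]
    simp only [← Finset.sum_smul]
    simp only [smul_eq_mul] at h0
    simp [h0]
  exact hleft.isEmbedding continuous_coinduced_rng hcont

end PathSpace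

/-! ### Operators on a complex Hilbert space -/

section Operators

variable {V : Type*} [NormedAddCommGroup V] [InnerProductSpace ℂ V] [CompleteSpace V]

/-- `u^T = exp(log(u) T)` for `u > 0` and a bounded operator `T`. -/
def opPow (u : ℝ) (T : V →L[ℂ] V) : V →L[ℂ] V := NormedSpace.exp ((Real.log u : ℂ) • T)

variable (V) in
/-- A complete orthonormal system of `V`. -/
def onSystem : Set V := (exists_hilbertBasis ℂ V).choose

/-- The trace `∑ ⟨T e, e⟩` of a positive operator, as an extended nonnegative number; a positive
operator is trace class iff it is finite, and it is then the trace norm. -/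
def posTrace (T : V →L[ℂ] V) : ℝ≥0∞ :=
  ∑' e : onSystem V, ENNReal.ofReal (RCLike.re (inner ℂ (T (e : V)) (e : V)))

variable (V) in
/-- Finite measures with values in the positive trace class operators of `V`. (Countable
additivity is asked for in the operator norm; for positive operators of finite trace this is the
same as countable additivity in the trace norm.) -/
structure TraceClassMeasure (S : Type*) [MeasurableSpace S] where
  /-- The underlying countably additive set function. -/
  toVec : VectorMeasure S (V →L[ℂ] V)
  isPositive : ∀ B, (toVec B).IsPositive
  traceClass : posTrace (toVec Set.univ) < ∞

/-- The trace measure `B ↦ ‖μ(B)‖_tr`. -/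
def TraceClassMeasure.traceMeasure {S : Type*} [MeasurableSpace S] (μ : TraceClassMeasure V S) :
    Measure S :=
  Measure.ofMeasurable (fun B _ => posTrace (μ.toVec B))
    (by simp [posTrace])
    (by
      intro f hf hd
      unfold posTrace
      rw [ENNReal.tsum_comm]
      refine tsum_congr fun e => ?_
      have hc : Continuous fun T : V →L[ℂ] V => RCLike.re (inner ℂ (T (e : V)) (e : V)) := by
        fun_prop
      have h : HasSum (fun i => RCLike.re (inner ℂ (μ.toVec (f i) (e : V)) (e : V)))
          (RCLike.re (inner ℂ (μ.toVec (⋃ i, f i) (e : V)) (e : V))) :=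
        (μ.toVec.m_iUnion hf hd).map
          (AddMonoidHom.mk' (fun T : V →L[ℂ] V => RCLike.re (inner ℂ (T (e : V)) (e : V)))
            (fun S T => by simp)) hc
      rw [← h.tsum_eq]
      exact ENNReal.ofReal_tsum_of_nonneg
        (fun i => (μ.isPositive (f i)).re_inner_nonneg_left _) h.summable)

/-- The trace measure is finite. -/
instance {S : Type*} [MeasurableSpace S] (μ : TraceClassMeasure V S) :
    IsFiniteMeasure μ.traceMeasure :=
  ⟨by
    rw [TraceClassMeasure.traceMeasure, Measure.ofMeasurable_apply _ MeasurableSet.univ]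
    exact μ.traceClass⟩

/-- The cross-covariance operator `E[X ⊗ Y]`, where `(f ⊗ g) h = ⟨h, g⟩ f`. -/
def crossCov {Ω : Type*} [MeasurableSpace Ω] (P : Measure Ω) (X Y : Ω → V) : V →L[ℂ] V :=
  ∫ ω, InnerProductSpace.rankOne ℂ (X ω) (Y ω) ∂P

end Operators

/-! ### Gaussian random measures and stochastic integrals -/

/-- The unit sphere of `ℝ^d`. -/
abbrev USphere (d : ℕ) : Type := Metric.sphere (0 : Eucl d) 1

/-- `ℝ^d ∖ {0}` in polar coordinates `(u, θ)`. -/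
abbrev Polar (d : ℕ) : Type := Set.Ioi (0 : ℝ) × USphere d

/-- The Lebesgue measure `du` on `(0, ∞)`. -/
def radial : Measure (Set.Ioi (0 : ℝ)) := (volume : Measure ℝ).comap Subtype.val

/-- Bounded Borel subsets of `ℝ^d ∖ {0}`. -/
abbrev BddBorel (d : ℕ) : Type :=
  {B : Set (Polar d) // MeasurableSet B ∧ ∃ R : ℝ, ∀ x ∈ B, (x.1 : ℝ) ≤ R}

section Integral

variable {d : ℕ} {V : Type*} [NormedAddCommGroup V] [InnerProductSpace ℂ V] [CompleteSpace V]

/-- The operator valued measure `ν(du, dθ) = du μ(dθ)` on bounded Borel sets: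
`ν(B) = ∫_0^∞ μ{θ : (u,θ) ∈ B} du`. -/
def controlMeasure (μ : TraceClassMeasure V (USphere d)) (B : Set (Polar d)) : V →L[ℂ] V :=
  ∫ u, μ.toVec {θ | (u, θ) ∈ B} ∂radial

/-- The trace measure of `ν(du, dθ) = du μ(dθ)`. -/
def controlTrace (μ : TraceClassMeasure V (USphere d)) : Measure (Polar d) :=
  radial.prod μ.traceMeasure

variable {Ω : Type*} [MeasurableSpace Ω]

/-- `ξ` is a real orthogonal Gaussian random measure with control measure `2⁻¹ ν`,
`ν(du, dθ) = du μ(dθ)`; an element `x` of `V` is real if `conj x = x`. -/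
structure IsRealGaussianMeasure [MeasurableSpace V]
    (conj : V ≃ₗᵢ⋆[ℂ] V) (P : Measure Ω) (μ : TraceClassMeasure V (USphere d))
    (ξ : BddBorel d → Ω → V) : Prop where
  measurable : ∀ B, Measurable (ξ B)
  real : ∀ B, ∀ᵐ ω ∂P, conj (ξ B ω) = ξ B ω
  gaussian : IsGaussianProcess ξ P
  memLp : ∀ B, MemLp (ξ B) 2 P
  centered : ∀ B, ∫ ω, ξ B ω ∂P = 0
  cov : ∀ B C : BddBorel d,
    crossCov P (ξ B) (ξ C) = (2⁻¹ : ℂ) • controlMeasure μ ((B : Set (Polar d)) ∩ C)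

/-- Simple operator valued functions, as formal sums `∑ 1_{B_i} T_i`. -/
abbrev SimpleOp (d : ℕ) (V : Type*) [NormedAddCommGroup V] [InnerProductSpace ℂ V] : Type _ :=
  BddBorel d →₀ (V →L[ℂ] V)

open Classical in
/-- The function `∑ 1_{B_i} T_i`. -/
def SimpleOp.toFun (φ : SimpleOp d V) (x : Polar d) : V →L[ℂ] V :=
  φ.sum fun B T => if x ∈ (B : Set (Polar d)) then T else 0

/-- The integral `∑ T_i W(B_i)` of the simple function `∑ 1_{B_i} T_i`. -/
def SimpleOp.integral (W : BddBorel d → Ω → V) (φ : SimpleOp d V) (ω : Ω) : V :=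
  φ.sum fun B T => T (W B ω)

/-- `I = ∫ f(u,θ) W(du,dθ)` for an operator valued integrand `f`: the extension of the integral of
simple functions by continuity. `I` is the limit in `L²(Ω; V)` of the integrals of simple functions
which converge to `f` strongly, almost everywhere, and whose operator norms are dominated by
a function in `L²(‖ν‖_tr)`. By dominated convergence this contains the approximation of `f` in
`∫ ‖φ_n - f‖_op² d‖ν‖_tr` (pass to a subsequence), and it also covers integrands that are only
strongly measurable in the sense that each `x ↦ f(x) v` is measurable. -/
def IsStochInt (μ : TraceClassMeasure V (USphere d)) (W : BddBorel d → Ω → V) (P : Measure Ω)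
    (f : Polar d → V →L[ℂ] V) (I : Ω → V) : Prop :=
  MemLp I 2 P ∧ ∃ (φ : ℕ → SimpleOp d V) (g : Polar d → ℝ≥0∞),
    Measurable g ∧ ∫⁻ x, g x ^ 2 ∂(controlTrace μ) < ∞ ∧
    (∀ n, ∀ᵐ x ∂(controlTrace μ), ‖(φ n).toFun x‖ₑ ≤ g x) ∧
    (∀ᵐ x ∂(controlTrace μ), ∀ v : V, Tendsto (fun n => (φ n).toFun x v) atTop (𝓝 (f x v))) ∧
    Tendsto (fun n => eLpNorm (fun ω => I ω - (φ n).integral W ω) 2 P) atTop (𝓝 0)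

/-- `f_s(u,θ) = e^{i u ⟨s,θ⟩} (1 ∧ u)^{k+1} u^{-(H+1/2)} A(θ)`. -/
def fieldKernel (k : ℕ) (H : V →L[ℂ] V) (A : USphere d → V →L[ℂ] V) (s : Eucl d)
    (x : Polar d) : V →L[ℂ] V :=
  (Complex.exp (Complex.I * ((x.1 : ℝ) * inner ℝ s (x.2 : Eucl d) : ℝ)) *
      ((min 1 (x.1 : ℝ) : ℝ) : ℂ) ^ (k + 1)) •
    (opPow (x.1 : ℝ) (-(H + (2⁻¹ : ℂ) • ContinuousLinearMap.id ℂ V)) ∘L A x.2)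

/-- `(u,θ) ↦ l̂(uθ) u^{-H-1/2} A(θ)`. -/
def tangentKernel (H : V →L[ℂ] V) (A : USphere d → V →L[ℂ] V) (l : FinMeas d)
    (x : Polar d) : V →L[ℂ] V :=
  fourier l ((x.1 : ℝ) • (x.2 : Eucl d)) •
    (opPow (x.1 : ℝ) (-(H + (2⁻¹ : ℂ) • ContinuousLinearMap.id ℂ V)) ∘L A x.2)

/-! ### Random fields -/

/-- Strict stationarity: shifts do not change the finite-dimensional distributions. -/
def IsStrictlyStationary [MeasurableSpace V] (P : Measure Ω) (X : Eucl d → Ω → V) : Prop :=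
  ∀ (h : Eucl d) (n : ℕ) (s : Fin n → Eucl d),
    IdentDistrib (fun ω i => X (s i + h) ω) (fun ω i => X (s i) ω) P P

/-- The path `g` is `γ`-Hölder continuous on bounded sets. -/
def IsLocHolder (γ : ℝ) (g : Eucl d → V) : Prop :=
  ∀ M : ℝ, ∃ C : ℝ, ∀ s t : Eucl d, ‖s‖ ≤ M → ‖t‖ ≤ M → ‖g s - g t‖ ≤ C * ‖s - t‖ ^ γ

variable {k : ℕ}

/-- A random element of `S_c(Λ_k, V)` is an intrinsic random function of order `k`: it is second
order (square integrable with mean zero) and its cross-covariance is translation invariant. -/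
def IsIRF (P : Measure Ω) (Y : Ω → PathSpace k d V) : Prop :=
  (∀ l, MemLp (fun ω => (Y ω).eval l) 2 P ∧ ∫ ω, (Y ω).eval l ∂P = 0) ∧
  ∀ (w : Eucl d) (l m : Lam k d),
    crossCov P (fun ω => (Y ω).eval (affine w 1 l)) (fun ω => (Y ω).eval (affine w 1 m)) =
      crossCov P (fun ω => (Y ω).eval l) (fun ω => (Y ω).eval m)

/-- `H`-self-similarity: `{Y(c·l)}` and `{c^H Y(l)}` have the same finite-dimensional
distributions, for all `c > 0`. -/
def IsSelfSimilar [MeasurableSpace V] (P : Measure Ω) (H : V →L[ℂ] V)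
    (Y : Ω → PathSpace k d V) : Prop :=
  ∀ c : ℝ, 0 < c → ∀ (n : ℕ) (l : Fin n → Lam k d),
    IdentDistrib (fun ω i => (Y ω).eval (affine 0 c (l i)))
      (fun ω i => opPow c H ((Y ω).eval (l i))) P P

/-- The element `l ↦ r^{-H} g(s + r·l)` of `S_c(Λ_k, V)`, where `g(l) = ∫ g dl`. -/
def rescaled (k : ℕ) (H : V →L[ℂ] V) (s : Eucl d) (r : ℝ) (g : C(Eucl d, V)) :
    PathSpace k d V :=
  ⟨(opPow r (-H)).toLinearMap ∘ₗ ((integ g).domRestrict (Lam k d)) ∘ₗ affine s r,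
    ⟨fun t => opPow r (-H) (g (s + r • t)), by fun_prop⟩, fun l => by
      have h := integ_affineFin g s r (l : FinMeas d)
      have h2 : integ (fun t => opPow r (-H) (g (s + r • t))) (l : FinMeas d) =
          opPow r (-H) (integ (fun t => g (s + r • t)) (l : FinMeas d)) := by
        simp [integ, Finsupp.linearCombination_apply, Finsupp.sum, map_sum]
      exact (congrArg (opPow r (-H)) h).trans h2.symm⟩

end Integral

end TangentField

end

open TangentField

/-! Laws. Since the real and imaginary parts of the noise are independent with equal covariances,
the pseudo-covariances cancel in `W`: for a stochastic integral `I` and a vector `h`, the real part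
of `⟨h, I⟩` is centered Gaussian with variance `E|⟨h, I⟩|² / 2`. Consequently the joint law of
finitely many stochastic integrals is determined by the second moments of all combinations `∑ T_i
I_i` with bounded operators `T_i` (`IsCircularNoise.identDistrib`). These second moments do not
change when the integrand is multiplied by a scalar function of modulus one, and they are multiplied
by `c⁻¹` under the dilation `u ↦ c u`. The two symmetries yield every identity in law. A translation
multiplies the kernels by a phase, which gives stationarity and the intrinsic property of the
tangent field; the homogeneity of `u^{-H-1/2}` gives self-similarity.

Integrability and regularity. The bounds on the spectrum give `‖u^{-H}‖ = O(u^{-b})` with some `b <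
k + 1` for small `u`, and `O(u^{-ε})` for large `u`. Hence `u^{-H-1/2} A(θ)` becomes square
integrable after multiplication by a scalar of size `u^{k+1}` for `u ≤ 1` and `u^γ`, `γ < ε`, for `u
> 1` (`exists_isBaseKernel`). When the increments of a family of multipliers are bounded by `‖s -
t‖^γ` times this weight, the increments of the integrals satisfy the same Hölder bound in `L²`, by
Gaussianity in every `L^p`, and chaining along dyadic grids produces Hölder paths
(`exists_isLocHolder_version`).

Tangent field. The phase `e^{iu⟨t,θ⟩}` alone is too large at low frequencies for the kernel
`u^{-H-1/2}`. Subtracting its Taylor polynomial of degree `k` for `u ≤ 1`, and `1` for `u > 1`,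
gives an admissible family of multipliers (`compPhase`), hence a random continuous function `F`.
Elements of `Λ_k` annihilate the compensating polynomials, so `∫ F dλ` has the kernel of `Y(λ)`, and
`Y` is the class of `F`.

Convergence. By the two symmetries, `r^{-H} X(s₀ + r·λ)` has, jointly in `λ`, the law of `∫ G_r dλ`,
where `G_r` has the kernel of `F` multiplied by `(1 ∧ u/r)^{k+1}` (`identDistrib_rescaled`). All
`G_r` are built from the same noise as `F`, and `G_r - F` only involves frequencies `u < r`. A
maximal inequality then bounds `G_r - F` locally uniformly in `L^p` by a quantity that vanishes as
`r ↓ 0`; almost sure convergence along subsequences of the copies gives convergence in distribution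
of the rescaled fields.

Nonvanishing. If `Y = 0`, differences of order `k + 1` show that the integrals with multipliers
`(e^{iu⟨v,θ⟩} - 1)^{k+1}` vanish for countably many `v` without common zero. Bounded multipliers
preserve vanishing, so a division and a limit show that `X(s) = 0`
(`IsCircularNoise.ae_eq_zero_of_forall`). -/

namespace TangentField

/-! ### Spectral bounds for operator powers -/

section SpectralExp

variable {A : Type*} [NormedRing A] [NormedAlgebra ℂ A] [CompleteSpace A]

/-- The easy half of the spectral mapping theorem for the exponential gives `exp (σ a) ⊆ σ (exp a)`;
this is the other half. -/
theorem spectrum_exp_subset (a : A) :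
    spectrum ℂ (NormedSpace.exp a) ⊆ Complex.exp '' spectrum ℂ a := by
  -- The bicommutant of `a` is closed and commutative, so Gelfand theory describes spectra in it by
  -- characters; it also contains the inverses of its elements, so the spectrum of `a` in it is not
  -- larger than in `A`.
  set B : Subalgebra ℂ A := Subalgebra.centralizer ℂ (Set.centralizer {a}) with hB
  have memB : ∀ x, x ∈ B ↔ ∀ y, a * y = y * a → y * x = x * y := by
    intro x
    rw [hB, Subalgebra.mem_centralizer_iff]
    simp [Set.mem_centralizer_iff]
  have haB : a ∈ B := (memB a).2 fun y hy => hy.symm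
  have hclosed : IsClosed (B : Set A) := by
    rw [hB, Subalgebra.coe_centralizer]
    exact Set.isClosed_centralizer _
  have : CompleteSpace B := hclosed.completeSpace_coe
  have hcomm : ∀ x y : B, x * y = y * x := by
    intro x y
    refine Subtype.ext ?_
    have hy := (memB y).1 y.2 a rfl
    exact ((memB x).1 x.2 y hy).symm
  let : NormedCommRing B := { (inferInstance : NormedRing B) with mul_comm := hcomm }
  let : NormedAlgebra ℚ A := NormedAlgebra.restrictScalars ℚ ℂ A
  let : NormedAlgebra ℚ B := NormedAlgebra.restrictScalars ℚ ℂ B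
  set a' : B := ⟨a, haB⟩
  have hexp : ((NormedSpace.exp a' : B) : A) = NormedSpace.exp a :=
    NormedSpace.map_exp B.val continuous_subtype_val a'
  intro z hz
  have hz' : z ∈ spectrum ℂ (NormedSpace.exp a' : B) := by
    intro h
    refine hz ?_
    have := h.map B.val
    simp only [map_sub, AlgHom.commutes] at this
    rwa [show B.val (NormedSpace.exp a') = NormedSpace.exp a from hexp] at this
  obtain ⟨f, hf⟩ := WeakDual.CharacterSpace.mem_spectrum_iff_exists.1 hz'
  refine ⟨f a', ?_, ?_⟩
  · have h1 : f a' ∈ spectrum ℂ a' := AlgHom.apply_mem_spectrum f a'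
    intro h2
    refine h1 ?_
    obtain ⟨w, hw⟩ := h2
    -- Whatever commutes with `a` commutes with the inverse of `f a' - a`, up to sign, so this
    -- inverse belongs to the bicommutant.
    have hwB : ((w⁻¹ : Aˣ) : A) ∈ B := by
      rw [memB]
      intro y hy
      have hc : Commute y (w : A) := by
        rw [hw]
        exact (Algebra.commute_algebraMap_right _ _).sub_right (Commute.symm hy)
      exact (hc.units_inv_right : _)
    refine ⟨⟨algebraMap ℂ B (f a') - a', ⟨_, hwB⟩, Subtype.ext ?_, Subtype.ext ?_⟩, rfl⟩
    · change (algebraMap ℂ A (f a') - a) * ((w⁻¹ : Aˣ) : A) = 1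
      rw [← hw]; exact w.mul_inv
    · change ((w⁻¹ : Aˣ) : A) * (algebraMap ℂ A (f a') - a) = 1
      rw [← hw]; exact w.inv_mul
  · rw [← hf]
    have := NormedSpace.map_exp (WeakDual.CharacterSpace.toAlgHom f)
      (WeakDual.CharacterSpace.toCLM f).continuous a'
    rw [Complex.exp_eq_exp_ℂ]
    exact this.symm

/-- If `re z < ω` on the spectrum of `a`, then `‖exp (t a)‖ ≤ C exp (t ω)` for `t ≥ 0`. -/
theorem exists_norm_exp_smul_le (a : A) {ω : ℝ} (h : ∀ z ∈ spectrum ℂ a, z.re < ω) :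
    ∃ C : ℝ, 0 < C ∧ ∀ t : ℝ, 0 ≤ t →
      ‖NormedSpace.exp ((t : ℂ) • a)‖ ≤ C * Real.exp (t * ω) := by
  let : NormedAlgebra ℚ A := NormedAlgebra.restrictScalars ℚ ℂ A
  -- The spectral radius is attained on a nonempty spectrum, so the inequality is strict and
  -- Gelfand's formula yields `‖exp(a)^n‖ ≤ exp(ω)^n` for large `n`.
  have hr : spectralRadius ℂ (NormedSpace.exp a) < ENNReal.ofReal (Real.exp ω) := by
    rcases (spectrum ℂ (NormedSpace.exp a)).eq_empty_or_nonempty with he | hne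
    · simp [spectralRadius, he, Real.exp_pos]
    · obtain ⟨z, hz, hzr⟩ := spectrum.exists_nnnorm_eq_spectralRadius_of_nonempty hne
      obtain ⟨w, hw, rfl⟩ := spectrum_exp_subset a hz
      rw [← hzr, ← enorm_eq_nnnorm, ← ofReal_norm, Complex.norm_exp]
      exact (ENNReal.ofReal_lt_ofReal_iff (Real.exp_pos _)).2 (Real.exp_lt_exp.2 (h w hw))
  have ht := spectrum.pow_nnnorm_pow_one_div_tendsto_nhds_spectralRadius (NormedSpace.exp a)
  obtain ⟨N, hN⟩ := eventually_atTop.1 ((ht.eventually (gt_mem_nhds hr)).and (eventually_ge_atTop 1))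
  set q : ℝ := Real.exp ω
  have hq : 0 < q := Real.exp_pos _
  have hpow : ∀ n, N ≤ n → ‖NormedSpace.exp a ^ n‖ ≤ q ^ n := by
    intro n hn
    obtain ⟨h1, h2⟩ := hN n hn
    have hn0 : (0 : ℝ) < n := by exact_mod_cast h2
    have h3 := ENNReal.rpow_le_rpow h1.le hn0.le
    rw [← ENNReal.rpow_mul, one_div, inv_mul_cancel₀ hn0.ne', ENNReal.rpow_one,
      ENNReal.rpow_natCast, ← ENNReal.ofReal_pow hq.le, ← enorm_eq_nnnorm,
      ← ofReal_norm] at h3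
    exact (ENNReal.ofReal_le_ofReal_iff (by positivity)).1 h3
  obtain ⟨C₁, hC₁⟩ : ∃ C₁ : ℝ, ∀ n, ‖NormedSpace.exp a ^ n‖ ≤ C₁ * q ^ n := by
    refine ⟨1 + ∑ n ∈ Finset.range N, ‖NormedSpace.exp a ^ n‖ / q ^ n, fun n => ?_⟩
    by_cases hn : N ≤ n
    · refine (hpow n hn).trans (le_mul_of_one_le_left (by positivity) ?_)
      exact le_add_of_nonneg_right (Finset.sum_nonneg fun i _ => by positivity)
    · rw [← div_le_iff₀ (by positivity)]
      have := Finset.single_le_sum (f := fun n => ‖NormedSpace.exp a ^ n‖ / q ^ n)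
        (fun i _ => by positivity) (Finset.mem_range.2 (not_le.1 hn))
      linarith
  obtain ⟨C₂, hC₂⟩ : ∃ C₂ : ℝ, ∀ s ∈ Set.Icc (0 : ℝ) 1,
      ‖NormedSpace.exp ((s : ℂ) • a)‖ * Real.exp (-(s * ω)) ≤ C₂ := by
    have hc : ContinuousOn (fun s : ℝ => ‖NormedSpace.exp ((s : ℂ) • a)‖ * Real.exp (-(s * ω)))
        (Set.Icc 0 1) := by
      have : Continuous fun s : ℝ => NormedSpace.exp ((s : ℂ) • a) :=
        (NormedSpace.exp_continuous ).comp (by fun_prop)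
      fun_prop
    obtain ⟨C₂, h⟩ := isCompact_Icc.bddAbove_image hc
    exact ⟨C₂, fun s hs => h ⟨s, hs, rfl⟩⟩
  -- Write `t = n + s` with `0 ≤ s < 1`: the bound on powers handles `n`, compactness of `[0, 1]`
  -- handles `s`. The summand `1` makes the constant positive.
  refine ⟨|C₁| * |C₂| + 1, by positivity, fun t ht0 => ?_⟩
  set n := ⌊t⌋₊
  set s := t - n
  have hs : s ∈ Set.Icc (0 : ℝ) 1 :=
    ⟨sub_nonneg.2 (Nat.floor_le ht0), by have := Nat.lt_floor_add_one t; simp only [s]; linarith⟩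
  have hdec : NormedSpace.exp ((t : ℂ) • a) =
      NormedSpace.exp a ^ n * NormedSpace.exp ((s : ℂ) • a) := by
    have e : (t : ℂ) • a = (n : ℕ) • a + (s : ℂ) • a := by
      rw [← Nat.cast_smul_eq_nsmul ℂ, ← add_smul]; congr 1; simp [s]
    rw [e, NormedSpace.exp_add_of_commute, NormedSpace.exp_nsmul]
    exact ((Commute.refl a).smul_left _).smul_right _
  have h1 := hC₁ n
  have h2 := hC₂ s hs
  rw [Real.exp_neg, ← div_eq_mul_inv, div_le_iff₀ (Real.exp_pos _)] at h2
  have h3 : Real.exp (t * ω) = q ^ n * Real.exp (s * ω) := by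
    rw [← Real.exp_nat_mul, ← Real.exp_add]; congr 1; simp [s]; ring
  rw [hdec, h3]
  calc _ ≤ ‖NormedSpace.exp a ^ n‖ * ‖NormedSpace.exp ((s : ℂ) • a)‖ := norm_mul_le _ _
    _ ≤ (|C₁| * q ^ n) * (|C₂| * Real.exp (s * ω)) := by
        gcongr
        · exact h1.trans (by gcongr; exact le_abs_self _)
        · exact h2.trans (by gcongr; exact le_abs_self _)
    _ = |C₁| * |C₂| * (q ^ n * Real.exp (s * ω)) := by ring
    _ ≤ _ := by gcongr; linarith

end SpectralExp

section OpPow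

variable {V : Type*} [NormedAddCommGroup V] [InnerProductSpace ℂ V] [CompleteSpace V]

theorem opPow_mul {u v : ℝ} (hu : 0 < u) (hv : 0 < v) (T : V →L[ℂ] V) :
    opPow (u * v) T = opPow u T * opPow v T := by
  let : NormedAlgebra ℚ (V →L[ℂ] V) := NormedAlgebra.restrictScalars ℚ ℂ _
  unfold opPow
  rw [Real.log_mul hu.ne' hv.ne', Complex.ofReal_add, add_smul,
    NormedSpace.exp_add_of_commute (((Commute.refl T).smul_left _).smul_right _)]

theorem opPow_neg_mul (u : ℝ) (T : V →L[ℂ] V) : opPow u (-T) * opPow u T = 1 := by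
  let : NormedAlgebra ℚ (V →L[ℂ] V) := NormedAlgebra.restrictScalars ℚ ℂ _
  unfold opPow
  rw [← NormedSpace.exp_add_of_commute
    ((((Commute.refl T).neg_left).smul_left _).smul_right _), smul_neg, neg_add_cancel,
    NormedSpace.exp_zero]

theorem opPow_mul_neg (u : ℝ) (T : V →L[ℂ] V) : opPow u T * opPow u (-T) = 1 := by
  simpa using opPow_neg_mul u (-T)

theorem opPow_neg_add_half {u : ℝ} (hu : 0 < u) (T : V →L[ℂ] V) :
    opPow u (-(T + (2⁻¹ : ℂ) • ContinuousLinearMap.id ℂ V)) =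
      ((u ^ (-(2⁻¹ : ℝ)) : ℝ) : ℂ) • opPow u (-T) := by
  let : NormedAlgebra ℚ (V →L[ℂ] V) := NormedAlgebra.restrictScalars ℚ ℂ _
  unfold opPow
  have e : (Real.log u : ℂ) • (-(T + (2⁻¹ : ℂ) • ContinuousLinearMap.id ℂ V)) =
      (Real.log u : ℂ) • (-T) + algebraMap ℂ (V →L[ℂ] V) ((Real.log u * (-2⁻¹) : ℝ) : ℂ) := by
    rw [Algebra.algebraMap_eq_smul_one, neg_add, smul_add, smul_neg _ ((2⁻¹ : ℂ) • _), smul_smul]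
    congr 1
    push_cast
    rw [mul_neg, neg_smul]
    rfl
  rw [e, NormedSpace.exp_add_of_commute (Algebra.commutes _ _).symm,
    ← NormedSpace.algebraMap_exp_comm, ← Complex.exp_eq_exp_ℂ, ← Algebra.commutes,
    ← Algebra.smul_def, ← Complex.ofReal_exp, Real.rpow_def_of_pos hu]

theorem continuousOn_opPow (T : V →L[ℂ] V) : ContinuousOn (fun u => opPow u T) (Set.Ioi 0) := by
  let : NormedAlgebra ℚ (V →L[ℂ] V) := NormedAlgebra.restrictScalars ℚ ℂ _
  unfold opPow
  have h : Continuous fun t : ℝ => NormedSpace.exp ((t : ℂ) • T) :=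
    (NormedSpace.exp_continuous ).comp (by fun_prop)
  exact h.comp_continuousOn (Real.continuousOn_log.mono fun x hx => (ne_of_gt hx))

/-- If `a < re z` on the spectrum of `T`, then `u^{-T} = O(u^{-a})` for large `u`. -/
theorem exists_norm_opPow_neg_le (T : V →L[ℂ] V) {a : ℝ} (h : ∀ z ∈ spectrum ℂ T, a < z.re) :
    ∃ C : ℝ, 0 < C ∧ ∀ u : ℝ, 1 ≤ u → ‖opPow u (-T)‖ ≤ C * u ^ (-a) := by
  obtain ⟨C, hC, hb⟩ := exists_norm_exp_smul_le (-T) (ω := -a) (by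
    intro z hz
    rw [← spectrum.neg_eq, Set.mem_neg] at hz
    have := h _ hz
    simp only [Complex.neg_re] at this
    linarith)
  refine ⟨C, hC, fun u hu => ?_⟩
  rw [Real.rpow_def_of_pos (by linarith)]
  exact hb _ (Real.log_nonneg hu)

/-- If `re z < b` on the spectrum of `T`, then `u^{-T} = O(u^{-b})` for small `u`. -/
theorem exists_norm_opPow_neg_le' (T : V →L[ℂ] V) {b : ℝ} (h : ∀ z ∈ spectrum ℂ T, z.re < b) :
    ∃ C : ℝ, 0 < C ∧ ∀ u : ℝ, 0 < u → u ≤ 1 → ‖opPow u (-T)‖ ≤ C * u ^ (-b) := by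
  obtain ⟨C, hC, hb⟩ := exists_norm_exp_smul_le T h
  refine ⟨C, hC, fun u hu0 hu => ?_⟩
  have := hb (-Real.log u) (neg_nonneg.2 (Real.log_nonpos hu0.le hu))
  rw [Real.rpow_def_of_pos hu0]
  convert! this using 2
  · unfold opPow; congr 1; push_cast; rw [smul_neg, neg_smul]
  · ring_nf

/-- A strict upper bound for the real part of the spectrum can be improved. -/
theorem exists_re_lt_of_spectrum (T : V →L[ℂ] V) {b : ℝ} (h : ∀ z ∈ spectrum ℂ T, z.re < b) :
    ∃ b' < b, ∀ z ∈ spectrum ℂ T, z.re < b' := by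
  rcases (spectrum ℂ T).eq_empty_or_nonempty with he | hne
  · exact ⟨b - 1, by linarith, by simp [he]⟩
  · obtain ⟨z, hz, hmax⟩ := (spectrum.isCompact T).exists_isMaxOn hne
      Complex.continuous_re.continuousOn
    refine ⟨(z.re + b) / 2, by linarith [h z hz], fun w hw => ?_⟩
    have := hmax hw
    simp only [Set.mem_ofPred_eq] at this
    linarith [h z hz]

end OpPow

/-! ### Chaining on dyadic grids -/

section Chaining

variable {d : ℕ} {V : Type*} [NormedAddCommGroup V]

/-- The point `z / 2^n`. -/
noncomputable def gridPt (n : ℕ) (z : Fin d → ℕ) : Fin d → ℝ := fun i => z i / 2 ^ n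

/-- Pairs of neighbouring points of the grid of level `n` in the unit cube. -/
def gridPairs (d n : ℕ) : Finset ((Fin d → ℕ) × (Fin d → ℕ)) :=
  ((Fintype.piFinset fun _ => Finset.range (2 ^ n + 1)) ×ˢ
    (Fintype.piFinset fun _ => Finset.range (2 ^ n + 1))).filter
      fun q => ∀ i, q.1 i ≤ q.2 i + 1 ∧ q.2 i ≤ q.1 i + 1

theorem mem_gridPairs {n : ℕ} {z w : Fin d → ℕ} :
    (z, w) ∈ gridPairs d n ↔
      (∀ i, z i ≤ 2 ^ n ∧ w i ≤ 2 ^ n) ∧ ∀ i, z i ≤ w i + 1 ∧ w i ≤ z i + 1 := by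
  simp [gridPairs, forall_and]

/-- Dropping the neighbour condition makes the count crude: the exponent is `2 * d` instead of `d`.
This is harmless because moments of every order are available. -/
theorem card_gridPairs_le (d n : ℕ) : (gridPairs d n).card ≤ 2 ^ ((n + 1) * (2 * d)) := by
  refine (Finset.card_filter_le _ _).trans ?_
  rw [Finset.card_product, Fintype.card_piFinset]
  simp only [Finset.card_range, Finset.prod_const, Finset.card_univ, Fintype.card_fin]
  rw [← pow_add, ← two_mul, pow_mul 2 (n + 1) (2 * d)]
  refine Nat.pow_le_pow_left ?_ _
  rw [pow_succ]
  have := Nat.one_le_two_pow (n := n)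
  omega

theorem gridPt_mem_Icc {n : ℕ} {z : Fin d → ℕ} (hz : ∀ i, z i ≤ 2 ^ n) :
    gridPt n z ∈ Set.Icc (0 : Fin d → ℝ) 1 := by
  refine ⟨fun i => by simp only [gridPt, Pi.zero_apply]; positivity, fun i => ?_⟩
  simp only [gridPt, Pi.one_apply]
  rw [div_le_one (by positivity)]
  exact_mod_cast hz i

theorem norm_gridPt_sub_le {n : ℕ} {z w : Fin d → ℕ}
    (h : ∀ i, z i ≤ w i + 1 ∧ w i ≤ z i + 1) :
    ‖gridPt n z - gridPt n w‖ ≤ (2 ^ n)⁻¹ := by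
  rw [pi_norm_le_iff_of_nonneg (by positivity)]
  intro i
  have h1 : (z i : ℝ) ≤ w i + 1 := by exact_mod_cast (h i).1
  have h2 : (w i : ℝ) ≤ z i + 1 := by exact_mod_cast (h i).2
  simp only [gridPt, Pi.sub_apply, Real.norm_eq_abs]
  rw [← sub_div, abs_div, abs_of_pos (by positivity : (0 : ℝ) < 2 ^ n), div_eq_mul_inv]
  refine mul_le_of_le_one_left (by positivity) ?_
  rw [abs_le]; constructor <;> linarith

/-- Coordinatewise lower dyadic approximation. -/
noncomputable def gridFloor (n : ℕ) (s : Fin d → ℝ) : Fin d → ℕ := fun i => ⌊s i * 2 ^ n⌋₊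

/-- Dyadic points of the unit cube. -/
def dyadicCube (d : ℕ) : Set (Fin d → ℝ) :=
  {s | ∃ n, ∃ z : Fin d → ℕ, (∀ i, z i ≤ 2 ^ n) ∧ s = gridPt n z}

theorem gridFloor_le {n : ℕ} {s : Fin d → ℝ} (hs : s ∈ Set.Icc (0 : Fin d → ℝ) 1) (i : Fin d) :
    gridFloor n s i ≤ 2 ^ n := by
  have h1 : s i ≤ 1 := hs.2 i
  refine Nat.floor_le_of_le ?_
  push_cast
  exact mul_le_of_le_one_left (by positivity) h1

theorem gridPt_gridFloor_succ (n : ℕ) (s : Fin d → ℝ) :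
    gridPt n (gridFloor n s) = gridPt (n + 1) (fun i => 2 * gridFloor n s i) := by
  funext i
  simp only [gridPt]
  push_cast
  rw [pow_succ]
  field_simp

/-- Since `⌊2y⌋` is `2⌊y⌋` or `2⌊y⌋ + 1`, successive approximations are neighbours on the finer
grid. These are the links of the chain. -/
theorem gridFloor_succ_mem {n : ℕ} {s : Fin d → ℝ} (hs : s ∈ Set.Icc (0 : Fin d → ℝ) 1) :
    (gridFloor (n + 1) s, fun i => 2 * gridFloor n s i) ∈ gridPairs d (n + 1) := by
  have key : ∀ i, 2 * gridFloor n s i ≤ gridFloor (n + 1) s i ∧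
      gridFloor (n + 1) s i ≤ 2 * gridFloor n s i + 1 := by
    intro i
    have h0 : 0 ≤ s i * 2 ^ n := mul_nonneg (hs.1 i) (by positivity)
    have e : s i * 2 ^ (n + 1) = 2 * (s i * 2 ^ n) := by rw [pow_succ]; ring
    have h1 := Nat.floor_le h0
    have h2 := Nat.lt_floor_add_one (s i * 2 ^ n)
    simp only [gridFloor]
    constructor
    · refine Nat.le_floor ?_
      push_cast; rw [e]; linarith
    · refine Nat.lt_succ_iff.1 ((Nat.floor_lt (by rw [e]; positivity)).2 ?_)
      push_cast; rw [e]; linarith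
  refine mem_gridPairs.2 ⟨fun i => ⟨gridFloor_le hs i, ?_⟩, fun i => ?_⟩
  · exact (key i).1.trans (gridFloor_le hs i)
  · have := key i; omega

/-- A dyadic point equals its approximations at all finer levels, so chains ending in dyadic points
are finite and no continuity of the function is needed. -/
theorem gridPt_gridFloor_of_le {m n : ℕ} (h : m ≤ n) (z : Fin d → ℕ) :
    gridPt n (gridFloor n (gridPt m z)) = gridPt m z := by
  funext i
  obtain ⟨j, rfl⟩ := Nat.exists_eq_add_of_le h
  have e : (z i : ℝ) / 2 ^ m * 2 ^ (m + j) = ((z i * 2 ^ j : ℕ) : ℝ) := by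
    push_cast; rw [pow_add]; field_simp
  simp only [gridPt, gridFloor, e, Nat.floor_natCast]
  push_cast
  rw [pow_add]
  field_simp

theorem gridFloor_pair_mem {n : ℕ} {s t : Fin d → ℝ} (hs : s ∈ Set.Icc (0 : Fin d → ℝ) 1)
    (ht : t ∈ Set.Icc (0 : Fin d → ℝ) 1) (h : ‖s - t‖ ≤ (2 ^ n)⁻¹) :
    (gridFloor n s, gridFloor n t) ∈ gridPairs d n := by
  have key : ∀ s t : Fin d → ℝ, s ∈ Set.Icc (0 : Fin d → ℝ) 1 → ‖s - t‖ ≤ (2 ^ n)⁻¹ →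
      ∀ i, gridFloor n s i ≤ gridFloor n t i + 1 := by
    intro s t hs h i
    have h1 := (norm_le_pi_norm (s - t) i).trans h
    rw [Pi.sub_apply, Real.norm_eq_abs, inv_eq_one_div, le_div_iff₀ (by positivity)] at h1
    have h2 : (s i - t i) * 2 ^ n ≤ 1 :=
      (mul_le_mul_of_nonneg_right (le_abs_self _) (by positivity)).trans h1
    have h3 := Nat.lt_floor_add_one (t i * 2 ^ n)
    have h0 : 0 ≤ s i * 2 ^ n := mul_nonneg (hs.1 i) (by positivity)
    simp only [gridFloor]
    refine Nat.lt_succ_iff.1 ((Nat.floor_lt h0).2 ?_)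
    push_cast
    linarith
  exact mem_gridPairs.2 ⟨fun i => ⟨gridFloor_le hs i, gridFloor_le ht i⟩,
    fun i => ⟨key s t hs h i, key t s ht (by rwa [norm_sub_rev]) i⟩⟩

/-- The constant of the chaining argument with exponent `β`. -/
noncomputable def chainBound (β : ℝ) : ℝ := 2 ^ β * (1 + 2 / (1 - 2 ^ (-β)))

theorem chainBound_nonneg {β : ℝ} (hβ : 0 < β) : 0 ≤ chainBound β := by
  have hr1 : (2 : ℝ) ^ (-β) < 1 := Real.rpow_lt_one_of_one_lt_of_neg one_lt_two (neg_lt_zero.2 hβ)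
  have : 0 < 1 - (2 : ℝ) ^ (-β) := sub_pos.2 hr1
  unfold chainBound; positivity

/-- Control of the increments over neighbouring grid points gives a Hölder estimate. -/
theorem norm_sub_le_of_gridPairs {f : (Fin d → ℝ) → V} {κ β : ℝ} (hκ : 0 ≤ κ) (hβ : 0 < β)
    (hf : ∀ n, ∀ q ∈ gridPairs d n,
      ‖f (gridPt n q.1) - f (gridPt n q.2)‖ ≤ κ * (2 ^ (-β)) ^ n)
    {s t : Fin d → ℝ} (hs : s ∈ dyadicCube d) (ht : t ∈ dyadicCube d) :
    ‖f s - f t‖ ≤ κ * chainBound β * ‖s - t‖ ^ β := by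
  set r : ℝ := 2 ^ (-β) with hr
  have hr0 : 0 < r := by positivity
  have hr1 : r < 1 := Real.rpow_lt_one_of_one_lt_of_neg one_lt_two (neg_lt_zero.2 hβ)
  have hr2 : 0 < 1 - r := sub_pos.2 hr1
  have cube : ∀ {s}, s ∈ dyadicCube d → s ∈ Set.Icc (0 : Fin d → ℝ) 1 := by
    rintro s ⟨n, z, hz, rfl⟩; exact gridPt_mem_Icc hz
  -- Telescoping over the levels from `m` to that of `s` leaves a partial sum of a geometric series.
  have chain : ∀ s ∈ dyadicCube d, ∀ m,
      ‖f s - f (gridPt m (gridFloor m s))‖ ≤ κ * (r ^ m / (1 - r)) := by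
    intro s hs m
    have step : ∀ j, ‖f (gridPt (m + j) (gridFloor (m + j) s)) - f (gridPt m (gridFloor m s))‖ ≤
        κ * ((r ^ m - r ^ (m + j)) / (1 - r)) := by
      intro j
      induction j with
      | zero => simp
      | succ j ih =>
        have h1 := hf _ _ (gridFloor_succ_mem (n := m + j) (cube hs))
        simp only [← gridPt_gridFloor_succ] at h1
        have h2 : (r ^ m - r ^ (m + (j + 1))) / (1 - r) =
            r ^ (m + j) + (r ^ m - r ^ (m + j)) / (1 - r) := by
          field_simp; ring
        rw [h2, mul_add]
        refine (norm_sub_le_norm_sub_add_norm_sub _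
          (f (gridPt (m + j) (gridFloor (m + j) s))) _).trans (add_le_add (h1.trans ?_) ih)
        gcongr κ * ?_
        exact pow_le_pow_of_le_one hr0.le hr1.le (Nat.le_succ _)
    obtain ⟨n, z, hz, rfl⟩ := hs
    have h1 := step n
    rw [gridPt_gridFloor_of_le (Nat.le_add_left n m)] at h1
    refine h1.trans ?_
    gcongr
    exact sub_le_self _ (by positivity)
  rcases eq_or_ne s t with rfl | hst
  · simp only [sub_self, norm_zero]
    rw [Real.zero_rpow hβ.ne', mul_zero]
  have hpos : 0 < ‖s - t‖ := norm_pos_iff.2 (sub_ne_zero.2 hst)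
  have hle : ‖s - t‖ ≤ 1 := by
    rw [pi_norm_le_iff_of_nonneg zero_le_one]
    intro i
    have h1 := (cube hs).1 i
    have h2 := (cube hs).2 i
    have h3 := (cube ht).1 i
    have h4 := (cube ht).2 i
    simp only [Pi.zero_apply, Pi.one_apply] at h1 h2 h3 h4
    rw [Pi.sub_apply, Real.norm_eq_abs, abs_le]; constructor <;> linarith
  -- The level with `2^{-(m+1)} < ‖s - t‖ ≤ 2^{-m}`: the upper bound makes the approximations of `s`
  -- and `t` neighbours, the lower bound converts `2^{-βm}` into a multiple of `‖s - t‖^β`.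
  obtain ⟨m, hm1, hm2⟩ := exists_nat_pow_near_of_lt_one hpos hle (by norm_num : (0 : ℝ) < 2⁻¹)
    (by norm_num)
  have hpair := hf m _ (gridFloor_pair_mem (cube hs) (cube ht) (by rwa [inv_pow] at hm2))
  have h1 := chain s hs m
  have h2 := chain t ht m
  have hrm : r ^ m ≤ 2 ^ β * ‖s - t‖ ^ β := by
    have e : r ^ m = 2 ^ β * ((2⁻¹ : ℝ) ^ (m + 1)) ^ β := by
      rw [← Real.rpow_natCast, ← Real.rpow_natCast, ← Real.rpow_mul (by norm_num),
        Real.inv_rpow (by norm_num), ← Real.rpow_neg (by norm_num),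
        ← Real.rpow_mul (by norm_num), ← Real.rpow_add (by norm_num)]
      congr 1; push_cast; ring
    rw [e]
    gcongr
  have h3 : ‖f s - f t‖ ≤ κ * (r ^ m / (1 - r)) + κ * r ^ m + κ * (r ^ m / (1 - r)) := by
    have e : f s - f t = (f s - f (gridPt m (gridFloor m s))) +
        (f (gridPt m (gridFloor m s)) - f (gridPt m (gridFloor m t))) -
        (f t - f (gridPt m (gridFloor m t))) := by abel
    rw [e]
    refine (norm_sub_le _ _).trans (add_le_add ((norm_add_le _ _).trans (add_le_add h1 hpair)) h2)
  refine h3.trans ?_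
  have e : κ * (r ^ m / (1 - r)) + κ * r ^ m + κ * (r ^ m / (1 - r)) =
      κ * (1 + 2 / (1 - r)) * r ^ m := by field_simp; ring
  rw [e, chainBound, ← hr]
  calc κ * (1 + 2 / (1 - r)) * r ^ m ≤ κ * (1 + 2 / (1 - r)) * (2 ^ β * ‖s - t‖ ^ β) := by gcongr
    _ = _ := by ring

/-- The sum of the `p`-th powers of the increments over neighbouring grid points. -/
noncomputable def chainSum (β : ℝ) (p : ℕ) (f : (Fin d → ℝ) → V) : ℝ≥0∞ :=
  ∑' n : ℕ, ENNReal.ofReal (((2 : ℝ) ^ (β * p)) ^ n) *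
    ∑ q ∈ gridPairs d n, ‖f (gridPt n q.1) - f (gridPt n q.2)‖ₑ ^ p

/-- Each increment is one nonnegative term of the sum; taking `p`-th roots gives the hypothesis of
`norm_sub_le_of_gridPairs`. -/
theorem norm_sub_le_of_chainSum {f : (Fin d → ℝ) → V} {β : ℝ} {p : ℕ} (hp : p ≠ 0) (hβ : 0 < β)
    (hf : chainSum β p f ≠ ∞) {s t : Fin d → ℝ} (hs : s ∈ dyadicCube d) (ht : t ∈ dyadicCube d) :
    ‖f s - f t‖ ≤ (chainSum β p f).toReal ^ ((p : ℝ)⁻¹) * chainBound β * ‖s - t‖ ^ β := by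
  refine norm_sub_le_of_gridPairs (by positivity) hβ (fun n q hq => ?_) hs ht
  have h1 : ENNReal.ofReal (((2 : ℝ) ^ (β * p)) ^ n) * ‖f (gridPt n q.1) - f (gridPt n q.2)‖ₑ ^ p ≤
      chainSum β p f := by
    refine le_trans ?_ (ENNReal.le_tsum n)
    gcongr
    exact Finset.single_le_sum (f := fun q : (Fin d → ℕ) × (Fin d → ℕ) =>
      ‖f (gridPt n q.1) - f (gridPt n q.2)‖ₑ ^ p) (fun _ _ => zero_le) hq
  have h2 := ENNReal.toReal_mono hf h1
  rw [ENNReal.toReal_mul, ENNReal.toReal_ofReal (by positivity), ENNReal.toReal_pow,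
    toReal_enorm] at h2
  have h3 : ((2 ^ β) ^ n * ‖f (gridPt n q.1) - f (gridPt n q.2)‖) ^ p ≤
      (chainSum β p f).toReal := by
    refine le_trans (le_of_eq ?_) h2
    rw [mul_pow, Real.rpow_mul (by norm_num), Real.rpow_natCast, ← pow_mul, ← pow_mul, mul_comm n p]
  have h4 := Real.rpow_le_rpow (by positivity) h3 (by positivity : (0 : ℝ) ≤ (p : ℝ)⁻¹)
  rw [Real.pow_rpow_inv_natCast (by positivity) hp] at h4
  rw [Real.rpow_neg (by norm_num), inv_pow, ← div_eq_mul_inv, le_div_iff₀ (by positivity)]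
  linarith

variable {Ω : Type*} [MeasurableSpace Ω] {P : Measure Ω}

theorem measurable_chainSum [MeasurableSpace V] [BorelSpace V] [SecondCountableTopology V]
    {Z : (Fin d → ℝ) → Ω → V} (hZ : ∀ s, Measurable (Z s)) (β : ℝ) (p : ℕ) :
    Measurable fun ω => chainSum β p fun s => Z s ω := by
  unfold chainSum
  refine Measurable.tsum fun n => Measurable.const_mul ?_ _
  exact Finset.measurable_sum _ fun q _ => (((hZ _).sub (hZ _)).enorm.pow_const p)

/-- The constant in the moment estimate for `chainSum`. -/
noncomputable def momentBound (d : ℕ) (β : ℝ) (p : ℕ) (q : ℝ) : ℝ≥0∞ :=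
  2 ^ (2 * d) * (1 - ENNReal.ofReal (2 ^ (β * p + 2 * d - q)))⁻¹

theorem momentBound_ne_top {d : ℕ} {β : ℝ} {p : ℕ} {q : ℝ} (h : β * p + 2 * d < q) :
    momentBound d β p q ≠ ∞ := by
  refine ENNReal.mul_ne_top (by finiteness) (ENNReal.inv_ne_top.2 ?_)
  refine (tsub_pos_of_lt ?_).ne'
  rw [ENNReal.ofReal_lt_one]
  exact Real.rpow_lt_one_of_one_lt_of_neg one_lt_two (by linarith)

/-- Level `n` contributes at most `2^{(n+1)·2d}` pairs at distance at most `2^{-n}`, hence a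
geometric term of ratio `2^{βp + 2d - q}`. If the ratio is at least `1`, then `momentBound` is
infinite and nothing is claimed. -/
theorem lintegral_chainSum_le [MeasurableSpace V] [BorelSpace V] [SecondCountableTopology V]
    {Z : (Fin d → ℝ) → Ω → V} (hZ : ∀ s, Measurable (Z s)) (β : ℝ) (p : ℕ) {q : ℝ} (hq : 0 ≤ q)
    (C : ℝ≥0∞)
    (hC : ∀ s ∈ Set.Icc (0 : Fin d → ℝ) 1, ∀ t ∈ Set.Icc (0 : Fin d → ℝ) 1,
      ∫⁻ ω, ‖Z s ω - Z t ω‖ₑ ^ p ∂P ≤ C * ENNReal.ofReal (‖s - t‖ ^ q)) :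
    ∫⁻ ω, chainSum β p (fun s => Z s ω) ∂P ≤ momentBound d β p q * C := by
  have hm : ∀ s t, Measurable fun ω => ‖Z s ω - Z t ω‖ₑ ^ p :=
    fun s t => ((hZ s).sub (hZ t)).enorm.pow_const p
  unfold chainSum
  rw [lintegral_tsum fun n => (Measurable.const_mul
    (Finset.measurable_sum _ fun q _ => hm _ _) _).aemeasurable]
  have hn : ∀ n : ℕ, ∫⁻ ω, ENNReal.ofReal (((2 : ℝ) ^ (β * p)) ^ n) *
      ∑ q ∈ gridPairs d n, ‖Z (gridPt n q.1) ω - Z (gridPt n q.2) ω‖ₑ ^ p ∂P ≤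
      2 ^ (2 * d) * C * ENNReal.ofReal (2 ^ (β * p + 2 * d - q)) ^ n := by
    intro n
    rw [lintegral_const_mul _ (Finset.measurable_sum _ fun q _ => hm _ _),
      lintegral_finsetSum _ fun q _ => hm _ _]
    have h1 : ∑ x ∈ gridPairs d n, ∫⁻ ω, ‖Z (gridPt n x.1) ω - Z (gridPt n x.2) ω‖ₑ ^ p ∂P ≤
        2 ^ ((n + 1) * (2 * d)) * (C * ENNReal.ofReal (((2 ^ n)⁻¹) ^ q)) := by
      refine (Finset.sum_le_card_nsmul _ _ (C * ENNReal.ofReal (((2 ^ n)⁻¹) ^ q))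
        fun x hx => ?_).trans ?_
      · obtain ⟨h1, h2⟩ := mem_gridPairs.1 (show (x.1, x.2) ∈ gridPairs d n from hx)
        refine (hC _ (gridPt_mem_Icc fun i => (h1 i).1) _
          (gridPt_mem_Icc fun i => (h1 i).2)).trans ?_
        gcongr
        exact norm_gridPt_sub_le h2
      · rw [nsmul_eq_mul]
        gcongr
        exact_mod_cast card_gridPairs_le d n
    refine (mul_le_mul_right h1 _).trans (le_of_eq ?_)
    have e2 : (2 : ℝ≥0∞) ^ ((n + 1) * (2 * d)) =
        2 ^ (2 * d) * ENNReal.ofReal ((2 ^ (2 * (d : ℝ))) ^ n) := by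
      rw [add_mul, one_mul, pow_add, mul_comm, ENNReal.ofReal_pow (by positivity)]
      congr 1
      rw [mul_comm n, pow_mul]
      congr 1
      rw [show (2 * (d : ℝ)) = ((2 * d : ℕ) : ℝ) by push_cast; ring, Real.rpow_natCast,
        ENNReal.ofReal_pow (by norm_num)]
      simp
    have e3 : ENNReal.ofReal (2 ^ (β * p + 2 * d - q)) ^ n = ENNReal.ofReal (((2 : ℝ) ^ (β * p)) ^ n)
        * ENNReal.ofReal ((2 ^ (2 * (d : ℝ))) ^ n) * ENNReal.ofReal (((2 ^ n)⁻¹) ^ q) := by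
      rw [← ENNReal.ofReal_mul (by positivity), ← ENNReal.ofReal_mul (by positivity),
        ← ENNReal.ofReal_pow (by positivity)]
      congr 1
      have e4 : (((2 : ℝ) ^ n)⁻¹) ^ q = (2 ^ (-q)) ^ n := by
        rw [← Real.rpow_natCast, ← Real.rpow_natCast, ← Real.rpow_neg (by norm_num),
          ← Real.rpow_mul (by norm_num), ← Real.rpow_mul (by norm_num)]
        congr 1; ring
      rw [e4, ← mul_pow, ← mul_pow, sub_eq_add_neg, Real.rpow_add (by norm_num),
        Real.rpow_add (by norm_num)]
    rw [e2, e3]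
    ring
  refine (ENNReal.tsum_le_tsum hn).trans (le_of_eq ?_)
  rw [ENNReal.tsum_mul_left, ENNReal.tsum_geometric, momentBound]
  ring

end Chaining

/-! ### Continuous versions of random fields -/

section Version

variable {d : ℕ} {V : Type*} [NormedAddCommGroup V]

/-- The affine map of the unit cube onto the cube `[-2^m, 2^m]^d`. -/
noncomputable def cubeMap (m : ℕ) (x : Fin d → ℝ) : Eucl d :=
  WithLp.toLp 2 fun i => 2 ^ m * (2 * x i - 1)

/-- The inverse of `cubeMap`. -/
noncomputable def cubeInv (m : ℕ) (s : Eucl d) : Fin d → ℝ := fun i => (s i / 2 ^ m + 1) / 2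

theorem cubeMap_cubeInv (m : ℕ) (s : Eucl d) : cubeMap m (cubeInv m s) = s := by
  ext i
  simp only [cubeMap, cubeInv]
  field_simp
  ring

theorem norm_cubeInv_sub_le (m : ℕ) (s t : Eucl d) : ‖cubeInv m s - cubeInv m t‖ ≤ ‖s - t‖ := by
  rw [pi_norm_le_iff_of_nonneg (norm_nonneg _)]
  intro i
  have h := PiLp.norm_apply_le (s - t) i
  have e : (cubeInv m s - cubeInv m t) i = (s - t) i * (2 ^ (m + 1))⁻¹ := by
    simp only [cubeInv, Pi.sub_apply, PiLp.sub_apply, pow_succ]; field_simp; ring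
  rw [e, norm_mul]
  refine (mul_le_of_le_one_right (norm_nonneg _) ?_).trans h
  rw [norm_inv, norm_pow]
  exact inv_le_one_of_one_le₀ (one_le_pow₀ (by norm_num))

/-- Dyadic points of `ℝ^d`. -/
def dyadicPts (d : ℕ) : Set (Eucl d) := {s | ∃ n : ℕ, ∃ z : Fin d → ℤ, ∀ i, s i = z i / 2 ^ n}

theorem cubeInv_mem {m : ℕ} {s : Eucl d} (hs : s ∈ dyadicPts d) (hm : ‖s‖ ≤ 2 ^ m) :
    cubeInv m s ∈ dyadicCube d := by
  obtain ⟨n, z, hz⟩ := hs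
  have hb : ∀ i, |(z i : ℝ)| ≤ 2 ^ (n + m) := by
    intro i
    have h1 := (PiLp.norm_apply_le s i).trans hm
    rw [hz, Real.norm_eq_abs, abs_div, abs_of_pos (by positivity : (0 : ℝ) < 2 ^ n),
      div_le_iff₀ (by positivity), ← pow_add, add_comm] at h1
    exact h1
  have hb1 : ∀ i, 0 ≤ z i + 2 ^ (n + m) := by
    intro i
    have := (abs_le.1 (hb i)).1
    have : (-(2 ^ (n + m)) : ℤ) ≤ z i := by exact_mod_cast this
    linarith
  have hb2 : ∀ i, z i + 2 ^ (n + m) ≤ 2 ^ (n + m + 1) := by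
    intro i
    have := (abs_le.1 (hb i)).2
    have : z i ≤ (2 ^ (n + m) : ℤ) := by exact_mod_cast this
    rw [pow_succ]; linarith
  refine ⟨n + m + 1, fun i => (z i + 2 ^ (n + m)).toNat, fun i => ?_, ?_⟩
  · have := hb2 i
    zify
    rwa [Int.toNat_of_nonneg (hb1 i)]
  · funext i
    have e : (((z i + 2 ^ (n + m)).toNat : ℕ) : ℝ) = z i + 2 ^ (n + m) := by
      have := Int.toNat_of_nonneg (hb1 i)
      have := congrArg (Int.cast : ℤ → ℝ) this
      push_cast at this
      exact this
    simp only [cubeInv, gridPt, hz]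
    rw [e, pow_succ, pow_add]
    field_simp

theorem exists_cubeMap_bounds (d m : ℕ) : ∃ L : ℝ, 0 ≤ L ∧
    (∀ x y : Fin d → ℝ, ‖cubeMap m x - cubeMap m y‖ ≤ L * ‖x - y‖) ∧
    ∀ x ∈ Set.Icc (0 : Fin d → ℝ) 1, ‖cubeMap m x‖ ≤ L := by
  set T : (Fin d → ℝ) →L[ℝ] Eucl d :=
    ((PiLp.continuousLinearEquiv 2 ℝ fun _ : Fin d => ℝ).symm : (Fin d → ℝ) →L[ℝ] Eucl d)
  have hT : ∀ x, T x = WithLp.toLp 2 x := fun x => rfl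
  refine ⟨‖T‖ * 2 ^ (m + 1), by positivity, fun x y => ?_, fun x hx => ?_⟩
  · have e : cubeMap m x - cubeMap m y = T ((2 : ℝ) ^ (m + 1) • (x - y)) := by
      rw [hT]
      ext i
      simp only [cubeMap, PiLp.sub_apply, Pi.smul_apply, Pi.sub_apply, smul_eq_mul, pow_succ]
      ring
    rw [e]
    refine (T.le_opNorm _).trans ?_
    rw [norm_smul, norm_pow, Real.norm_two, mul_assoc]
  · have e : cubeMap m x = T ((2 : ℝ) ^ m • (fun i => 2 * x i - 1)) := by
      rw [hT]; rfl
    rw [e]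
    refine (T.le_opNorm _).trans ?_
    rw [norm_smul, norm_pow, Real.norm_two]
    gcongr
    have h1 : ‖(fun i => 2 * x i - 1 : Fin d → ℝ)‖ ≤ 1 := by
      rw [pi_norm_le_iff_of_nonneg zero_le_one]
      intro i
      have h1 := hx.1 i
      have h2 := hx.2 i
      simp only [Pi.zero_apply, Pi.one_apply] at h1 h2
      rw [Real.norm_eq_abs, abs_le]; constructor <;> linarith
    refine (mul_le_of_le_one_right (by positivity) h1).trans ?_
    exact pow_le_pow_right₀ (by norm_num) (Nat.le_succ _)

/-- Dyadic approximation of a point of `ℝ^d`. -/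
noncomputable def dyadicApprox (n : ℕ) (t : Eucl d) : Eucl d :=
  WithLp.toLp 2 fun i => (⌊t i * 2 ^ n⌋ : ℝ) / 2 ^ n

theorem dyadicApprox_mem (n : ℕ) (t : Eucl d) : dyadicApprox n t ∈ dyadicPts d :=
  ⟨n, fun i => ⌊t i * 2 ^ n⌋, fun _ => rfl⟩

theorem tendsto_dyadicApprox (t : Eucl d) :
    Tendsto (fun n => dyadicApprox n t) atTop (𝓝 t) := by
  have h : Tendsto (fun n : ℕ => fun i => (⌊t i * 2 ^ n⌋ : ℝ) / 2 ^ n) atTop (𝓝 fun i => t i) := by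
    rw [tendsto_pi_nhds]
    intro i
    have h0 : Tendsto (fun n : ℕ => t i - (2⁻¹ : ℝ) ^ n) atTop (𝓝 (t i)) := by
      simpa using (tendsto_pow_atTop_nhds_zero_of_lt_one (by norm_num : (0 : ℝ) ≤ 2⁻¹)
        (by norm_num)).const_sub (t i)
    refine tendsto_of_tendsto_of_tendsto_of_le_of_le h0 tendsto_const_nhds (fun n => ?_)
      fun n => ?_
    · simp only [inv_pow]
      rw [le_div_iff₀ (by positivity), sub_mul, inv_mul_cancel₀ (by positivity)]
      exact (Int.sub_one_lt_floor _).le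
    · simp only
      rw [div_le_iff₀ (by positivity)]
      exact Int.floor_le _
  exact ((PiLp.continuous_toLp 2 fun _ : Fin d => ℝ).tendsto _).comp h

variable {Ω : Type*} [MeasurableSpace Ω] {P : Measure Ω}

theorem lintegral_chainSum_cubeMap_le [MeasurableSpace V] [BorelSpace V]
    [SecondCountableTopology V] {Z : Eucl d → Ω → V} (hZ : ∀ s, Measurable (Z s)) {m : ℕ} {L : ℝ}
    (hL : 0 ≤ L) (hL1 : ∀ x y : Fin d → ℝ, ‖cubeMap m x - cubeMap m y‖ ≤ L * ‖x - y‖)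
    (hL2 : ∀ x ∈ Set.Icc (0 : Fin d → ℝ) 1, ‖cubeMap m x‖ ≤ L)
    (β : ℝ) (p : ℕ) {q : ℝ} (hq : 0 ≤ q) (C : ℝ≥0∞)
    (hC : ∀ s t, ‖s‖ ≤ L → ‖t‖ ≤ L →
      ∫⁻ ω, ‖Z s ω - Z t ω‖ₑ ^ p ∂P ≤ C * ENNReal.ofReal (‖s - t‖ ^ q)) :
    ∫⁻ ω, chainSum β p (fun x => Z (cubeMap m x) ω) ∂P ≤
      momentBound d β p q * (C * ENNReal.ofReal (L ^ q)) := by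
  refine lintegral_chainSum_le (Z := fun x ω => Z (cubeMap m x) ω) (fun s => hZ _) β p hq _
    fun s hs t ht => ?_
  refine (hC _ _ (hL2 s hs) (hL2 t ht)).trans ?_
  rw [mul_assoc, ← ENNReal.ofReal_mul (by positivity), ← Real.mul_rpow hL (norm_nonneg _)]
  gcongr
  exact hL1 s t

/-- Local Hölder continuity along the dyadic points. -/
def HolderOnDyadics (β : ℝ) (x : Eucl d → V) : Prop :=
  ∀ m : ℕ, ∃ C : ℝ, ∀ s ∈ dyadicPts d, ∀ t ∈ dyadicPts d, ‖s‖ ≤ 2 ^ m → ‖t‖ ≤ 2 ^ m →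
    ‖x s - x t‖ ≤ C * ‖s - t‖ ^ β

theorem norm_sub_le_of_chainSum_cubeMap {x : Eucl d → V} {β : ℝ} {p m : ℕ} (hp : p ≠ 0)
    (hβ : 0 < β) (hx : chainSum β p (fun y => x (cubeMap m y)) ≠ ∞) {s t : Eucl d}
    (hs : s ∈ dyadicPts d) (ht : t ∈ dyadicPts d) (hsm : ‖s‖ ≤ 2 ^ m) (htm : ‖t‖ ≤ 2 ^ m) :
    ‖x s - x t‖ ≤ (chainSum β p fun y => x (cubeMap m y)).toReal ^ ((p : ℝ)⁻¹) * chainBound β *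
      ‖s - t‖ ^ β := by
  have h := norm_sub_le_of_chainSum hp hβ hx (cubeInv_mem hs hsm) (cubeInv_mem ht htm)
  simp only [cubeMap_cubeInv] at h
  have := chainBound_nonneg hβ
  refine h.trans ?_
  gcongr
  exact norm_cubeInv_sub_le m s t

theorem HolderOnDyadics.tendsto_limUnder [CompleteSpace V] {β : ℝ} (hβ : 0 < β) {x : Eucl d → V}
    (hx : HolderOnDyadics β x) (t : Eucl d) :
    Tendsto (fun n => x (dyadicApprox n t)) atTop
      (𝓝 (limUnder atTop fun n => x (dyadicApprox n t))) := by
  refine tendsto_nhds_limUnder (cauchySeq_tendsto_of_complete ?_)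
  obtain ⟨m, hm⟩ := pow_unbounded_of_one_lt ‖t‖ one_lt_two
  obtain ⟨C, hC⟩ := hx m
  have ht := tendsto_dyadicApprox t
  obtain ⟨N, hN⟩ := eventually_atTop.1 (ht.norm.eventually (gt_mem_nhds hm))
  have hc := ht.cauchySeq
  rw [cauchySeq_iff_tendsto_dist_atTop_0] at hc ⊢
  have h0 : Tendsto (fun q : ℕ × ℕ => C * dist (dyadicApprox q.1 t) (dyadicApprox q.2 t) ^ β)
      atTop (𝓝 0) := by
    have := (hc.rpow_const (Or.inr hβ.le)).const_mul C
    rwa [Real.zero_rpow hβ.ne', mul_zero] at this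
  refine squeeze_zero' (Eventually.of_forall fun q => dist_nonneg) ?_ h0
  filter_upwards [eventually_ge_atTop (N, N)] with q hq
  rw [dist_eq_norm, dist_eq_norm]
  exact hC _ (dyadicApprox_mem _ _) _ (dyadicApprox_mem _ _) (hN _ hq.1).le (hN _ hq.2).le

theorem HolderOnDyadics.isLocHolder {β γ : ℝ} (hγ : 0 < γ) (hγβ : γ ≤ β) {x y : Eucl d → V}
    (hx : HolderOnDyadics β x) (hy : ∀ t, Tendsto (fun n => x (dyadicApprox n t)) atTop (𝓝 (y t))) :
    ∀ M : ℝ, ∃ C : ℝ, ∀ s t : Eucl d, ‖s‖ ≤ M → ‖t‖ ≤ M → ‖y s - y t‖ ≤ C * ‖s - t‖ ^ γ := by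
  intro M
  have hβ : 0 < β := hγ.trans_le hγβ
  obtain ⟨m, hm⟩ := pow_unbounded_of_one_lt M one_lt_two
  obtain ⟨C, hC⟩ := hx m
  have key : ∀ s t : Eucl d, ‖s‖ ≤ M → ‖t‖ ≤ M → ‖y s - y t‖ ≤ C * ‖s - t‖ ^ β := by
    intro s t hs ht
    have h1 := ((hy s).sub (hy t)).norm
    have h2 : Tendsto (fun n => C * ‖dyadicApprox n s - dyadicApprox n t‖ ^ β) atTop
        (𝓝 (C * ‖s - t‖ ^ β)) :=
      ((((tendsto_dyadicApprox s).sub (tendsto_dyadicApprox t)).norm).rpow_const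
        (Or.inr hβ.le)).const_mul C
    refine le_of_tendsto_of_tendsto h1 h2 ?_
    filter_upwards [(tendsto_dyadicApprox s).norm.eventually (gt_mem_nhds (hs.trans_lt hm)),
      (tendsto_dyadicApprox t).norm.eventually (gt_mem_nhds (ht.trans_lt hm))] with n hn1 hn2
    exact hC _ (dyadicApprox_mem _ _) _ (dyadicApprox_mem _ _) hn1.le hn2.le
  -- On the ball of radius `M` distances are at most `2|M|`, which absorbs the surplus exponent `β -
  -- γ`.
  refine ⟨|C| * (2 * |M|) ^ (β - γ), fun s t hs ht => ?_⟩
  refine (key s t hs ht).trans ?_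
  rcases eq_or_ne s t with rfl | hst
  · simp [Real.zero_rpow hβ.ne', Real.zero_rpow hγ.ne']
  have hpos : 0 < ‖s - t‖ := norm_pos_iff.2 (sub_ne_zero.2 hst)
  have e : ‖s - t‖ ^ β = ‖s - t‖ ^ (β - γ) * ‖s - t‖ ^ γ := by
    rw [← Real.rpow_add hpos]; congr 1; ring
  have h3 : ‖s - t‖ ≤ 2 * |M| := by
    have := norm_sub_le s t
    have := le_abs_self M
    linarith
  rw [e, ← mul_assoc]
  gcongr
  exact le_abs_self C

theorem ae_holderOnDyadics [MeasurableSpace V] [BorelSpace V] [SecondCountableTopology V]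
    {Z : Eucl d → Ω → V} (hZ : ∀ s, Measurable (Z s)) {β γ : ℝ} (hβ : 0 < β) (hβγ : β < γ)
    (hmom : ∀ p : ℕ, p ≠ 0 → ∀ M : ℝ, ∃ C : ℝ≥0∞, C ≠ ∞ ∧ ∀ s t, ‖s‖ ≤ M → ‖t‖ ≤ M →
      ∫⁻ ω, ‖Z s ω - Z t ω‖ₑ ^ p ∂P ≤ C * ENNReal.ofReal (‖s - t‖ ^ (γ * p))) :
    ∀ᵐ ω ∂P, HolderOnDyadics β fun s => Z s ω := by
  -- The loss of `2d` from counting pairs is compensated by a large `p`, since `β < γ`.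
  obtain ⟨p, hp0, hp1⟩ : ∃ p : ℕ, p ≠ 0 ∧ β * p + 2 * d < γ * p := by
    obtain ⟨p, hp⟩ := exists_nat_gt (2 * d / (γ - β))
    rw [div_lt_iff₀ (sub_pos.2 hβγ)] at hp
    refine ⟨p, ?_, by linarith⟩
    rintro rfl
    simp only [Nat.cast_zero, zero_mul] at hp
    have : (0 : ℝ) ≤ 2 * d := by positivity
    linarith
  have hfin : ∀ m : ℕ, ∀ᵐ ω ∂P, chainSum β p (fun x => Z (cubeMap m x) ω) < ∞ := by
    intro m
    obtain ⟨L, hL, hL1, hL2⟩ := exists_cubeMap_bounds d m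
    obtain ⟨C, hC, hC1⟩ := hmom p hp0 L
    have h0 : 0 ≤ γ * p := mul_nonneg (hβ.trans hβγ).le (Nat.cast_nonneg p)
    have hm : Measurable fun ω => chainSum β p (fun x => Z (cubeMap m x) ω) :=
      measurable_chainSum (Z := fun x => Z (cubeMap m x)) (fun s => hZ _) _ _
    refine ae_lt_top hm (ne_top_of_le_ne_top ?_
      (lintegral_chainSum_cubeMap_le hZ hL hL1 hL2 β p h0 C hC1))
    exact ENNReal.mul_ne_top (momentBound_ne_top hp1)
        (ENNReal.mul_ne_top hC ENNReal.ofReal_ne_top)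
  have hall := ae_all_iff.2 hfin
  filter_upwards [hall] with ω hω
  intro m
  exact ⟨(chainSum β p fun x => Z (cubeMap m x) ω).toReal ^ ((p : ℝ)⁻¹) * chainBound β,
    fun s hs t ht hsm htm => norm_sub_le_of_chainSum_cubeMap (x := fun s => Z s ω) hp0
      hβ (hω m).ne hs ht hsm htm⟩

/-- This identifies the pathwise limit along dyadic approximations with the original variable:
convergence in mean has an almost surely convergent subsequence. -/
theorem ae_tendsto_of_moment [MeasurableSpace V] [BorelSpace V] [SecondCountableTopology V]
    {Z : Eucl d → Ω → V} (hZ : ∀ s, Measurable (Z s)) {γ : ℝ} (hγ : 0 < γ)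
    (hmom : ∀ M : ℝ, ∃ C : ℝ≥0∞, C ≠ ∞ ∧ ∀ s t, ‖s‖ ≤ M → ‖t‖ ≤ M →
      ∫⁻ ω, ‖Z s ω - Z t ω‖ₑ ∂P ≤ C * ENNReal.ofReal (‖s - t‖ ^ γ)) (t : Eucl d) :
    ∃ ns : ℕ → ℕ, StrictMono ns ∧
      ∀ᵐ ω ∂P, Tendsto (fun i => Z (dyadicApprox (ns i) t) ω) atTop (𝓝 (Z t ω)) := by
  suffices h : Tendsto (fun n => eLpNorm (Z (dyadicApprox n t) - Z t) 1 P) atTop (𝓝 0) by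
    have hT : TendstoInMeasure P (fun n => Z (dyadicApprox n t)) atTop (Z t) :=
      tendstoInMeasure_of_tendsto_eLpNorm one_ne_zero (fun n => (hZ _).aestronglyMeasurable)
        (hZ _).aestronglyMeasurable h
    exact hT.exists_seq_tendsto_ae
  obtain ⟨C, hC, hC1⟩ := hmom (‖t‖ + 1)
  have h2 : Tendsto (fun n => C * ENNReal.ofReal (‖dyadicApprox n t - t‖ ^ γ)) atTop (𝓝 0) := by
    have h3 : Tendsto (fun n => ‖dyadicApprox n t - t‖ ^ γ) atTop (𝓝 0) := by
      have h4 := ((tendsto_dyadicApprox t).sub_const t).norm.rpow_const (p := γ) (Or.inr hγ.le)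
      rwa [sub_self, norm_zero, Real.zero_rpow hγ.ne'] at h4
    have := ENNReal.Tendsto.const_mul (ENNReal.tendsto_ofReal h3) (Or.inr hC)
    simpa using this
  refine tendsto_of_tendsto_of_tendsto_of_le_of_le' tendsto_const_nhds h2
    (Eventually.of_forall fun _ => zero_le) ?_
  filter_upwards [(tendsto_dyadicApprox t).norm.eventually
    (gt_mem_nhds (lt_add_one ‖t‖))] with n hn
  rw [eLpNorm_one_eq_lintegral_enorm]
  exact hC1 (dyadicApprox n t) t hn.le (by linarith)

/-- Kolmogorov's criterion: moment estimates for the increments give a version with Hölder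
continuous paths. -/
theorem exists_isLocHolder_version [CompleteSpace V] [MeasurableSpace V] [BorelSpace V]
    [SecondCountableTopology V] {X : Eucl d → Ω → V} (hX : ∀ s, AEStronglyMeasurable (X s) P)
    {γ₀ : ℝ} (hγ₀ : 0 < γ₀)
    (hmom : ∀ γ : ℝ, 0 < γ → γ < γ₀ → ∀ p : ℕ, p ≠ 0 → ∀ M : ℝ, ∃ C : ℝ≥0∞, C ≠ ∞ ∧
      ∀ s t, ‖s‖ ≤ M → ‖t‖ ≤ M →
        ∫⁻ ω, ‖X s ω - X t ω‖ₑ ^ p ∂P ≤ C * ENNReal.ofReal (‖s - t‖ ^ (γ * p))) :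
    ∃ Xv : Eucl d → Ω → V, (∀ s, Measurable (Xv s)) ∧ (∀ s, Xv s =ᵐ[P] X s) ∧
      ∀ ω, ∀ γ : ℝ, 0 < γ → γ < γ₀ → ∀ M : ℝ, ∃ C : ℝ, ∀ s t : Eucl d, ‖s‖ ≤ M → ‖t‖ ≤ M →
        ‖Xv s ω - Xv t ω‖ ≤ C * ‖s - t‖ ^ γ := by
  obtain ⟨Z, hZm, hZX⟩ : ∃ Z : Eucl d → Ω → V, (∀ s, Measurable (Z s)) ∧ ∀ s, Z s =ᵐ[P] X s :=
    ⟨fun s => (hX s).mk (X s), fun s => (hX s).stronglyMeasurable_mk.measurable,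
      fun s => (hX s).ae_eq_mk.symm⟩
  have hmomZ : ∀ γ : ℝ, 0 < γ → γ < γ₀ → ∀ p : ℕ, p ≠ 0 → ∀ M : ℝ, ∃ C : ℝ≥0∞, C ≠ ∞ ∧
      ∀ s t, ‖s‖ ≤ M → ‖t‖ ≤ M →
        ∫⁻ ω, ‖Z s ω - Z t ω‖ₑ ^ p ∂P ≤ C * ENNReal.ofReal (‖s - t‖ ^ (γ * p)) := by
    intro γ h1 h2 p hp M
    obtain ⟨C, hC, hC1⟩ := hmom γ h1 h2 p hp M
    refine ⟨C, hC, fun s t hs ht => ?_⟩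
    rw [lintegral_congr_ae (g := fun ω => ‖X s ω - X t ω‖ₑ ^ p)]
    · exact hC1 s t hs ht
    filter_upwards [hZX s, hZX t] with ω h1 h2
    rw [h1, h2]
  -- Exponents increasing to `γ₀` reduce all `γ < γ₀` to countably many almost sure statements.
  obtain ⟨β, hβm, hβ, hβlim⟩ := exists_seq_strictMono_tendsto' hγ₀
  have hae : ∀ᵐ ω ∂P, ∀ j, HolderOnDyadics (β j) fun s => Z s ω := by
    refine ae_all_iff.2 fun j => ?_
    obtain ⟨h1, h2⟩ := hβ j
    exact ae_holderOnDyadics hZm h1 (by linarith : β j < (β j + γ₀) / 2)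
      (hmomZ _ (by linarith) (by linarith))
  obtain ⟨G, hGae, hGm, hHol⟩ := hae.exists_measurable_mem
  -- Outside a measurable set `G` of full measure all paths are set to zero, so that every path is
  -- regular, not only almost every one.
  set Xv : Eucl d → Ω → V := fun t =>
    G.indicator fun ω => limUnder atTop fun n => Z (dyadicApprox n t) ω with hXv
  have hlim : ∀ ω ∈ G, ∀ t, Tendsto (fun n => Z (dyadicApprox n t) ω) atTop (𝓝 (Xv t ω)) := by
    intro ω hω t
    simp only [hXv, Set.indicator_of_mem hω]
    exact (hHol ω hω 0).tendsto_limUnder (hβ 0).1 t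
  refine ⟨Xv, fun t => ?_, fun t => ?_, fun ω γ hγ hγ1 => ?_⟩
  · refine measurable_of_tendsto_metrizable
      (f := fun n => G.indicator (Z (dyadicApprox n t))) (fun n => (hZm _).indicator hGm) ?_
    rw [tendsto_pi_nhds]
    intro ω
    by_cases hω : ω ∈ G
    · simp only [Set.indicator_of_mem hω]
      exact hlim ω hω t
    · simp [hXv, hω]
  · obtain ⟨ns, hns, hae⟩ := ae_tendsto_of_moment hZm (half_pos hγ₀) (fun M => by
      simpa using hmomZ _ (half_pos hγ₀) (by linarith) 1 one_ne_zero M) t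
    filter_upwards [hae, hGae, hZX t] with ω h1 h2 h3
    rw [← h3]
    exact tendsto_nhds_unique ((hlim ω h2 t).comp hns.tendsto_atTop) h1
  · by_cases hω : ω ∈ G
    · obtain ⟨j, hj⟩ := (hβlim.eventually (lt_mem_nhds hγ1)).exists
      exact (hHol ω hω j).isLocHolder hγ hj.le (hlim ω hω)
    · intro M
      refine ⟨0, fun s t _ _ => ?_⟩
      simp [hXv, hω]

/-- A maximal inequality for random fields with continuous paths, from moment estimates for the
increments. -/
theorem exists_maximal_bound [MeasurableSpace V] [BorelSpace V] [SecondCountableTopology V]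
    (P : Measure Ω) (m : ℕ) {p : ℕ} (hp : p ≠ 0) {q : ℝ} (hq : 2 * d < q) : ∃ L : ℝ,
    ∃ c : ℝ≥0∞, c ≠ ∞ ∧ ∀ Z : Eucl d → Ω → V, (∀ s, Measurable (Z s)) →
      (∀ ω, Continuous fun s => Z s ω) →
      ∀ C : ℝ≥0∞, (∀ s t, ‖s‖ ≤ L → ‖t‖ ≤ L →
        ∫⁻ ω, ‖Z s ω - Z t ω‖ₑ ^ p ∂P ≤ C * ENNReal.ofReal (‖s - t‖ ^ q)) →
      ∃ K : Ω → ℝ≥0∞, Measurable K ∧ ∫⁻ ω, K ω ∂P ≤ c * C ∧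
        ∀ ω s, ‖s‖ < 2 ^ m → ‖Z s ω - Z 0 ω‖ₑ ^ p ≤ K ω := by
  obtain ⟨L, hL, hL1, hL2⟩ := exists_cubeMap_bounds d m
  have hp' : (0 : ℝ) < p := by positivity
  -- With this choice `βp + 2d` is the midpoint of `2d` and `q`, so the moment constant is finite.
  -- Neither it nor `L` depends on the field `Z`.
  set β : ℝ := (q - 2 * d) / (2 * p) with hβdef
  have hβ : 0 < β := div_pos (by linarith) (by positivity)
  have hβp : β * p + 2 * d < q := by
    have : β * p = (q - 2 * d) / 2 := by rw [hβdef]; field_simp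
    rw [this]; linarith
  have hq0 : 0 ≤ q := by
    have : (0 : ℝ) ≤ 2 * d := by positivity
    linarith
  set A : ℝ := chainBound β * (2 ^ m) ^ β with hA
  have hA0 : 0 ≤ A := mul_nonneg (chainBound_nonneg hβ) (by positivity)
  -- The summand `1` keeps the factor positive, so that the bound is infinite wherever `chainSum` is
  -- infinite.
  refine ⟨L, ENNReal.ofReal (A ^ p + 1) * (momentBound d β p q * ENNReal.ofReal (L ^ q)),
    ENNReal.mul_ne_top ENNReal.ofReal_ne_top (ENNReal.mul_ne_top (momentBound_ne_top hβp)
      ENNReal.ofReal_ne_top), fun Z hZ hZc C hC => ?_⟩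
  have hm : Measurable fun ω => chainSum β p (fun x => Z (cubeMap m x) ω) :=
    measurable_chainSum (Z := fun x => Z (cubeMap m x)) (fun s => hZ _) _ _
  refine ⟨fun ω => ENNReal.ofReal (A ^ p + 1) * chainSum β p (fun x => Z (cubeMap m x) ω),
    hm.const_mul _, ?_, fun ω => ?_⟩
  · rw [lintegral_const_mul _ hm]
    refine (mul_le_mul_right (lintegral_chainSum_cubeMap_le hZ hL hL1 hL2 β p hq0 C hC) _).trans
      (le_of_eq ?_)
    ring
  intro s hs
  beta_reduce
  set S := chainSum β p (fun x => Z (cubeMap m x) ω)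
  by_cases hS : S = ∞
  · rw [hS, ENNReal.mul_top]
    · exact le_top
    · exact (ENNReal.ofReal_pos.2 (by positivity)).ne'
  have h0 : (0 : Eucl d) ∈ dyadicPts d := ⟨0, 0, fun i => by simp⟩
  have key : ∀ s ∈ dyadicPts d, ‖s‖ ≤ 2 ^ m → ‖Z s ω - Z 0 ω‖ ≤ S.toReal ^ ((p : ℝ)⁻¹) * A := by
    intro s hs hsm
    refine (norm_sub_le_of_chainSum_cubeMap (x := fun s => Z s ω) hp hβ hS hs h0 hsm
      (by simp)).trans ?_
    rw [hA, ← mul_assoc, sub_zero]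
    have := chainBound_nonneg hβ
    gcongr
  have h1 : ‖Z s ω - Z 0 ω‖ ≤ S.toReal ^ ((p : ℝ)⁻¹) * A := by
    have ht := tendsto_dyadicApprox s
    refine le_of_tendsto ((((hZc ω).tendsto s).comp ht).sub_const (Z 0 ω)).norm ?_
    filter_upwards [ht.norm.eventually (gt_mem_nhds hs)] with n hn
    exact key _ (dyadicApprox_mem _ _) hn.le
  have h2 : ‖Z s ω - Z 0 ω‖ ^ p ≤ (A ^ p + 1) * S.toReal := by
    refine (pow_le_pow_left₀ (norm_nonneg _) h1 p).trans ?_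
    rw [mul_pow, Real.rpow_inv_natCast_pow ENNReal.toReal_nonneg hp, mul_comm]
    gcongr
    linarith
  rw [← ofReal_norm, ← ENNReal.ofReal_pow (norm_nonneg _)]
  refine (ENNReal.ofReal_le_ofReal h2).trans ?_
  rw [ENNReal.ofReal_mul (by positivity), ENNReal.ofReal_toReal hS]

end Version

/-! ### The control measure -/

section Basis

variable {V : Type*} [NormedAddCommGroup V] [InnerProductSpace ℂ V] [CompleteSpace V]

theorem exists_coe_eq_onSystem : ∃ b : HilbertBasis (onSystem V) ℂ V, ⇑b = Subtype.val :=
  (exists_hilbertBasis ℂ V).choose_spec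

/-- Distinct orthonormal vectors are at distance `√2`, so the open balls of radius `1/2` around them
are disjoint. -/
theorem countable_onSystem [SecondCountableTopology V] : (onSystem V).Countable := by
  obtain ⟨b, hb⟩ := exists_coe_eq_onSystem (V := V)
  refine Set.PairwiseDisjoint.countable_of_isOpen (s := fun e : V => Metric.ball e 2⁻¹)
    (fun e he f hf hef => ?_) (fun e _ => Metric.isOpen_ball)
    (fun e _ => ⟨e, Metric.mem_ball_self (by norm_num)⟩)
  refine Metric.ball_disjoint_ball ?_
  have ho := b.orthonormal
  have h1 : ∀ e : onSystem V, ‖(e : V)‖ = 1 := fun e => by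
    have := ho.1 e; rwa [hb] at this
  have h2 : inner ℂ (e : V) f = 0 := by
    have := ho.2 (i := ⟨e, he⟩) (j := ⟨f, hf⟩) (by simpa using hef)
    rwa [hb] at this
  have h3 : ‖e - f‖ * ‖e - f‖ = 2 := by
    have := norm_sub_mul_self (𝕜 := ℂ) e f
    rw [h2, h1 ⟨e, he⟩, h1 ⟨f, hf⟩] at this
    rw [this]
    norm_num
  rw [dist_eq_norm]
  nlinarith [norm_nonneg (e - f)]

instance [SecondCountableTopology V] : Countable (onSystem V) := countable_onSystem.to_subtype

/-- Parseval's identity. -/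
theorem tsum_enorm_inner_sq (x : V) :
    ∑' e : onSystem V, ‖inner ℂ (e : V) x‖ₑ ^ 2 = ‖x‖ₑ ^ 2 := by
  obtain ⟨b, hb⟩ := exists_coe_eq_onSystem (V := V)
  have h := b.hasSum_inner_mul_inner x x
  have h2 : HasSum (fun e : onSystem V => ‖inner ℂ (e : V) x‖ ^ 2) (‖x‖ ^ 2) := by
    have h3 := h.mapL Complex.reCLM
    have e1 : Complex.reCLM (inner ℂ x x) = ‖x‖ ^ 2 := by
      rw [inner_self_eq_norm_sq_to_K]; norm_cast
    have e2 : ∀ e : onSystem V, Complex.reCLM (inner ℂ x (b e) * inner ℂ (b e) x) =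
        ‖inner ℂ (e : V) x‖ ^ 2 := by
      intro e
      rw [hb, ← inner_conj_symm x, Complex.conj_mul']
      norm_cast
    simpa only [e1, e2] using h3
  have h4 := ENNReal.ofReal_tsum_of_nonneg (fun e => sq_nonneg _) h2.summable
  rw [h2.tsum_eq] at h4
  simp only [ENNReal.ofReal_pow (norm_nonneg _), ofReal_norm] at h4
  exact h4.symm

/-- The orthogonal projection on the span of finitely many elements of `onSystem V`. -/
noncomputable def proj (F : Finset (onSystem V)) : V →L[ℂ] V :=
  ∑ e ∈ F, InnerProductSpace.rankOne ℂ (e : V) (e : V)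

theorem proj_apply (F : Finset (onSystem V)) (x : V) :
    proj F x = ∑ e ∈ F, inner ℂ (e : V) x • (e : V) := by
  simp [proj]

theorem tendsto_proj (x : V) : Tendsto (fun F => proj F x) atTop (𝓝 x) := by
  obtain ⟨b, hb⟩ := exists_coe_eq_onSystem (V := V)
  have h := b.hasSum_repr x
  simp only [b.repr_apply_apply, hb] at h
  simp only [proj_apply]
  exact h

open Classical in
theorem inner_onSystem (e f : onSystem V) : inner ℂ (e : V) (f : V) = if e = f then 1 else 0 := by
  obtain ⟨b, hb⟩ := exists_coe_eq_onSystem (V := V)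
  have := (orthonormal_iff_ite.1 b.orthonormal) e f
  rwa [hb] at this

open Classical in
theorem inner_onSystem_proj (F : Finset (onSystem V)) (e : onSystem V) (x : V) :
    inner ℂ (e : V) (proj F x) = if e ∈ F then inner ℂ (e : V) x else 0 := by
  simp only [proj_apply, inner_sum, inner_smul_right, inner_onSystem]
  simp

theorem enorm_proj_le (F : Finset (onSystem V)) (x : V) : ‖proj F x‖ₑ ≤ ‖x‖ₑ := by
  have h : ‖proj F x‖ₑ ^ 2 ≤ ‖x‖ₑ ^ 2 := by
    rw [← tsum_enorm_inner_sq, ← tsum_enorm_inner_sq x]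
    refine ENNReal.tsum_le_tsum fun e => ?_
    rw [inner_onSystem_proj]
    split_ifs <;> simp
  exact (ENNReal.pow_le_pow_left_iff two_ne_zero).1 h

end Basis

/-! ### Operator valued measures and their scalar components -/

section Control

variable {V : Type*} [NormedAddCommGroup V] [InnerProductSpace ℂ V] [CompleteSpace V]

/-- The measure `B ↦ ⟨μ(B) a, a⟩`. -/
noncomputable def TraceClassMeasure.scalarMeasure {S : Type*} [MeasurableSpace S]
    (μ : TraceClassMeasure V S)
    (a : V) : Measure S :=
  Measure.ofMeasurable (fun B _ => ENNReal.ofReal (RCLike.re (inner ℂ (μ.toVec B a) a)))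
    (by simp)
    (by
      intro f hf hd
      have hc : Continuous fun T : V →L[ℂ] V => RCLike.re (inner ℂ (T a) a) := by fun_prop
      have h : HasSum (fun i => RCLike.re (inner ℂ (μ.toVec (f i) a) a))
          (RCLike.re (inner ℂ (μ.toVec (⋃ i, f i) a) a)) :=
        (μ.toVec.m_iUnion hf hd).map
          (AddMonoidHom.mk' (fun T : V →L[ℂ] V => RCLike.re (inner ℂ (T a) a))
            (fun S T => by simp)) hc
      rw [← h.tsum_eq]
      exact ENNReal.ofReal_tsum_of_nonneg
        (fun i => (μ.isPositive (f i)).re_inner_nonneg_left _) h.summable)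

variable {S : Type*} [MeasurableSpace S] (μ : TraceClassMeasure V S)

theorem TraceClassMeasure.scalarMeasure_apply (a : V) {B : Set S} (hB : MeasurableSet B) :
    μ.scalarMeasure a B = ENNReal.ofReal (RCLike.re (inner ℂ (μ.toVec B a) a)) :=
  Measure.ofMeasurable_apply _ hB

instance (a : V) : IsFiniteMeasure (μ.scalarMeasure a) :=
  ⟨by rw [μ.scalarMeasure_apply a MeasurableSet.univ]; exact ENNReal.ofReal_lt_top⟩

theorem TraceClassMeasure.traceMeasure_eq_sum :
    μ.traceMeasure = Measure.sum fun e : onSystem V => μ.scalarMeasure (e : V) := by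
  ext B hB
  rw [Measure.sum_apply _ hB, TraceClassMeasure.traceMeasure, Measure.ofMeasurable_apply _ hB]
  unfold posTrace
  exact tsum_congr fun e => (μ.scalarMeasure_apply _ hB).symm

theorem TraceClassMeasure.inner_toVec_self (a : V) {B : Set S} (hB : MeasurableSet B) :
    inner ℂ a (μ.toVec B a) = ((μ.scalarMeasure a B).toReal : ℂ) := by
  rw [μ.scalarMeasure_apply a hB,
    ENNReal.toReal_ofReal ((μ.isPositive B).re_inner_nonneg_left _)]
  have h := (μ.isPositive B).isSelfAdjoint.isSymmetric
  have h1 := h a a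
  rw [← ContinuousLinearMap.coe_coe, ← h1]
  exact (h.coe_re_inner_apply_self a).symm

/-- Positivity on the complement gives `0 ≤ μ(B) ≤ μ(S)` in the operator order, and the norm is
monotone there. Nonmeasurable sets have the default value `0`. -/
theorem TraceClassMeasure.norm_toVec_le (B : Set S) : ‖μ.toVec B‖ ≤ ‖μ.toVec Set.univ‖ := by
  by_cases hB : MeasurableSet B
  · refine CStarAlgebra.norm_le_norm_of_nonneg_of_le
      ((ContinuousLinearMap.nonneg_iff_isPositive _).2 (μ.isPositive B)) ?_
    rw [← sub_nonneg, ← VectorMeasure.of_compl hB]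
    exact (ContinuousLinearMap.nonneg_iff_isPositive _).2 (μ.isPositive _)
  · rw [μ.toVec.not_measurable hB, norm_zero]; exact norm_nonneg _

/-- An induction from rectangles, as for product measures. Measurability in operator norm is
required because `controlMeasure` is a Bochner integral of operators. -/
theorem TraceClassMeasure.stronglyMeasurable_section {R : Type*} [MeasurableSpace R]
    {B : Set (R × S)} (hB : MeasurableSet B) :
    StronglyMeasurable fun u => μ.toVec {θ | (u, θ) ∈ B} := by
  induction B, hB using MeasurableSpace.induction_on_inter generateFrom_prod.symm isPiSystem_prod
    with
  | empty => simpa using stronglyMeasurable_const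
  | basic t ht =>
    obtain ⟨s, hs, t, ht, rfl⟩ := ht
    have : (fun u => μ.toVec {θ | (u, θ) ∈ s ×ˢ t}) = s.indicator fun _ => μ.toVec t := by
      funext u
      by_cases hu : u ∈ s <;> simp [hu]
    rw [this]
    exact stronglyMeasurable_const.indicator hs
  | compl t ht ih =>
    have : (fun u => μ.toVec {θ | (u, θ) ∈ tᶜ}) =
        fun u => μ.toVec Set.univ - μ.toVec {θ | (u, θ) ∈ t} := by
      funext u
      exact VectorMeasure.of_compl (measurable_prodMk_left ht)
    rw [this]
    exact stronglyMeasurable_const.sub ih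
  | iUnion f hd hf ih =>
    refine stronglyMeasurable_of_tendsto atTop
      (f := fun n u => ∑ i ∈ Finset.range n, μ.toVec {θ | (u, θ) ∈ f i})
      (fun n => Finset.stronglyMeasurable_fun_sum _ fun i _ => ih i) ?_
    rw [tendsto_pi_nhds]
    intro u
    have := μ.toVec.m_iUnion (f := fun i => {θ | (u, θ) ∈ f i})
      (fun i => measurable_prodMk_left (hf i))
      (fun i j hij => (hd hij).preimage _)
    have h2 := this.tendsto_sum_nat
    convert! h2 using 2
    congr 1
    ext θ
    simp

end Control

/-! ### The control measure on polar coordinates -/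

section ControlPolar

variable {d : ℕ} {V : Type*} [NormedAddCommGroup V] [InnerProductSpace ℂ V] [CompleteSpace V]
  (μ : TraceClassMeasure V (USphere d))

theorem map_val_radial :
    radial.map (Subtype.val : Set.Ioi (0 : ℝ) → ℝ) = volume.restrict (Set.Ioi 0) := by
  rw [radial, (MeasurableEmbedding.subtype_coe measurableSet_Ioi).map_comap, Subtype.range_coe]

instance : SigmaFinite radial := by
  refine SigmaFinite.of_map radial measurable_subtype_coe.aemeasurable ?_
  rw [map_val_radial]
  infer_instance

theorem radial_le_lt_top (R : ℝ) : radial {u : Set.Ioi (0 : ℝ) | (u : ℝ) ≤ R} < ∞ := by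
  unfold radial
  rw [(MeasurableEmbedding.subtype_coe measurableSet_Ioi).comap_apply]
  refine (measure_mono (?_ : _ ⊆ Set.Icc 0 R)).trans_lt measure_Icc_lt_top
  rintro _ ⟨u, hu, rfl⟩
  exact ⟨u.2.le, hu⟩

theorem integrable_section (B : BddBorel d) :
    Integrable (fun u => μ.toVec {θ | (u, θ) ∈ (B : Set (Polar d))}) radial := by
  obtain ⟨B, hB, R, hR⟩ := B
  refine Measure.integrableOn_of_bounded (s := {u : Set.Ioi (0 : ℝ) | (u : ℝ) ≤ R}) (M := ‖μ.toVec Set.univ‖)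
    (radial_le_lt_top R).ne (μ.stronglyMeasurable_section hB).aestronglyMeasurable
    (Eventually.of_forall fun u => μ.norm_toVec_le _) |>.integrable_of_forall_notMem_eq_zero ?_
  intro u hu
  have : {θ | (u, θ) ∈ B} = ∅ := by
    ext θ
    simp only [Set.mem_ofPred_eq, Set.mem_empty_iff_false, iff_false]
    exact fun h => hu (hR _ h)
  simp [this]

/-- Intersection of bounded Borel sets. -/
def BddBorel.inter (B : BddBorel d) {C : Set (Polar d)} (hC : MeasurableSet C) : BddBorel d :=
  ⟨B ∩ C, B.2.1.inter hC, B.2.2.imp fun _ h x hx => h x hx.1⟩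

theorem inner_controlMeasure (B : BddBorel d) (a b : V) :
    inner ℂ a (controlMeasure μ B b) =
      ∫ u, inner ℂ a (μ.toVec {θ | (u, θ) ∈ (B : Set (Polar d))} b) ∂radial := by
  unfold controlMeasure
  rw [ContinuousLinearMap.integral_apply (integrable_section μ B), ← integral_inner]
  exact (integrable_section μ B).apply_continuousLinearMap b

/-- The measure `B ↦ ⟨ν(B) a, a⟩`, `ν(du, dθ) = du μ(dθ)`. -/
noncomputable def controlScalar (a : V) : Measure (Polar d) := radial.prod (μ.scalarMeasure a)

theorem controlTrace_eq_sum [SecondCountableTopology V] :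
    controlTrace μ = Measure.sum fun e : onSystem V => controlScalar μ (e : V) := by
  unfold controlTrace controlScalar
  rw [μ.traceMeasure_eq_sum, Measure.prod_sum_right]

theorem controlScalar_lt_top (B : BddBorel d) (a : V) : controlScalar μ a B < ∞ := by
  obtain ⟨B, hB, R, hR⟩ := B
  refine (measure_mono (?_ : B ⊆ {u : Set.Ioi (0 : ℝ) | (u : ℝ) ≤ R} ×ˢ Set.univ)).trans_lt ?_
  · exact fun x hx => ⟨hR x hx, trivial⟩
  · unfold controlScalar
    rw [Measure.prod_prod]
    exact ENNReal.mul_lt_top (radial_le_lt_top R) (measure_lt_top _ _)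

theorem inner_controlMeasure_self (B : BddBorel d) (a : V) :
    inner ℂ a (controlMeasure μ B a) = ((controlScalar μ a B).toReal : ℂ) := by
  have h : ∀ u, inner ℂ a (μ.toVec {θ | (u, θ) ∈ (B : Set (Polar d))} a) =
      ((μ.scalarMeasure a (Prod.mk u ⁻¹' B)).toReal : ℂ) :=
    fun u => μ.inner_toVec_self a (measurable_prodMk_left B.2.1)
  rw [inner_controlMeasure]
  simp only [h]
  rw [integral_complex_ofReal]
  congr 1
  rw [integral_toReal, controlScalar, Measure.prod_apply B.2.1]
  · exact (measurable_measure_prodMk_left B.2.1).aemeasurable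
  · exact Eventually.of_forall fun u => measure_lt_top _ _

/-- The dilation `(u, θ) ↦ (c u, θ)`. -/
noncomputable def dilate (c : ℝ) (hc : 0 < c) (x : Polar d) : Polar d :=
  (⟨c * x.1, mul_pos hc x.1.2⟩, x.2)

end ControlPolar

/-! ### Simple functions and their integrals -/

section SimpleAlgebra

variable {d : ℕ} {V : Type*} [NormedAddCommGroup V] [InnerProductSpace ℂ V]

open Classical in
/-- `SimpleOp.toFun` as an additive map. -/
noncomputable def SimpleOp.toFunHom (x : Polar d) : SimpleOp d V →+ (V →L[ℂ] V) :=
  Finsupp.liftAddHom fun B => if x ∈ (B : Set (Polar d)) then AddMonoidHom.id _ else 0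

theorem SimpleOp.toFunHom_apply (x : Polar d) (φ : SimpleOp d V) :
    SimpleOp.toFunHom x φ = φ.toFun x := by
  classical
  simp only [SimpleOp.toFunHom, Finsupp.liftAddHom_apply, SimpleOp.toFun]
  refine Finsupp.sum_congr fun B _ => ?_
  split_ifs <;> rfl

variable {Ω : Type*}

/-- `SimpleOp.integral` as an additive map. -/
noncomputable def SimpleOp.integralHom (W : BddBorel d → Ω → V) (ω : Ω) : SimpleOp d V →+ V :=
  Finsupp.liftAddHom fun B => AddMonoidHom.mk' (fun T : V →L[ℂ] V => T (W B ω)) fun S T => by simp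

theorem SimpleOp.integralHom_apply (W : BddBorel d → Ω → V) (ω : Ω) (φ : SimpleOp d V) :
    SimpleOp.integralHom W ω φ = φ.integral W ω := by
  simp only [SimpleOp.integralHom, Finsupp.liftAddHom_apply, SimpleOp.integral]
  rfl

open Classical in
theorem SimpleOp.toFun_single (B : BddBorel d) (T : V →L[ℂ] V) (x : Polar d) :
    SimpleOp.toFun (Finsupp.single B T : SimpleOp d V) x =
      if x ∈ (B : Set (Polar d)) then T else 0 := by
  rw [SimpleOp.toFun, Finsupp.sum_single_index]
  simp

theorem SimpleOp.integral_single (W : BddBorel d → Ω → V) (B : BddBorel d) (T : V →L[ℂ] V)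
    (ω : Ω) : SimpleOp.integral W (Finsupp.single B T : SimpleOp d V) ω = T (W B ω) := by
  rw [SimpleOp.integral, Finsupp.sum_single_index]
  simp

theorem SimpleOp.toFun_sum {ι : Type*} (s : Finset ι) (φ : ι → SimpleOp d V) (x : Polar d) :
    SimpleOp.toFun (∑ i ∈ s, φ i : SimpleOp d V) x = ∑ i ∈ s, (φ i).toFun x := by
  simp only [← SimpleOp.toFunHom_apply, map_sum]

theorem SimpleOp.integral_sum {ι : Type*} (W : BddBorel d → Ω → V) (s : Finset ι)
    (φ : ι → SimpleOp d V) (ω : Ω) :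
    SimpleOp.integral W (∑ i ∈ s, φ i : SimpleOp d V) ω = ∑ i ∈ s, (φ i).integral W ω := by
  simp only [← SimpleOp.integralHom_apply, map_sum]

theorem SimpleOp.toFun_sub (φ ψ : SimpleOp d V) (x : Polar d) :
    SimpleOp.toFun (φ - ψ) x = φ.toFun x - ψ.toFun x := by
  simp only [← SimpleOp.toFunHom_apply, map_sub]

theorem SimpleOp.integral_sub (W : BddBorel d → Ω → V) (φ ψ : SimpleOp d V) (ω : Ω) :
    SimpleOp.integral W (φ - ψ) ω = φ.integral W ω - ψ.integral W ω := by
  simp only [← SimpleOp.integralHom_apply, map_sub]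

theorem SimpleOp.toFun_add (φ ψ : SimpleOp d V) (x : Polar d) :
    SimpleOp.toFun (φ + ψ) x = φ.toFun x + ψ.toFun x := by
  simp only [← SimpleOp.toFunHom_apply, map_add]

theorem SimpleOp.integral_add (W : BddBorel d → Ω → V) (φ ψ : SimpleOp d V) (ω : Ω) :
    SimpleOp.integral W (φ + ψ) ω = φ.integral W ω + ψ.integral W ω := by
  simp only [← SimpleOp.integralHom_apply, map_add]

/-- Composition with a bounded operator. -/
noncomputable def SimpleOp.comp (T : V →L[ℂ] V) (φ : SimpleOp d V) : SimpleOp d V :=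
  φ.mapRange (fun S => T ∘L S) (by simp)

theorem SimpleOp.toFun_comp (T : V →L[ℂ] V) (φ : SimpleOp d V) (x : Polar d) :
    (SimpleOp.comp T φ).toFun x = T ∘L φ.toFun x := by
  classical
  unfold SimpleOp.comp SimpleOp.toFun
  rw [Finsupp.sum_mapRange_index (by simp), Finsupp.sum, Finsupp.sum,
    ContinuousLinearMap.comp_finsetSum]
  refine Finset.sum_congr rfl fun B _ => ?_
  split_ifs <;> simp

theorem SimpleOp.integral_comp (W : BddBorel d → Ω → V) (T : V →L[ℂ] V) (φ : SimpleOp d V)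
    (ω : Ω) : (SimpleOp.comp T φ).integral W ω = T (φ.integral W ω) := by
  unfold SimpleOp.comp SimpleOp.integral
  rw [Finsupp.sum_mapRange_index (by simp), Finsupp.sum, Finsupp.sum, map_sum]
  rfl

theorem SimpleOp.stronglyMeasurable_toFun (φ : SimpleOp d V) : StronglyMeasurable φ.toFun := by
  classical
  have : φ.toFun = fun x => ∑ B ∈ φ.support, (B : Set (Polar d)).indicator (fun _ => φ B) x := by
    funext x
    simp only [SimpleOp.toFun, Finsupp.sum, Set.indicator]
  rw [this]
  exact Finset.stronglyMeasurable_fun_sum _ fun B _ =>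
    stronglyMeasurable_const.indicator B.2.1

end SimpleAlgebra

/-! ### Second moments of the circular noise -/

section Noise

variable {d : ℕ} {V : Type*} [NormedAddCommGroup V] [InnerProductSpace ℂ V] [CompleteSpace V]
  {Ω : Type*} [MeasurableSpace Ω]

/-- A circularly symmetric complex Gaussian random measure with control measure `du μ(dθ)`. -/
structure IsCircularNoise (P : Measure Ω) (μ : TraceClassMeasure V (USphere d))
    (W : BddBorel d → Ω → V) : Prop where
  memLp : ∀ B, MemLp (W B) 2 P
  cov : ∀ (B C : BddBorel d) (a b : V),
    ∫ ω, inner ℂ a (W B ω) * inner ℂ (W C ω) b ∂P =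
      inner ℂ a (controlMeasure μ ((B : Set (Polar d)) ∩ C) b)
  -- The real part of a circular variable carries half of the second moment, hence `1/4` instead of
  -- the usual `1/2`.
  charFun : ∀ (φ : SimpleOp d V) (h : V),
    ∫ ω, Complex.exp (Complex.I * ((inner ℂ h (φ.integral W ω)).re : ℝ)) ∂P =
      Complex.exp (-(4⁻¹ * (∫ ω, ‖inner ℂ h (φ.integral W ω)‖ ^ 2 ∂P : ℝ)))

variable {P : Measure Ω} {μ : TraceClassMeasure V (USphere d)} {W : BddBorel d → Ω → V}

theorem IsCircularNoise.memLp_integral (hW : IsCircularNoise P μ W) (φ : SimpleOp d V) :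
    MemLp (φ.integral W) 2 P := by
  have : φ.integral W = fun ω => ∑ B ∈ φ.support, φ B (W B ω) := rfl
  rw [this]
  exact memLp_finsetSum _ fun B _ => (φ B).comp_memLp' (hW.memLp B)

theorem IsCircularNoise.memLp_inner (hW : IsCircularNoise P μ W) (a : V) (B : BddBorel d) :
    MemLp (fun ω => inner ℂ a (W B ω)) 2 P := (hW.memLp B).const_inner a

theorem IsCircularNoise.memLp_inner' (hW : IsCircularNoise P μ W) (a : V) (B : BddBorel d) :
    MemLp (fun ω => inner ℂ (W B ω) a) 2 P := (hW.memLp B).inner_const a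

theorem IsCircularNoise.integral_sum_mul_sum (hW : IsCircularNoise P μ W) {ι κ : Type*}
    (s : Finset ι) (t : Finset κ) (g : ι → V) (h : κ → V) (B : ι → BddBorel d)
    (C : κ → BddBorel d) :
    ∫ ω, (∑ i ∈ s, inner ℂ (g i) (W (B i) ω)) * (∑ j ∈ t, inner ℂ (W (C j) ω) (h j)) ∂P =
      ∑ i ∈ s, ∑ j ∈ t, inner ℂ (g i) (controlMeasure μ ((B i : Set (Polar d)) ∩ C j) (h j)) := by
  simp only [Finset.sum_mul_sum]
  have hint : ∀ i j, Integrable (fun ω => inner ℂ (g i) (W (B i) ω) * inner ℂ (W (C j) ω) (h j)) P :=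
    fun i j => (hW.memLp_inner (g i) (B i)).integrable_mul (hW.memLp_inner' (h j) (C j))
  rw [integral_finsetSum _ fun i _ => integrable_finsetSum _ fun j _ => hint i j]
  refine Finset.sum_congr rfl fun i _ => ?_
  rw [integral_finsetSum _ fun j _ => hint i j]
  exact Finset.sum_congr rfl fun j _ => hW.cov _ _ _ _

/-- Second moments of finite sums, in terms of the control measure. -/
theorem IsCircularNoise.integral_norm_sum_sq (hW : IsCircularNoise P μ W) {ι : Type*}
    (s : Finset ι) (g : ι → V) (B : ι → BddBorel d) :
    ((∫ ω, ‖∑ i ∈ s, inner ℂ (g i) (W (B i) ω)‖ ^ 2 ∂P : ℝ) : ℂ) =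
      ∑ i ∈ s, ∑ j ∈ s, inner ℂ (g i) (controlMeasure μ ((B i : Set (Polar d)) ∩ B j) (g j)) := by
  rw [← hW.integral_sum_mul_sum, ← integral_complex_ofReal]
  refine integral_congr_ae (Eventually.of_forall fun ω => ?_)
  simp only
  have : ∑ j ∈ s, inner ℂ (W (B j) ω) (g j) =
      starRingEnd ℂ (∑ j ∈ s, inner ℂ (g j) (W (B j) ω)) := by
    rw [map_sum]
    exact Finset.sum_congr rfl fun j _ => (inner_conj_symm _ _).symm
  rw [this, Complex.mul_conj']
  push_cast
  rfl

theorem integrable_norm_sq {E : Type*} [NormedAddCommGroup E] {f : Ω → E} (hf : MemLp f 2 P) :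
    Integrable (fun ω => ‖f ω‖ ^ 2) P :=
  (memLp_two_iff_integrable_sq_norm hf.1).1 hf

theorem lintegral_enorm_sq_eq {E : Type*} [NormedAddCommGroup E] {f : Ω → E} (hf : MemLp f 2 P) :
    ∫⁻ ω, ‖f ω‖ₑ ^ 2 ∂P = ENNReal.ofReal (∫ ω, ‖f ω‖ ^ 2 ∂P) := by
  rw [ofReal_integral_eq_lintegral_ofReal (integrable_norm_sq hf)
    (Eventually.of_forall fun _ => sq_nonneg _)]
  refine lintegral_congr fun ω => ?_
  rw [ENNReal.ofReal_pow (norm_nonneg _), ofReal_norm]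

theorem lintegral_enorm_sq_eq_eLpNorm {E : Type*} [NormedAddCommGroup E] (f : Ω → E) :
    ∫⁻ ω, ‖f ω‖ₑ ^ 2 ∂P = eLpNorm f 2 P ^ 2 := by
  have := eLpNorm_nnreal_pow_eq_lintegral (f := f) (μ := P) (p := 2) two_ne_zero
  simp only [NNReal.coe_ofNat, ENNReal.rpow_ofNat, ENNReal.coe_ofNat] at this
  exact this.symm

theorem controlMeasure_empty : controlMeasure μ (∅ : Set (Polar d)) = 0 := by
  simp [controlMeasure]

theorem IsCircularNoise.lintegral_enorm_sum_sq_of_disjoint (hW : IsCircularNoise P μ W)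
    {ι : Type*} (s : Finset ι) (g : ι → V) (B : ι → BddBorel d)
    (hB : Pairwise fun i j => Disjoint (B i : Set (Polar d)) (B j)) :
    ∫⁻ ω, ‖∑ i ∈ s, inner ℂ (g i) (W (B i) ω)‖ₑ ^ 2 ∂P =
      ∑ i ∈ s, controlScalar μ (g i) (B i) := by
  classical
  have hm : MemLp (fun ω => ∑ i ∈ s, inner ℂ (g i) (W (B i) ω)) 2 P :=
    memLp_finsetSum s fun i _ => hW.memLp_inner (g i) (B i)
  rw [lintegral_enorm_sq_eq hm]
  have h := hW.integral_norm_sum_sq s g B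
  have h2 : ∀ i ∈ s, ∑ j ∈ s, inner ℂ (g i)
      (controlMeasure μ ((B i : Set (Polar d)) ∩ B j) (g j)) =
      ((controlScalar μ (g i) (B i)).toReal : ℂ) := by
    intro i hi
    rw [Finset.sum_eq_single i]
    · rw [Set.inter_self, inner_controlMeasure_self]
    · intro j _ hij
      rw [(hB hij.symm).inter_eq, controlMeasure_empty]; simp
    · exact fun h => absurd hi h
  rw [Finset.sum_congr rfl h2, ← Complex.ofReal_sum] at h
  rw [Complex.ofReal_injective h, ENNReal.ofReal_sum_of_nonneg fun _ _ => ENNReal.toReal_nonneg]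
  exact Finset.sum_congr rfl fun i _ => ENNReal.ofReal_toReal (controlScalar_lt_top μ _ _).ne

variable [SecondCountableTopology V]

/-- Almost sure finite additivity. -/
theorem IsCircularNoise.ae_eq_sum (hW : IsCircularNoise P μ W) {ι : Type*}
    (s : Finset ι) (A : ι → BddBorel d) (B : BddBorel d)
    (hA : Pairwise fun i j => Disjoint (A i : Set (Polar d)) (A j))
    (hB : (B : Set (Polar d)) = ⋃ i ∈ s, (A i : Set (Polar d))) :
    W B =ᵐ[P] fun ω => ∑ i ∈ s, W (A i) ω := by
  classical
  have key : ∀ a : V, ∀ᵐ ω ∂P, inner ℂ a (W B ω - ∑ i ∈ s, W (A i) ω) = 0 := by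
    intro a
    set Z : Ω → ℂ := fun ω => inner ℂ a (W B ω) - ∑ i ∈ s, inner ℂ a (W (A i) ω) with hZ
    have hn : controlScalar μ a B = ∑ i ∈ s, controlScalar μ a (A i) := by
      rw [hB, measure_biUnion_finset (fun i _ j _ hij => hA hij) fun i _ => (A i).2.1]
    have hself : ∀ C : BddBorel d, inner ℂ a (controlMeasure μ C a) =
        ((controlScalar μ a C).toReal : ℂ) := fun C => inner_controlMeasure_self μ C a
    have hcross : ∀ j ∈ s, ∑ i ∈ s, inner ℂ a
        (controlMeasure μ ((A i : Set (Polar d)) ∩ A j) a) =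
          ((controlScalar μ a (A j)).toReal : ℂ) := by
      intro j hj
      rw [Finset.sum_eq_single j]
      · rw [Set.inter_self, hself]
      · intro i _ hij
        rw [(hA hij).inter_eq, controlMeasure_empty]; simp
      · exact fun h => absurd hj h
    have hsub : ∀ i ∈ s, (A i : Set (Polar d)) ⊆ B := fun i hi => by
      rw [hB]; exact Set.subset_biUnion_of_mem (u := fun i => (A i : Set (Polar d))) hi
    have hint : ∀ C D : BddBorel d,
        Integrable (fun ω => inner ℂ a (W C ω) * inner ℂ (W D ω) a) P :=
      fun C D => (hW.memLp_inner a C).integrable_mul (hW.memLp_inner' a D)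
    -- The defect of additivity is orthogonal to each variable of which it is a linear combination,
    -- so its second moment is zero.
    have horth : ∀ C : BddBorel d, (C = B ∨ ∃ j ∈ s, C = A j) →
        ∫ ω, Z ω * inner ℂ (W C ω) a ∂P = 0 := by
      intro C hC
      simp only [hZ, sub_mul, Finset.sum_mul]
      rw [integral_sub (hint _ _) (integrable_finsetSum _ fun i _ => hint _ _),
        integral_finsetSum _ fun i _ => hint _ _]
      simp only [hW.cov]
      rcases hC with rfl | ⟨j, hj, rfl⟩
      · rw [Set.inter_self, hself, hn]
        have hi : ∀ i ∈ s, inner ℂ a (controlMeasure μ ((A i : Set (Polar d)) ∩ C) a) =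
            ((controlScalar μ a (A i)).toReal : ℂ) := fun i hi => by
          rw [Set.inter_eq_left.2 (hsub i hi), hself (A i)]
        rw [Finset.sum_congr rfl hi]
        rw [ENNReal.toReal_sum fun i _ => (controlScalar_lt_top μ _ _).ne]
        push_cast
        exact sub_self _
      · rw [Set.inter_eq_right.2 (hsub j hj), hself, hcross j hj, sub_self]
    have hZm : MemLp Z 2 P :=
      (hW.memLp_inner a B).sub (memLp_finsetSum _ fun i _ => hW.memLp_inner a (A i))
    have hZ0 : ((∫ ω, ‖Z ω‖ ^ 2 ∂P : ℝ) : ℂ) = 0 := by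
      rw [← integral_complex_ofReal]
      have : ∀ ω, ((‖Z ω‖ ^ 2 : ℝ) : ℂ) =
          Z ω * inner ℂ (W B ω) a - ∑ i ∈ s, Z ω * inner ℂ (W (A i) ω) a := by
        intro ω
        rw [← Finset.mul_sum, ← mul_sub]
        push_cast
        rw [← Complex.mul_conj']
        congr 1
        simp only [hZ, map_sub, map_sum, inner_conj_symm]
      simp only [this]
      have hi : ∀ C, Integrable (fun ω => Z ω * inner ℂ (W C ω) a) P := fun C =>
        hZm.integrable_mul (hW.memLp_inner' a C)
      rw [integral_sub (hi _) (integrable_finsetSum _ fun i _ => hi _),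
        integral_finsetSum _ fun i _ => hi _, horth B (Or.inl rfl),
        Finset.sum_eq_zero fun i hi => horth _ (Or.inr ⟨i, hi, rfl⟩), sub_zero]
    have h3 := (integral_eq_zero_iff_of_nonneg (fun _ => sq_nonneg _)
      (integrable_norm_sq hZm)).1 (Complex.ofReal_eq_zero.1 hZ0)
    filter_upwards [h3] with ω hω
    have : Z ω = 0 := by simpa using hω
    rw [inner_sub_right, inner_sum]
    exact this
  have h2 : ∀ᵐ ω ∂P, ∀ e : onSystem V, inner ℂ (e : V) (W B ω - ∑ i ∈ s, W (A i) ω) = 0 :=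
    ae_all_iff.2 fun e => key e
  filter_upwards [h2] with ω hω
  have := tsum_enorm_inner_sq (W B ω - ∑ i ∈ s, W (A i) ω)
  simp only [hω] at this
  rw [← sub_eq_zero, ← enorm_eq_zero]
  simpa using this.symm

/-- The measure `B ↦ E ‖T W(B)‖²`. -/
noncomputable def opScalar (μ : TraceClassMeasure V (USphere d)) (T : V →L[ℂ] V) :
    Measure (Polar d) :=
  Measure.sum fun e : onSystem V => controlScalar μ (ContinuousLinearMap.adjoint T (e : V))

theorem lintegral_enorm_sq_eq_tsum {f : Ω → V} (hf : AEStronglyMeasurable f P) :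
    ∫⁻ ω, ‖f ω‖ₑ ^ 2 ∂P = ∑' e : onSystem V, ∫⁻ ω, ‖inner ℂ (e : V) (f ω)‖ₑ ^ 2 ∂P := by
  simp only [← tsum_enorm_inner_sq (f _)]
  exact lintegral_tsum fun e => ((hf.const_inner).enorm.pow_const 2)

/-- Parseval's identity reduces this to the coordinates `⟨e, T W(B)⟩ = ⟨T* e, W(B)⟩`, where
disjointness removes the cross terms. -/
theorem IsCircularNoise.lintegral_enorm_sum_comp_sq (hW : IsCircularNoise P μ W) {ι : Type*}
    (s : Finset ι) (T : ι → V →L[ℂ] V) (B : ι → BddBorel d)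
    (hB : Pairwise fun i j => Disjoint (B i : Set (Polar d)) (B j)) :
    ∫⁻ ω, ‖∑ i ∈ s, T i (W (B i) ω)‖ₑ ^ 2 ∂P = ∑ i ∈ s, opScalar μ (T i) (B i) := by
  have hm : MemLp (fun ω => ∑ i ∈ s, T i (W (B i) ω)) 2 P :=
    memLp_finsetSum s fun i _ => (T i).comp_memLp' (hW.memLp (B i))
  rw [lintegral_enorm_sq_eq_tsum hm.aestronglyMeasurable]
  simp only [inner_sum, ← ContinuousLinearMap.adjoint_inner_left]
  simp only [hW.lintegral_enorm_sum_sq_of_disjoint s _ B hB]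
  rw [Summable.tsum_finsetSum fun _ _ => ENNReal.summable]
  refine Finset.sum_congr rfl fun i _ => ?_
  rw [opScalar, Measure.sum_apply _ (B i).2.1]

theorem IsCircularNoise.lintegral_enorm_comp_sq (hW : IsCircularNoise P μ W) (T : V →L[ℂ] V)
    (B : BddBorel d) : ∫⁻ ω, ‖T (W B ω)‖ₑ ^ 2 ∂P = opScalar μ T B := by
  have := hW.lintegral_enorm_sum_comp_sq (Finset.univ : Finset Unit) (fun _ => T) (fun _ => B)
    (fun i j h => absurd (Subsingleton.elim i j) h)
  simpa using this

theorem IsCircularNoise.lintegral_enorm_sq (hW : IsCircularNoise P μ W) (B : BddBorel d) :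
    ∫⁻ ω, ‖W B ω‖ₑ ^ 2 ∂P = controlTrace μ B := by
  have := hW.lintegral_enorm_comp_sq (ContinuousLinearMap.id ℂ V) B
  simpa [opScalar, controlTrace_eq_sum, ContinuousLinearMap.adjoint_id] using this

/-- The part of the control measure outside of finitely many coordinates. -/
noncomputable def tailMeasure (μ : TraceClassMeasure V (USphere d)) (F : Finset (onSystem V)) :
    Measure (Polar d) :=
  Measure.sum fun e : {e : onSystem V // e ∉ F} => controlScalar μ (e : V)

theorem tailMeasure_le (μ : TraceClassMeasure V (USphere d)) (F : Finset (onSystem V)) :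
    tailMeasure μ F ≤ controlTrace μ := by
  refine Measure.le_iff.2 fun B hB => ?_
  rw [tailMeasure, controlTrace_eq_sum, Measure.sum_apply _ hB, Measure.sum_apply _ hB]
  exact ENNReal.tsum_comp_le_tsum_of_injective Subtype.val_injective _

theorem IsCircularNoise.lintegral_enorm_sub_proj_sq (hW : IsCircularNoise P μ W)
    (F : Finset (onSystem V)) (B : BddBorel d) :
    ∫⁻ ω, ‖W B ω - proj F (W B ω)‖ₑ ^ 2 ∂P = tailMeasure μ F B := by
  classical
  have hm : MemLp (fun ω => W B ω - proj F (W B ω)) 2 P :=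
    (hW.memLp B).sub ((proj F).comp_memLp' (hW.memLp B))
  rw [lintegral_enorm_sq_eq_tsum hm.aestronglyMeasurable, tailMeasure,
    Measure.sum_apply _ B.2.1]
  have h1 : ∀ e : onSystem V, ∫⁻ ω, ‖inner ℂ (e : V) (W B ω)‖ₑ ^ 2 ∂P =
      controlScalar μ (e : V) B := by
    intro e
    have := hW.lintegral_enorm_sum_sq_of_disjoint (Finset.univ : Finset Unit) (fun _ => (e : V))
      (fun _ => B) (fun i j h => absurd (Subsingleton.elim i j) h)
    simpa using this
  have h2 : ∀ e : onSystem V, ∫⁻ ω, ‖inner ℂ (e : V) (W B ω - proj F (W B ω))‖ₑ ^ 2 ∂P =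
      Set.indicator {e | e ∉ F} (fun e : onSystem V => controlScalar μ (e : V) B) e := by
    intro e
    simp only [inner_sub_right, inner_onSystem_proj]
    by_cases he : e ∈ F
    · simp [he]
    · simp [he, h1]
  simp only [h2]
  exact (tsum_subtype {e : onSystem V | e ∉ F} fun e => controlScalar μ (e : V) B).symm

theorem add_sq_le_ennreal (a b : ℝ≥0∞) : (a + b) ^ 2 ≤ 2 * a ^ 2 + 2 * b ^ 2 := by
  rcases eq_or_ne a ∞ with rfl | ha
  · simp
  rcases eq_or_ne b ∞ with rfl | hb
  · simp
  lift a to ℝ≥0 using ha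
  lift b to ℝ≥0 using hb
  norm_cast
  rw [← NNReal.coe_le_coe]
  push_cast
  nlinarith [sq_nonneg ((a : ℝ) - b)]

/-- The noise is split into finitely many coordinates and the rest. For fixed `F`, strong
convergence of operators makes the first term small, while the second is small uniformly over
dominated operators. This is what permits strong instead of norm convergence of integrands. -/
theorem IsCircularNoise.opScalar_le (hW : IsCircularNoise P μ W) (F : Finset (onSystem V))
    (T : V →L[ℂ] V) (B : BddBorel d) :
    opScalar μ T B ≤ 2 * (‖T ∘L proj F‖ₑ ^ 2 * controlTrace μ B) +
      2 * (‖T‖ₑ ^ 2 * tailMeasure μ F B) := by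
  have hm := (hW.memLp B).aestronglyMeasurable
  have hm2 : AEStronglyMeasurable (fun ω => W B ω - proj F (W B ω)) P :=
    hm.sub ((proj F).continuous.comp_aestronglyMeasurable hm)
  rw [← hW.lintegral_enorm_comp_sq, ← hW.lintegral_enorm_sq, ← hW.lintegral_enorm_sub_proj_sq,
    ← lintegral_const_mul'' _ (hm.enorm.pow_const 2), ← lintegral_const_mul'' _ (hm2.enorm.pow_const 2),
    ← lintegral_const_mul'' _ ((hm.enorm.pow_const 2).const_mul _),
    ← lintegral_const_mul'' _ ((hm2.enorm.pow_const 2).const_mul _),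
    ← lintegral_add_left' (((hm.enorm.pow_const 2).const_mul _).const_mul _)]
  refine lintegral_mono fun ω => ?_
  rw [← mul_pow, ← mul_pow]
  refine le_trans ?_ (add_sq_le_ennreal _ _)
  gcongr
  have e : T (W B ω) = (T ∘L proj F) (W B ω) + T (W B ω - proj F (W B ω)) := by simp
  rw [e]
  exact (enorm_add_le _ _).trans (add_le_add ((T ∘L proj F).le_opENorm _) (T.le_opENorm _))

end Noise

/-! ### The stochastic integral -/

section Disjoint

variable {d : ℕ} {V : Type*} [NormedAddCommGroup V] [InnerProductSpace ℂ V] [CompleteSpace V]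
  {Ω : Type*} [MeasurableSpace Ω] {P : Measure Ω} {μ : TraceClassMeasure V (USphere d)}
  {W : BddBorel d → Ω → V}

/-- The atoms of the algebra generated by finitely many bounded Borel sets. -/
def atom (s σ : Finset (BddBorel d)) : BddBorel d :=
  ⟨{x | (∀ B ∈ s, (x ∈ (B : Set (Polar d)) ↔ B ∈ σ)) ∧ σ ⊆ s ∧ σ.Nonempty}, by
    have : {x : Polar d | (∀ B ∈ s, (x ∈ (B : Set (Polar d)) ↔ B ∈ σ)) ∧ σ ⊆ s ∧ σ.Nonempty} =
        (⋂ B ∈ s, {x | x ∈ (B : Set (Polar d)) ↔ B ∈ σ}) ∩ {_x | σ ⊆ s ∧ σ.Nonempty} := by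
      ext x; simp
    rw [this]
    refine (Finset.measurableSet_biInter _ fun B _ => ?_).inter (MeasurableSet.const _)
    exact MeasurableSet.iff B.2.1 (MeasurableSet.const _), by
    -- The atom with empty `σ` would be the unbounded complement of all the sets; every other atom
    -- lies in a member of `s`.
    choose R hR using fun B : BddBorel d => B.2.2
    refine ⟨∑ B ∈ s, |R B|, ?_⟩
    rintro x ⟨h1, h2, B, hB⟩
    refine (hR B x ((h1 B (h2 hB)).2 hB)).trans ((le_abs_self _).trans ?_)
    exact Finset.single_le_sum (f := fun B => |R B|) (fun _ _ => abs_nonneg _) (h2 hB)⟩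

theorem mem_atom {s σ : Finset (BddBorel d)} {x : Polar d} :
    x ∈ (atom s σ : Set (Polar d)) ↔
      (∀ B ∈ s, (x ∈ (B : Set (Polar d)) ↔ B ∈ σ)) ∧ σ ⊆ s ∧ σ.Nonempty := Iff.rfl

theorem disjoint_atom (s : Finset (BddBorel d)) :
    Pairwise fun σ τ => Disjoint (atom s σ : Set (Polar d)) (atom s τ) := by
  intro σ τ hne
  refine Set.disjoint_left.2 fun x h1 h2 => hne ?_
  obtain ⟨h1, hs1, -⟩ := mem_atom.1 h1
  obtain ⟨h2, hs2, -⟩ := mem_atom.1 h2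
  ext B
  exact ⟨fun h => (h2 B (hs1 h)).1 ((h1 B (hs1 h)).2 h),
    fun h => (h1 B (hs2 h)).1 ((h2 B (hs2 h)).2 h)⟩

open Classical in
/-- Every simple function can be written with disjoint sets, without changing the integral. -/
theorem IsCircularNoise.exists_disjoint [SecondCountableTopology V] (hW : IsCircularNoise P μ W)
    (φ : SimpleOp d V) : ∃ (s : Finset (Finset (BddBorel d))) (A : Finset (BddBorel d) → BddBorel d)
      (T : Finset (BddBorel d) → V →L[ℂ] V),
      (Pairwise fun i j => Disjoint (A i : Set (Polar d)) (A j)) ∧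
      (∀ x, φ.toFun x = ∑ i ∈ s, if x ∈ (A i : Set (Polar d)) then T i else 0) ∧
      φ.integral W =ᵐ[P] fun ω => ∑ i ∈ s, T i (W (A i) ω) := by
  refine ⟨φ.support.powerset, atom φ.support, fun σ => ∑ B ∈ σ, φ B, disjoint_atom _, fun x => ?_,
    ?_⟩
  · set σ := φ.support.filter fun B : BddBorel d => x ∈ (B : Set (Polar d)) with hσ
    have h1 : φ.toFun x = ∑ B ∈ σ, φ B := by
      rw [SimpleOp.toFun, Finsupp.sum, hσ, Finset.sum_filter]
    rw [h1]
    by_cases hne : σ.Nonempty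
    · rw [Finset.sum_eq_single σ, if_pos]
      · refine mem_atom.2 ⟨fun B hB => ?_, Finset.filter_subset _ _, hne⟩
        simp only [hσ, Finset.mem_filter, hB, true_and]
      · intro τ hτ hne'
        refine if_neg fun hx => hne' ?_
        obtain ⟨h2, h3, -⟩ := mem_atom.1 hx
        ext B
        simp only [hσ, Finset.mem_filter]
        exact ⟨fun h => ⟨h3 h, (h2 B (h3 h)).2 h⟩, fun h => (h2 B h.1).1 h.2⟩
      · exact fun h => absurd (Finset.mem_powerset.2 (Finset.filter_subset _ _)) h
    · rw [Finset.not_nonempty_iff_eq_empty.1 hne, Finset.sum_empty]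
      refine (Finset.sum_eq_zero fun τ _ => if_neg fun hx => hne ?_).symm
      obtain ⟨h2, h3, B, hB⟩ := mem_atom.1 hx
      exact ⟨B, Finset.mem_filter.2 ⟨h3 hB, (h2 B (h3 hB)).2 hB⟩⟩
  · have h : ∀ B ∈ φ.support, W B =ᵐ[P] fun ω =>
        ∑ σ ∈ φ.support.powerset.filter (fun σ => B ∈ σ), W (atom φ.support σ) ω := by
      intro B hB
      refine hW.ae_eq_sum _ _ _ (disjoint_atom _) ?_
      ext x
      simp only [Set.mem_iUnion, Finset.mem_filter, Finset.mem_powerset, exists_prop]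
      constructor
      · intro hx
        refine ⟨φ.support.filter fun B : BddBorel d => x ∈ (B : Set (Polar d)),
          ⟨Finset.filter_subset _ _, Finset.mem_filter.2 ⟨hB, hx⟩⟩, mem_atom.2
          ⟨fun C hC => ?_, Finset.filter_subset _ _, B, Finset.mem_filter.2 ⟨hB, hx⟩⟩⟩
        simp only [Finset.mem_filter, hC, true_and]
      · rintro ⟨σ, ⟨h1, h2⟩, h3⟩
        exact ((mem_atom.1 h3).1 B hB).2 h2
    have h2 : ∀ᵐ ω ∂P, ∀ B ∈ φ.support, W B ω =
        ∑ σ ∈ φ.support.powerset.filter (fun σ => B ∈ σ), W (atom φ.support σ) ω :=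
      (ae_ball_iff φ.support.countable_toSet).2 h
    filter_upwards [h2] with ω hω
    rw [SimpleOp.integral, Finsupp.sum]
    rw [Finset.sum_congr rfl fun B hB => congrArg (φ B) (hω B hB)]
    simp only [map_sum, sum_apply, Finset.sum_filter, apply_ite, map_zero]
    rw [Finset.sum_comm]
    refine Finset.sum_congr rfl fun σ hσ => ?_
    rw [← Finset.sum_filter]
    refine Finset.sum_congr ?_ fun _ _ => rfl
    ext B
    simp only [Finset.mem_filter]
    exact ⟨fun h => h.2, fun h => ⟨Finset.mem_powerset.1 hσ h, h⟩⟩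

open Classical in
-- At most one summand is nonzero, so `G` need not be additive; it is applied to squared norms.
theorem apply_sum_ite_of_disjoint {ι α M N : Type*} [AddCommMonoid M] [AddCommMonoid N]
    (s : Finset ι) (A : ι → Set α) (hA : Pairwise fun i j => Disjoint (A i) (A j)) (T : ι → M)
    (G : M → N) (hG : G 0 = 0) (x : α) :
    G (∑ i ∈ s, if x ∈ A i then T i else 0) = ∑ i ∈ s, if x ∈ A i then G (T i) else 0 := by
  by_cases h : ∃ i ∈ s, x ∈ A i
  · obtain ⟨i, hi, hx⟩ := h
    have h0 : ∀ j ∈ s, j ≠ i → x ∉ A j := fun j _ hj hxj =>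
      Set.disjoint_left.1 (hA hj) hxj hx
    rw [Finset.sum_eq_single i (fun j hj hne => if_neg (h0 j hj hne)) (fun h => absurd hi h),
      Finset.sum_eq_single i (fun j hj hne => if_neg (h0 j hj hne)) (fun h => absurd hi h),
      if_pos hx, if_pos hx]
  · push Not at h
    rw [Finset.sum_eq_zero fun i hi => if_neg (h i hi),
      Finset.sum_eq_zero fun i hi => if_neg (h i hi), hG]

open Classical in
theorem lintegral_of_disjoint (m : Measure (Polar d)) {ι : Type*} (s : Finset ι)
    (A : ι → BddBorel d) (hA : Pairwise fun i j => Disjoint (A i : Set (Polar d)) (A j))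
    (T : ι → V →L[ℂ] V) (G : (V →L[ℂ] V) → ℝ≥0∞) (hG : G 0 = 0) :
    ∫⁻ x, G (∑ i ∈ s, if x ∈ (A i : Set (Polar d)) then T i else 0) ∂m =
      ∑ i ∈ s, G (T i) * m (A i) := by
  have h : ∀ x, G (∑ i ∈ s, if x ∈ (A i : Set (Polar d)) then T i else 0) =
      ∑ i ∈ s, (A i : Set (Polar d)).indicator (fun _ => G (T i)) x := by
    intro x
    rw [apply_sum_ite_of_disjoint s (fun i => (A i : Set (Polar d))) hA T G hG]
    simp only [Set.indicator]
  simp only [h]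
  rw [lintegral_finsetSum _ fun i _ => measurable_const.indicator (A i).2.1]
  refine Finset.sum_congr rfl fun i _ => ?_
  rw [lintegral_indicator (A i).2.1, setLIntegral_const]

variable [SecondCountableTopology V]

theorem IsCircularNoise.lintegral_integral_sq_le (hW : IsCircularNoise P μ W)
    (F : Finset (onSystem V)) (φ : SimpleOp d V) :
    ∫⁻ ω, ‖φ.integral W ω‖ₑ ^ 2 ∂P ≤
      2 * ∫⁻ x, ‖φ.toFun x ∘L proj F‖ₑ ^ 2 ∂(controlTrace μ) +
        2 * ∫⁻ x, ‖φ.toFun x‖ₑ ^ 2 ∂(tailMeasure μ F) := by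
  classical
  obtain ⟨s, A, T, hA, hf, hi⟩ := hW.exists_disjoint φ
  rw [lintegral_congr_ae (g := fun ω => ‖∑ i ∈ s, T i (W (A i) ω)‖ₑ ^ 2)
      (hi.mono fun ω hω => by simp only [hω]),
    hW.lintegral_enorm_sum_comp_sq s T A hA]
  simp only [hf]
  rw [lintegral_of_disjoint (controlTrace μ) s A hA T (fun S => ‖S ∘L proj F‖ₑ ^ 2) (by simp),
    lintegral_of_disjoint (tailMeasure μ F) s A hA T (fun S => ‖S‖ₑ ^ 2) (by simp),
    Finset.mul_sum, Finset.mul_sum, ← Finset.sum_add_distrib]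
  exact Finset.sum_le_sum fun i _ => hW.opScalar_le F (T i) (A i)

/-- With no coordinates selected only the tail term remains. The factor `2` is not sharp, but only
boundedness is needed. -/
theorem IsCircularNoise.lintegral_integral_sq_le' (hW : IsCircularNoise P μ W)
    (φ : SimpleOp d V) :
    ∫⁻ ω, ‖φ.integral W ω‖ₑ ^ 2 ∂P ≤ 2 * ∫⁻ x, ‖φ.toFun x‖ₑ ^ 2 ∂(controlTrace μ) := by
  refine (hW.lintegral_integral_sq_le ∅ φ).trans ?_
  have h1 : (proj ∅ : V →L[ℂ] V) = 0 := by simp [proj]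
  simp only [h1, ContinuousLinearMap.comp_zero, enorm_zero]
  simp only [ne_eq, OfNat.ofNat_ne_zero, not_false_eq_true, zero_pow, lintegral_zero, mul_zero,
    zero_add]
  gcongr
  exact tailMeasure_le μ ∅

theorem tendsto_lintegral_tailMeasure {g : Polar d → ℝ≥0∞}
    (hg : ∫⁻ x, g x ∂(controlTrace μ) ≠ ∞) :
    Tendsto (fun F => ∫⁻ x, g x ∂(tailMeasure μ F)) atTop (𝓝 0) := by
  simp only [tailMeasure, lintegral_sum_measure]
  rw [controlTrace_eq_sum, lintegral_sum_measure] at hg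
  exact ENNReal.tendsto_tsum_compl_atTop_zero hg

/-- Dominated convergence for integrals of simple functions. -/
theorem IsCircularNoise.tendsto_lintegral_integral_sq (hW : IsCircularNoise P μ W) {ι : Type*}
    {l : Filter ι} [l.IsCountablyGenerated] (φ : ι → SimpleOp d V) {g : Polar d → ℝ≥0∞}
    (hgi : ∫⁻ x, g x ^ 2 ∂(controlTrace μ) < ∞)
    (hφg : ∀ i, ∀ᵐ x ∂(controlTrace μ), ‖(φ i).toFun x‖ₑ ≤ g x)
    (hφ : ∀ᵐ x ∂(controlTrace μ), ∀ v : V, Tendsto (fun i => (φ i).toFun x v) l (𝓝 0)) :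
    Tendsto (fun i => ∫⁻ ω, ‖(φ i).integral W ω‖ₑ ^ 2 ∂P) l (𝓝 0) := by
  rw [ENNReal.tendsto_nhds_zero]
  intro ε hε
  have hε4 : 0 < ε / 4 := ENNReal.div_pos hε.ne' (by simp)
  -- `F` is chosen for the dominating function, hence for all indices at once; the two terms of the
  -- split are each to be at most `2 * (ε / 4)`.
  obtain ⟨F, hF⟩ := ((ENNReal.tendsto_nhds_zero.1
    (tendsto_lintegral_tailMeasure (μ := μ) hgi.ne)) (ε / 4) hε4).exists
  have hmain : Tendsto (fun i => ∫⁻ x, ‖(φ i).toFun x ∘L proj F‖ₑ ^ 2 ∂(controlTrace μ)) l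
      (𝓝 0) := by
    have : (0 : ℝ≥0∞) = ∫⁻ x, (fun _ => 0 : Polar d → ℝ≥0∞) x ∂(controlTrace μ) := by simp
    rw [this]
    refine tendsto_lintegral_filter_of_dominated_convergence (fun x => g x ^ 2)
      (Eventually.of_forall fun i => ?_) (Eventually.of_forall fun i => ?_) hgi.ne ?_
    · have h1 : StronglyMeasurable fun x => (φ i).toFun x ∘L proj F :=
        (ContinuousLinearMap.precomp V (proj F)).continuous.comp_stronglyMeasurable
          (φ i).stronglyMeasurable_toFun
      exact h1.enorm.pow_const 2
    · filter_upwards [hφg i] with x hx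
      gcongr
      refine (ContinuousLinearMap.opENorm_le_bound _ fun v => ?_)
      rw [ContinuousLinearMap.comp_apply]
      refine (((φ i).toFun x).le_opENorm _).trans ?_
      gcongr
      exact enorm_proj_le F v
    · filter_upwards [hφ] with x hx
      -- On the span of the finitely many vectors in `F`, strong convergence is norm convergence.
      have h1 : Tendsto (fun i => ∑ e ∈ F, ‖(φ i).toFun x (e : V)‖ₑ) l (𝓝 0) := by
        have := tendsto_finsetSum F fun (e : onSystem V) _ => (hx (e : V)).enorm
        simpa using this
      have h2 : Tendsto (fun i => ‖(φ i).toFun x ∘L proj F‖ₑ) l (𝓝 0) := by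
        refine tendsto_of_tendsto_of_tendsto_of_le_of_le tendsto_const_nhds h1
          (fun _ => zero_le) fun i => ?_
        refine ContinuousLinearMap.opENorm_le_bound _ fun v => ?_
        rw [ContinuousLinearMap.comp_apply, proj_apply, map_sum, Finset.sum_mul]
        refine (enorm_sum_le _ _).trans (Finset.sum_le_sum fun e _ => ?_)
        rw [map_smul, enorm_smul, mul_comm]
        gcongr
        have h3 := ENNReal.le_tsum (f := fun e : onSystem V => ‖inner ℂ (e : V) v‖ₑ ^ 2) e
        rw [tsum_enorm_inner_sq] at h3
        exact (ENNReal.pow_le_pow_left_iff two_ne_zero).1 h3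
      simpa using ENNReal.Tendsto.pow (n := 2) h2
  filter_upwards [(ENNReal.tendsto_nhds_zero.1 hmain) (ε / 4) hε4] with i hi
  refine (hW.lintegral_integral_sq_le F (φ i)).trans ?_
  have htail : ∫⁻ x, ‖(φ i).toFun x‖ₑ ^ 2 ∂(tailMeasure μ F) ≤ ε / 4 := by
    refine le_trans (lintegral_mono_ae ?_) hF
    filter_upwards [(Measure.absolutelyContinuous_of_le (tailMeasure_le μ F)).ae_le (hφg i)]
      with x hx
    gcongr
  calc _ ≤ 2 * (ε / 4) + 2 * (ε / 4) := by gcongr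
    _ = ε := by
      rw [← two_mul, ← mul_assoc]
      norm_num
      exact ENNReal.mul_div_cancel (by simp) (by simp)

end Disjoint

/-! ### Uniqueness and completeness of the stochastic integral -/

section StochInt

variable {d : ℕ} {V : Type*} [NormedAddCommGroup V] [InnerProductSpace ℂ V] [CompleteSpace V]
  {Ω : Type*} [MeasurableSpace Ω] {P : Measure Ω} {μ : TraceClassMeasure V (USphere d)}
  {W : BddBorel d → Ω → V}

/-- Dominated strong approximation by simple functions. -/
def IsApprox (μ : TraceClassMeasure V (USphere d)) (f : Polar d → V →L[ℂ] V)
    (φ : ℕ → SimpleOp d V) : Prop :=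
  ∃ g : Polar d → ℝ≥0∞, Measurable g ∧ ∫⁻ x, g x ^ 2 ∂(controlTrace μ) < ∞ ∧
    (∀ n, ∀ᵐ x ∂(controlTrace μ), ‖(φ n).toFun x‖ₑ ≤ g x) ∧
    ∀ᵐ x ∂(controlTrace μ), ∀ v : V, Tendsto (fun n => (φ n).toFun x v) atTop (𝓝 (f x v))

theorem isStochInt_iff {f : Polar d → V →L[ℂ] V} {I : Ω → V} :
    IsStochInt μ W P f I ↔ MemLp I 2 P ∧ ∃ φ, IsApprox μ f φ ∧
      Tendsto (fun n => eLpNorm (fun ω => I ω - (φ n).integral W ω) 2 P) atTop (𝓝 0) := by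
  constructor
  · rintro ⟨h, φ, g, h1, h2, h3, h4, h5⟩
    exact ⟨h, φ, ⟨g, h1, h2, h3, h4⟩, h5⟩
  · rintro ⟨h, φ, ⟨g, h1, h2, h3, h4⟩, h5⟩
    exact ⟨h, φ, g, h1, h2, h3, h4, h5⟩

theorem lintegral_add_sq_lt_top {α : Type*} [MeasurableSpace α] {m : Measure α} {g h : α → ℝ≥0∞}
    (hgm : Measurable g) (hg : ∫⁻ x, g x ^ 2 ∂m < ∞) (hh : ∫⁻ x, h x ^ 2 ∂m < ∞) :
    ∫⁻ x, (g x + h x) ^ 2 ∂m < ∞ := by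
  refine (lintegral_mono fun x => add_sq_le_ennreal (g x) (h x)).trans_lt ?_
  rw [lintegral_add_left ((hgm.pow_const 2).const_mul 2),
    lintegral_const_mul' _ _ (by simp), lintegral_const_mul' _ _ (by simp)]
  exact ENNReal.add_lt_top.2 ⟨ENNReal.mul_lt_top (by simp) hg, ENNReal.mul_lt_top (by simp) hh⟩

theorem tendsto_eLpNorm_two_iff {ι E : Type*} [NormedAddCommGroup E] {l : Filter ι}
    {f : ι → Ω → E} : Tendsto (fun i => eLpNorm (f i) 2 P) l (𝓝 0) ↔
      Tendsto (fun i => ∫⁻ ω, ‖f i ω‖ₑ ^ 2 ∂P) l (𝓝 0) := by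
  simp only [lintegral_enorm_sq_eq_eLpNorm]
  constructor
  · intro h
    simpa using ENNReal.Tendsto.pow (n := 2) h
  · intro h
    have := (ENNReal.continuous_rpow_const (y := (1 / 2 : ℝ))).tendsto (0 : ℝ≥0∞) |>.comp h
    simp only [Function.comp_def, ← ENNReal.rpow_natCast, ← ENNReal.rpow_mul] at this
    simpa using this

theorem tendsto_eLpNorm_of_sub {ι E : Type*} [NormedAddCommGroup E] {l : Filter ι}
    {f : ι → Ω → E} {I : Ω → E} (hI : MemLp I 2 P) (hf : ∀ i, AEStronglyMeasurable (f i) P)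
    (h : Tendsto (fun i => eLpNorm (fun ω => I ω - f i ω) 2 P) l (𝓝 0)) :
    Tendsto (fun i => eLpNorm (f i) 2 P) l (𝓝 (eLpNorm I 2 P)) := by
  have h1 : Tendsto (fun i => eLpNorm I 2 P - eLpNorm (fun ω => I ω - f i ω) 2 P) l
      (𝓝 (eLpNorm I 2 P)) := by
    have := ENNReal.Tendsto.sub (tendsto_const_nhds (x := eLpNorm I 2 P) (f := l)) h
      (Or.inl hI.eLpNorm_ne_top)
    simpa using this
  have h2 : Tendsto (fun i => eLpNorm I 2 P + eLpNorm (fun ω => I ω - f i ω) 2 P) l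
      (𝓝 (eLpNorm I 2 P)) := by
    simpa using h.const_add (eLpNorm I 2 P)
  refine tendsto_of_tendsto_of_tendsto_of_le_of_le h1 h2 (fun i => ?_) fun i => ?_
  · refine tsub_le_iff_right.2 ?_
    have e : I = fun ω => f i ω + (I ω - f i ω) := by funext ω; abel
    conv_lhs => rw [e]
    exact eLpNorm_add_le (hf i) (hI.1.sub (hf i)) (by norm_num)
  · have e : f i = fun ω => I ω - (I ω - f i ω) := by funext ω; abel
    conv_lhs => rw [e]
    exact eLpNorm_sub_le hI.1 (hI.1.sub (hf i)) (by norm_num)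

variable [SecondCountableTopology V]

/-- The differences over pairs of indices tend to zero strongly and are dominated by `g + g'`. With
`φ = ψ` this is the Cauchy property; on the diagonal it shows that the limit does not depend on the
approximation. -/
theorem IsCircularNoise.tendsto_eLpNorm_sub (hW : IsCircularNoise P μ W)
    {f : Polar d → V →L[ℂ] V} {φ ψ : ℕ → SimpleOp d V} (hφ : IsApprox μ f φ)
    (hψ : IsApprox μ f ψ) :
    Tendsto (fun q : ℕ × ℕ => eLpNorm (fun ω => (φ q.1).integral W ω - (ψ q.2).integral W ω) 2 P)
      (atTop ×ˢ atTop) (𝓝 0) := by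
  obtain ⟨g, hgm, hgi, hg, hlim⟩ := hφ
  obtain ⟨g', hgm', hgi', hg', hlim'⟩ := hψ
  rw [tendsto_eLpNorm_two_iff]
  simp only [← SimpleOp.integral_sub]
  refine hW.tendsto_lintegral_integral_sq (fun q : ℕ × ℕ => φ q.1 - ψ q.2) (g := fun x => g x + g' x)
    (lintegral_add_sq_lt_top hgm hgi hgi') (fun q => ?_) ?_
  · filter_upwards [hg q.1, hg' q.2] with x h1 h2
    rw [SimpleOp.toFun_sub]
    exact enorm_sub_le.trans (add_le_add h1 h2)
  · filter_upwards [hlim, hlim'] with x h1 h2 v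
    simp only [SimpleOp.toFun_sub, sub_apply]
    have := ((h1 v).comp tendsto_fst).sub ((h2 v).comp tendsto_snd)
    simpa using this

theorem IsCircularNoise.tendsto_of_isApprox (hW : IsCircularNoise P μ W)
    {f : Polar d → V →L[ℂ] V} {I : Ω → V} (hI : IsStochInt μ W P f I) {ψ : ℕ → SimpleOp d V}
    (hψ : IsApprox μ f ψ) :
    Tendsto (fun n => eLpNorm (fun ω => I ω - (ψ n).integral W ω) 2 P) atTop (𝓝 0) := by
  obtain ⟨hI, φ, hφ, hlim⟩ := isStochInt_iff.1 hI
  have h1 := (hW.tendsto_eLpNorm_sub hφ hψ).comp (tendsto_id.prodMk tendsto_id)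
  refine tendsto_of_tendsto_of_tendsto_of_le_of_le tendsto_const_nhds
    (by simpa using hlim.add h1) (fun _ => zero_le) fun n => ?_
  have e : (fun ω => I ω - (ψ n).integral W ω) = (fun ω => I ω - (φ n).integral W ω) +
      fun ω => (φ n).integral W ω - (ψ n).integral W ω := by funext ω; simp
  rw [e]
  exact eLpNorm_add_le (hI.1.sub (hW.memLp_integral _).1)
    ((hW.memLp_integral _).1.sub (hW.memLp_integral _).1) (by norm_num)

/-- Uniqueness of the stochastic integral. -/
theorem IsCircularNoise.ae_eq (hW : IsCircularNoise P μ W) {f : Polar d → V →L[ℂ] V}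
    {I J : Ω → V} (hI : IsStochInt μ W P f I) (hJ : IsStochInt μ W P f J) : I =ᵐ[P] J := by
  obtain ⟨hJm, ψ, hψ, hJlim⟩ := isStochInt_iff.1 hJ
  have hIlim := hW.tendsto_of_isApprox hI hψ
  have h0 : eLpNorm (I - J) 2 P = 0 := by
    refine le_antisymm (ge_of_tendsto' (by simpa using hIlim.add hJlim) fun n => ?_) zero_le
    have e : I - J = (fun ω => I ω - (ψ n).integral W ω) - fun ω => J ω - (ψ n).integral W ω := by
      funext ω; simp
    rw [e]
    exact eLpNorm_sub_le (hI.1.1.sub (hW.memLp_integral _).1)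
      (hJm.1.sub (hW.memLp_integral _).1) (by norm_num)
  have h1 := (eLpNorm_eq_zero_iff (hI.1.1.sub hJm.1) two_ne_zero).1 h0
  filter_upwards [h1] with ω hω
  exact sub_eq_zero.1 hω

/-- The integrals of approximating simple functions converge. -/
theorem IsCircularNoise.exists_isStochInt_of_isApprox (hW : IsCircularNoise P μ W)
    {f : Polar d → V →L[ℂ] V} {φ : ℕ → SimpleOp d V} (hφ : IsApprox μ f φ) :
    ∃ I, IsStochInt μ W P f I := by
  have hc := hW.tendsto_eLpNorm_sub hφ hφ
  set F : ℕ → Lp V 2 P := fun n => (hW.memLp_integral (φ n)).toLp _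
  have hF : CauchySeq F := by
    rw [EMetric.cauchySeq_iff_NNReal]
    intro ε hε
    have := (hc.eventually (gt_mem_nhds (by simpa using hε : (0 : ℝ≥0∞) < ε)))
    rw [prod_atTop_atTop_eq] at this
    obtain ⟨⟨N, M⟩, hN⟩ := eventually_atTop.1 this
    refine ⟨max N M, fun n hn => ?_⟩
    have := hN (n, max N M) ⟨(le_max_left _ _).trans hn, le_max_right _ _⟩
    rw [Lp.edist_toLp_toLp]
    exact this
  obtain ⟨G, hG⟩ := cauchySeq_tendsto_of_complete hF
  refine ⟨G, isStochInt_iff.2 ⟨Lp.memLp G, φ, hφ, ?_⟩⟩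
  have := (Lp.tendsto_Lp_iff_tendsto_eLpNorm'' (fun n => (φ n).integral W)
    (fun n => hW.memLp_integral (φ n)) G (Lp.memLp G)).1 (by simpa [Lp.toLp_coeFn] using hG)
  refine this.congr fun n => ?_
  rw [eLpNorm_sub_comm]
  rfl

theorem IsCircularNoise.tendsto_lintegral_sq (hW : IsCircularNoise P μ W)
    {f : Polar d → V →L[ℂ] V} {I : Ω → V} (hI : IsStochInt μ W P f I) {ψ : ℕ → SimpleOp d V}
    (hψ : IsApprox μ f ψ) :
    Tendsto (fun n => ∫⁻ ω, ‖(ψ n).integral W ω‖ₑ ^ 2 ∂P) atTop (𝓝 (∫⁻ ω, ‖I ω‖ₑ ^ 2 ∂P)) := by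
  simp only [lintegral_enorm_sq_eq_eLpNorm]
  exact ENNReal.Tendsto.pow (tendsto_eLpNorm_of_sub hI.1 (fun n => (hW.memLp_integral _).1)
    (hW.tendsto_of_isApprox hI hψ))

end StochInt

/-! ### Existence of stochastic integrals -/

section Existence

variable {d : ℕ} {V : Type*} [NormedAddCommGroup V] [InnerProductSpace ℂ V] [CompleteSpace V]
  {Ω : Type*} [MeasurableSpace Ω] {P : Measure Ω} {μ : TraceClassMeasure V (USphere d)}
  {W : BddBorel d → Ω → V}

/-- Strongly measurable, square integrable operator valued integrands. -/
structure IsL2Kernel (μ : TraceClassMeasure V (USphere d)) (f : Polar d → V →L[ℂ] V) : Prop where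
  measurable : ∀ v, StronglyMeasurable fun x => f x v
  lt_top : ∫⁻ x, ‖f x‖ₑ ^ 2 ∂(controlTrace μ) < ∞

/-- The operator norm is a supremum over a countable dense set of vectors. The map `f` itself need
not be measurable for the norm topology of operators, which is not separable in general. -/
theorem measurable_enorm_of_apply [SecondCountableTopology V] {α : Type*} [MeasurableSpace α]
    {f : α → V →L[ℂ] V} (hf : ∀ v, StronglyMeasurable fun x => f x v) :
    Measurable fun x => ‖f x‖ₑ := by
  have h : (fun x => ‖f x‖ₑ) = fun x =>
      ⨆ n : ℕ, ‖f x (TopologicalSpace.denseSeq V n)‖ₑ / ‖TopologicalSpace.denseSeq V n‖ₑ := by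
    funext x
    have hle : ∀ v, ‖f x v‖ₑ / ‖v‖ₑ ≤ ‖f x‖ₑ := fun v =>
      ENNReal.div_le_of_le_mul ((f x).le_opENorm v)
    refine le_antisymm ?_ (iSup_le fun n => hle _)
    set M := ⨆ n : ℕ, ‖f x (TopologicalSpace.denseSeq V n)‖ₑ / ‖TopologicalSpace.denseSeq V n‖ₑ
      with hM
    have hMt : M ≠ ∞ := ((iSup_le fun n => hle _).trans_lt enorm_lt_top).ne
    refine ContinuousLinearMap.opENorm_le_bound _ fun v => ?_
    have hcl : IsClosed {v | ‖f x v‖ₑ ≤ M * ‖v‖ₑ} :=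
      isClosed_le (f x).continuous.enorm ((ENNReal.continuous_const_mul hMt).comp continuous_enorm)
    have hsub : Set.range (TopologicalSpace.denseSeq V) ⊆ {v | ‖f x v‖ₑ ≤ M * ‖v‖ₑ} := by
      rintro _ ⟨n, rfl⟩
      by_cases h0 : TopologicalSpace.denseSeq V n = 0
      · simp [h0]
      · have h1 := le_iSup (fun n : ℕ => ‖f x (TopologicalSpace.denseSeq V n)‖ₑ /
          ‖TopologicalSpace.denseSeq V n‖ₑ) n
        exact (ENNReal.div_le_iff (by simpa using h0) enorm_ne_top).1 h1
    have := hcl.closure_subset_iff.2 hsub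
    rw [(TopologicalSpace.denseRange_denseSeq V).closure_range] at this
    exact this (Set.mem_univ v)
  rw [h]
  exact Measurable.iSup fun n => (hf _).enorm.div_const _

/-- A simple function, cut off outside a bounded set, as a formal sum. -/
noncomputable def SimpleOp.ofSimpleFunc (g : SimpleFunc (Polar d) (V →L[ℂ] V)) (R : ℝ) : SimpleOp d V :=
  ∑ T ∈ g.range, Finsupp.single ⟨g ⁻¹' {T} ∩ {x | (x.1 : ℝ) ≤ R},
    (g.measurableSet_fiber T).inter
      (measurableSet_le (measurable_subtype_coe.comp measurable_fst) measurable_const),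
    R, fun _ hx => hx.2⟩ T

open Classical in
theorem SimpleOp.toFun_ofSimpleFunc (g : SimpleFunc (Polar d) (V →L[ℂ] V)) (R : ℝ) (x : Polar d) :
    (SimpleOp.ofSimpleFunc g R).toFun x = if (x.1 : ℝ) ≤ R then g x else 0 := by
  rw [SimpleOp.ofSimpleFunc, SimpleOp.toFun_sum]
  simp only [SimpleOp.toFun_single]
  rw [Finset.sum_eq_single (g x)]
  · congr 1
    simp
  · intro T _ hT
    refine if_neg fun h => hT ?_
    exact h.1.symm
  · intro h
    exact absurd (g.mem_range_self x) h

/-- Compression to finitely many coordinates turns measurability of each `f x v` into norm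
measurability, so that approximation by simple functions applies. -/
theorem stronglyMeasurable_proj_comp_proj {f : Polar d → V →L[ℂ] V}
    (hf : ∀ v, StronglyMeasurable fun x => f x v) (F : Finset (onSystem V)) :
    StronglyMeasurable fun x => proj F ∘L f x ∘L proj F := by
  have h : (fun x => proj F ∘L f x ∘L proj F) = fun x => ∑ e ∈ F,
      InnerProductSpace.rankOne ℂ (proj F (f x (e : V))) (e : V) := by
    funext x
    ext v
    simp [proj_apply F v, map_sum, InnerProductSpace.rankOne_apply]
  rw [h]
  refine Finset.stronglyMeasurable_fun_sum _ fun e _ => ?_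
  have hc : Continuous fun v : V => InnerProductSpace.rankOne ℂ (proj F v) (e : V) := by fun_prop
  exact hc.comp_stronglyMeasurable (hf e)

theorem enorm_proj_comp_proj_le (F : Finset (onSystem V)) (T : V →L[ℂ] V) :
    ‖proj F ∘L T ∘L proj F‖ₑ ≤ ‖T‖ₑ := by
  refine ContinuousLinearMap.opENorm_le_bound _ fun v => ?_
  refine (enorm_proj_le F _).trans ((T.le_opENorm _).trans ?_)
  gcongr
  exact enorm_proj_le F v

theorem tendsto_proj_comp_proj (T : V →L[ℂ] V) (v : V) :
    Tendsto (fun F => (proj F ∘L T ∘L proj F) v) atTop (𝓝 (T v)) := by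
  have h1 : Tendsto (fun F => T (proj F v)) atTop (𝓝 (T v)) :=
    (T.continuous.tendsto v).comp (tendsto_proj v)
  have h2 : Tendsto (fun F => proj F (T (proj F v) - T v)) atTop (𝓝 0) := by
    rw [tendsto_zero_iff_enorm_tendsto_zero]
    have h3 := tendsto_zero_iff_enorm_tendsto_zero.1 (tendsto_sub_nhds_zero_iff.2 h1)
    exact tendsto_of_tendsto_of_tendsto_of_le_of_le tendsto_const_nhds h3 (fun _ => zero_le)
      fun F => enorm_proj_le F _
  have h4 := h2.add (tendsto_proj (T v))
  rw [zero_add] at h4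
  refine h4.congr fun F => ?_
  simp

/-- The compressions of `f` to growing finite dimensional spaces are approximated in `L²` by simple
functions, cut off at `u ≤ n`. Errors below `2^{-n}` are square summable, hence tend to zero almost
everywhere. The last clause gives the norm estimate in `lintegral_sq_le`. -/
theorem IsL2Kernel.exists_isApprox [SecondCountableTopology V] {f : Polar d → V →L[ℂ] V}
    (hf : IsL2Kernel μ f) : ∃ φ, IsApprox μ f φ ∧ ∀ n : ℕ,
      ∫⁻ x, ‖(φ n).toFun x‖ₑ ^ 2 ∂(controlTrace μ) ≤
        2 * ∫⁻ x, ‖f x‖ₑ ^ 2 ∂(controlTrace μ) + 2 * ((2⁻¹ : ℝ≥0∞) ^ n) ^ 2 := by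
  classical
  obtain ⟨F, -, hF⟩ := exists_seq_monotone_tendsto_atTop_atTop (Finset (onSystem V))
  have hfm := measurable_enorm_of_apply hf.measurable
  have hmem : ∀ n, MemLp (fun x => proj (F n) ∘L f x ∘L proj (F n)) 2 (controlTrace μ) := by
    intro n
    refine ⟨(stronglyMeasurable_proj_comp_proj hf.measurable (F n)).aestronglyMeasurable, ?_⟩
    have h1 : eLpNorm (fun x => proj (F n) ∘L f x ∘L proj (F n)) 2 (controlTrace μ) ^ 2 < ∞ := by
      rw [← lintegral_enorm_sq_eq_eLpNorm]
      refine (lintegral_mono fun x => ?_).trans_lt hf.lt_top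
      gcongr
      exact enorm_proj_comp_proj_le _ _
    exact (ENNReal.pow_lt_top_iff.1 h1).resolve_right two_ne_zero
  have hg : ∀ n : ℕ, ∃ g : SimpleFunc (Polar d) (V →L[ℂ] V),
      eLpNorm ((fun x => proj (F n) ∘L f x ∘L proj (F n)) - ⇑g) 2 (controlTrace μ) <
        (2⁻¹ : ℝ≥0∞) ^ n := fun n => by
    obtain ⟨g, hg, -⟩ := (hmem n).exists_simpleFunc_eLpNorm_sub_lt (by simp)
      (ε := (2⁻¹ : ℝ≥0∞) ^ n) (by simp)
    exact ⟨g, hg⟩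
  choose g hg using hg
  set h : ℕ → Polar d → ℝ≥0∞ := fun n x => ‖proj (F n) ∘L f x ∘L proj (F n) - g n x‖ₑ with hh
  have hhm : ∀ n, Measurable (h n) := fun n =>
    ((stronglyMeasurable_proj_comp_proj hf.measurable (F n)).sub (g n).stronglyMeasurable).enorm
  have hhi : ∀ n, ∫⁻ x, h n x ^ 2 ∂(controlTrace μ) ≤ ((2⁻¹ : ℝ≥0∞) ^ n) ^ 2 := by
    intro n
    have := lintegral_enorm_sq_eq_eLpNorm (P := controlTrace μ)
      ((fun x => proj (F n) ∘L f x ∘L proj (F n)) - ⇑(g n))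
    simp only [Pi.sub_apply] at this
    rw [hh, this]
    exact pow_le_pow_left' (hg n).le 2
  have hle : ∀ n x, ‖(SimpleOp.ofSimpleFunc (g n) n).toFun x‖ₑ ≤ ‖f x‖ₑ + h n x := by
    intro n x
    rw [SimpleOp.toFun_ofSimpleFunc]
    split_ifs
    · have e : g n x = proj (F n) ∘L f x ∘L proj (F n) -
        (proj (F n) ∘L f x ∘L proj (F n) - g n x) := by abel
      rw [e]
      refine enorm_sub_le.trans (add_le_add (enorm_proj_comp_proj_le _ _) le_rfl)
    · simp
  have hsum : ∫⁻ x, ∑' n, h n x ^ 2 ∂(controlTrace μ) < ∞ := by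
    rw [lintegral_tsum fun n => ((hhm n).pow_const 2).aemeasurable]
    refine (ENNReal.tsum_le_tsum hhi).trans_lt ?_
    have e : ∀ n : ℕ, ((2⁻¹ : ℝ≥0∞) ^ n) ^ 2 = (4⁻¹ : ℝ≥0∞) ^ n := fun n => by
      rw [← pow_mul, mul_comm, pow_mul]
      congr 1
      rw [← ENNReal.inv_pow]
      norm_num
    simp only [e]
    rw [ENNReal.tsum_geometric]
    refine ENNReal.inv_lt_top.2 (tsub_pos_of_lt ?_)
    exact ENNReal.inv_lt_one.2 (by norm_num)
  have hae := ae_lt_top' (Measurable.tsum fun n => (hhm n).pow_const 2).aemeasurable hsum.ne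
  -- The square root of the sum of all squared errors dominates every single error and is still
  -- square integrable.
  refine ⟨fun n => SimpleOp.ofSimpleFunc (g n) n,
    ⟨fun x => ‖f x‖ₑ + (∑' n, h n x ^ 2) ^ (2⁻¹ : ℝ), ?_, ?_, ?_, ?_⟩, ?_⟩
  · exact hfm.add ((Measurable.tsum fun n => (hhm n).pow_const 2).pow_const _)
  · refine lintegral_add_sq_lt_top hfm hf.lt_top ?_
    simp only [← ENNReal.rpow_natCast, ← ENNReal.rpow_mul] at hsum ⊢
    simpa using hsum
  · intro n
    refine Eventually.of_forall fun x => (hle n x).trans (add_le_add le_rfl ?_)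
    rw [ENNReal.le_rpow_inv_iff (by norm_num)]
    have := ENNReal.le_tsum (f := fun n => h n x ^ 2) n
    exact_mod_cast this
  · filter_upwards [hae] with x hx v
    have h0 : Tendsto (fun n => h n x ^ 2) atTop (𝓝 0) :=
      ENNReal.tendsto_atTop_zero_of_tsum_ne_top hx.ne
    have h1 : Tendsto (fun n => h n x) atTop (𝓝 0) := by
      have := (ENNReal.continuous_rpow_const (y := (2⁻¹ : ℝ))).tendsto (0 : ℝ≥0∞) |>.comp h0
      simp only [Function.comp_def, ← ENNReal.rpow_natCast, ← ENNReal.rpow_mul] at this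
      simpa using this
    have h2 : Tendsto (fun n => (proj (F n) ∘L f x ∘L proj (F n) - g n x) v) atTop (𝓝 0) := by
      rw [tendsto_zero_iff_enorm_tendsto_zero]
      refine tendsto_of_tendsto_of_tendsto_of_le_of_le tendsto_const_nhds (?_ :
        Tendsto (fun n => h n x * ‖v‖ₑ) atTop (𝓝 0)) (fun _ => zero_le) fun n =>
        ContinuousLinearMap.le_opENorm _ _
      simpa using ENNReal.Tendsto.mul_const h1 (Or.inr enorm_ne_top)
    have h3 := ((tendsto_proj_comp_proj (f x) v).comp hF).sub h2
    rw [sub_zero] at h3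
    refine h3.congr' ?_
    filter_upwards [eventually_ge_atTop ⌈(x.1 : ℝ)⌉₊] with n hn
    rw [SimpleOp.toFun_ofSimpleFunc, if_pos (Nat.ceil_le.1 hn)]
    simp
  · intro n
    calc ∫⁻ x, ‖(SimpleOp.ofSimpleFunc (g n) n).toFun x‖ₑ ^ 2 ∂(controlTrace μ)
        ≤ ∫⁻ x, (2 * ‖f x‖ₑ ^ 2 + 2 * h n x ^ 2) ∂(controlTrace μ) := by
          refine lintegral_mono fun x => ?_
          exact (pow_le_pow_left' (hle n x) 2).trans (add_sq_le_ennreal _ _)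
      _ = 2 * ∫⁻ x, ‖f x‖ₑ ^ 2 ∂(controlTrace μ) + 2 * ∫⁻ x, h n x ^ 2 ∂(controlTrace μ) := by
          rw [lintegral_add_left ((hfm.pow_const 2).const_mul 2),
            lintegral_const_mul' _ _ (by simp), lintegral_const_mul' _ _ (by simp)]
      _ ≤ _ := by
          gcongr
          exact hhi n

variable [SecondCountableTopology V]

theorem IsCircularNoise.exists_isStochInt (hW : IsCircularNoise P μ W) {f : Polar d → V →L[ℂ] V}
    (hf : IsL2Kernel μ f) : ∃ I, IsStochInt μ W P f I := by
  obtain ⟨φ, hφ, -⟩ := hf.exists_isApprox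
  exact hW.exists_isStochInt_of_isApprox hφ

/-- The constant `4` is the product of the factor `2` in the bound for simple integrals and the
factor `2` in the bound for the approximations. -/
theorem IsCircularNoise.lintegral_sq_le (hW : IsCircularNoise P μ W) {f : Polar d → V →L[ℂ] V}
    (hf : IsL2Kernel μ f) {I : Ω → V} (hI : IsStochInt μ W P f I) :
    ∫⁻ ω, ‖I ω‖ₑ ^ 2 ∂P ≤ 4 * ∫⁻ x, ‖f x‖ₑ ^ 2 ∂(controlTrace μ) := by
  obtain ⟨φ, hφ, hle⟩ := hf.exists_isApprox
  have h1 := hW.tendsto_lintegral_sq hI hφ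
  have h2 : Tendsto (fun n : ℕ => 2 * (2 * ∫⁻ x, ‖f x‖ₑ ^ 2 ∂(controlTrace μ) +
      2 * ((2⁻¹ : ℝ≥0∞) ^ n) ^ 2)) atTop (𝓝 (4 * ∫⁻ x, ‖f x‖ₑ ^ 2 ∂(controlTrace μ))) := by
    have h3 : Tendsto (fun n : ℕ => (2⁻¹ : ℝ≥0∞) ^ n) atTop (𝓝 0) :=
      ENNReal.tendsto_pow_atTop_nhds_zero_of_lt_one (by simp)
    have h4 := ENNReal.Tendsto.const_mul (a := 2) (ENNReal.Tendsto.pow (n := 2) h3)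
      (Or.inr (by simp))
    have h5 := ENNReal.Tendsto.const_mul (a := 2)
      (h4.const_add (2 * ∫⁻ x, ‖f x‖ₑ ^ 2 ∂(controlTrace μ))) (Or.inr (by simp))
    refine h5.trans_eq ?_
    rw [zero_pow two_ne_zero, mul_zero, add_zero, ← mul_assoc]
    norm_num
  exact le_of_tendsto_of_tendsto' h1 h2 fun n =>
    (hW.lintegral_integral_sq_le' (φ n)).trans (by gcongr; exact hle n)

end Existence

/-! ### Operations on stochastic integrals -/

section Operations

variable {d : ℕ} {V : Type*} [NormedAddCommGroup V] [InnerProductSpace ℂ V] [CompleteSpace V]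
  {Ω : Type*} [MeasurableSpace Ω] {P : Measure Ω} {μ : TraceClassMeasure V (USphere d)}
  {W : BddBorel d → Ω → V} {f f' : Polar d → V →L[ℂ] V} {I J : Ω → V}

theorem IsStochInt.congr_ae (h : IsStochInt μ W P f I) (hIJ : I =ᵐ[P] J) :
    IsStochInt μ W P f J := by
  obtain ⟨h1, φ, hφ, h2⟩ := isStochInt_iff.1 h
  refine isStochInt_iff.2 ⟨h1.ae_eq hIJ, φ, hφ, h2.congr fun n => eLpNorm_congr_ae ?_⟩
  filter_upwards [hIJ] with ω hω
  rw [hω]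

theorem IsStochInt.comp (T : V →L[ℂ] V) (h : IsStochInt μ W P f I) :
    IsStochInt μ W P (fun x => T ∘L f x) (fun ω => T (I ω)) := by
  obtain ⟨h1, φ, ⟨g, hgm, hgi, hg, hl⟩, h2⟩ := isStochInt_iff.1 h
  refine isStochInt_iff.2 ⟨T.comp_memLp' h1, fun n => SimpleOp.comp T (φ n),
    ⟨fun x => ‖T‖ₑ * g x, hgm.const_mul _, ?_, fun n => ?_, ?_⟩, ?_⟩
  · simp only [mul_pow]
    rw [lintegral_const_mul' _ _ (by simp)]
    exact ENNReal.mul_lt_top (by simp) hgi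
  · filter_upwards [hg n] with x hx
    rw [SimpleOp.toFun_comp]
    exact (ContinuousLinearMap.opENorm_comp_le _ _).trans (by gcongr)
  · filter_upwards [hl] with x hx v
    simp only [SimpleOp.toFun_comp, ContinuousLinearMap.comp_apply]
    exact (T.continuous.tendsto _).comp (hx v)
  · simp only [SimpleOp.integral_comp, ← map_sub]
    have h3 := ENNReal.Tendsto.const_mul (a := ENNReal.ofReal ‖T‖) h2 (Or.inr (by simp))
    rw [mul_zero] at h3
    exact tendsto_of_tendsto_of_tendsto_of_le_of_le tendsto_const_nhds h3 (fun _ => zero_le)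
      fun n => eLpNorm_le_mul_eLpNorm_of_ae_le_mul (Eventually.of_forall fun ω => T.le_opNorm _) _

theorem IsStochInt.add (hm : ∀ φ : SimpleOp d V, AEStronglyMeasurable (φ.integral W) P)
    (h : IsStochInt μ W P f I) (h' : IsStochInt μ W P f' J) :
    IsStochInt μ W P (fun x => f x + f' x) (fun ω => I ω + J ω) := by
  obtain ⟨h1, φ, ⟨g, hgm, hgi, hg, hl⟩, h2⟩ := isStochInt_iff.1 h
  obtain ⟨h1', φ', ⟨g', hgm', hgi', hg', hl'⟩, h2'⟩ := isStochInt_iff.1 h'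
  refine isStochInt_iff.2 ⟨h1.add h1', fun n => φ n + φ' n,
    ⟨fun x => g x + g' x, hgm.add hgm', lintegral_add_sq_lt_top hgm hgi hgi', fun n => ?_, ?_⟩, ?_⟩
  · filter_upwards [hg n, hg' n] with x hx hx'
    rw [SimpleOp.toFun_add]
    exact (enorm_add_le _ _).trans (add_le_add hx hx')
  · filter_upwards [hl, hl'] with x hx hx' v
    simp only [SimpleOp.toFun_add, add_apply]
    exact (hx v).add (hx' v)
  · refine tendsto_of_tendsto_of_tendsto_of_le_of_le tendsto_const_nhds
      (by simpa using h2.add h2') (fun _ => zero_le) fun n => ?_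
    have e : (fun ω => I ω + J ω - (φ n + φ' n : SimpleOp d V).integral W ω) =
        (fun ω => I ω - (φ n).integral W ω) + fun ω => J ω - (φ' n).integral W ω := by
      funext ω
      simp only [SimpleOp.integral_add, Pi.add_apply]
      abel
    rw [e]
    exact eLpNorm_add_le (h1.1.sub (hm _)) (h1'.1.sub (hm _)) (by norm_num)

theorem isStochInt_zero : IsStochInt μ W P (fun _ => 0) (fun _ => 0) :=
  isStochInt_iff.2 ⟨MemLp.zero, fun _ => 0, ⟨fun _ => 0, measurable_const, by simp,
    fun n => Eventually.of_forall fun x => by simp [SimpleOp.toFun],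
    Eventually.of_forall fun x v => by simp [SimpleOp.toFun]⟩, by
      simp [SimpleOp.integral]⟩

theorem IsCircularNoise.isStochInt_add (hW : IsCircularNoise P μ W)
    (h : IsStochInt μ W P f I) (h' : IsStochInt μ W P f' J) :
    IsStochInt μ W P (fun x => f x + f' x) (fun ω => I ω + J ω) :=
  IsStochInt.add (fun φ => (hW.memLp_integral φ).1) h h'

theorem IsStochInt.smul (c : ℂ) (h : IsStochInt μ W P f I) :
    IsStochInt μ W P (fun x => c • f x) (fun ω => c • I ω) := by
  have := h.comp (c • ContinuousLinearMap.id ℂ V)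
  simpa only [ContinuousLinearMap.smul_comp, ContinuousLinearMap.id_comp, smul_apply,
    ContinuousLinearMap.id_apply] using this

theorem IsCircularNoise.isStochInt_sub (hW : IsCircularNoise P μ W)
    (h : IsStochInt μ W P f I) (h' : IsStochInt μ W P f' J) :
    IsStochInt μ W P (fun x => f x - f' x) (fun ω => I ω - J ω) := by
  have := hW.isStochInt_add h (h'.smul (-1))
  simpa only [neg_smul, one_smul, ← sub_eq_add_neg] using this

theorem IsCircularNoise.isStochInt_sum (hW : IsCircularNoise P μ W) {ι : Type*} (s : Finset ι)
    {f : ι → Polar d → V →L[ℂ] V} {I : ι → Ω → V}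
    (h : ∀ i ∈ s, IsStochInt μ W P (f i) (I i)) :
    IsStochInt μ W P (fun x => ∑ i ∈ s, f i x) (fun ω => ∑ i ∈ s, I i ω) := by
  classical
  induction s using Finset.induction_on with
  | empty => simpa using isStochInt_zero
  | insert i s hi ih =>
    simp only [Finset.sum_insert hi]
    exact hW.isStochInt_add (h i (Finset.mem_insert_self i s))
      (ih fun j hj => h j (Finset.mem_insert_of_mem hj))

theorem IsL2Kernel.mul {m : Polar d → ℂ} (hm : Measurable m) {C : ℝ≥0} (hC : ∀ x, ‖m x‖ₑ ≤ C)
    (hf : IsL2Kernel μ f) : IsL2Kernel μ (fun x => m x • f x) := by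
  refine ⟨fun v => hm.stronglyMeasurable.smul (hf.measurable v), ?_⟩
  refine (lintegral_mono (g := fun x => (C : ℝ≥0∞) ^ 2 * ‖f x‖ₑ ^ 2) fun x => ?_).trans_lt ?_
  · rw [enorm_smul, mul_pow]
    exact mul_le_mul' (pow_le_pow_left' (hC x) 2) le_rfl
  · rw [lintegral_const_mul' _ _ (by simp)]
    exact ENNReal.mul_lt_top (by simp) hf.lt_top

variable [SecondCountableTopology V]

/-- The disjoint pieces of `φ` are refined by the level sets of `m`; second moments add up over the
pieces. No constant is lost, and for `C = 1` this makes multiplication by unimodular functions an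
isometry. -/
theorem IsCircularNoise.exists_simpleFunc_mul (hW : IsCircularNoise P μ W) (φ : SimpleOp d V)
    (m : SimpleFunc (Polar d) ℂ) {C : ℝ≥0} (hC : ∀ x, ‖m x‖ₑ ≤ C) :
    ∃ ψ : SimpleOp d V, (∀ x, ψ.toFun x = m x • φ.toFun x) ∧
      ∫⁻ ω, ‖ψ.integral W ω‖ₑ ^ 2 ∂P ≤ (C : ℝ≥0∞) ^ 2 * ∫⁻ ω, ‖φ.integral W ω‖ₑ ^ 2 ∂P := by
  classical
  obtain ⟨s, A, T, hA, hf, hi⟩ := hW.exists_disjoint φ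
  have hB : ∀ i c, (BddBorel.inter (A i) (m.measurableSet_fiber c) : Set (Polar d)) =
      (A i : Set (Polar d)) ∩ m ⁻¹' {c} := fun i c => rfl
  set B : Finset (BddBorel d) × ℂ → BddBorel d := fun q =>
    BddBorel.inter (A q.1) (m.measurableSet_fiber q.2) with hBdef
  have hBd : Pairwise fun p q => Disjoint (B p : Set (Polar d)) (B q) := by
    rintro ⟨i, c⟩ ⟨j, e⟩ hne
    refine Set.disjoint_left.2 ?_
    rintro x ⟨h1, h2⟩ ⟨h3, h4⟩
    refine hne (Prod.ext ?_ (h2.symm.trans h4))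
    by_contra hij
    exact Set.disjoint_left.1 (hA hij) h1 h3
  refine ⟨∑ q ∈ s ×ˢ m.range, Finsupp.single (B q) (q.2 • T q.1), fun x => ?_, ?_⟩
  · rw [SimpleOp.toFun_sum, hf, Finset.smul_sum, Finset.sum_product]
    refine Finset.sum_congr rfl fun i _ => ?_
    rw [Finset.sum_eq_single (m x)]
    · rw [SimpleOp.toFun_single, smul_ite, smul_zero]
      refine if_congr ?_ rfl rfl
      simp [hBdef, hB]
    · intro c _ hc
      rw [SimpleOp.toFun_single]
      exact if_neg fun h => hc h.2.symm
    · exact fun h => absurd (m.mem_range_self x) h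
  · have hφ : ∫⁻ ω, ‖φ.integral W ω‖ₑ ^ 2 ∂P = ∑ i ∈ s, opScalar μ (T i) (A i) := by
      rw [← hW.lintegral_enorm_sum_comp_sq s T A hA]
      exact lintegral_congr_ae (hi.mono fun ω hω => by simp only [hω])
    rw [hφ]
    simp only [SimpleOp.integral_sum, SimpleOp.integral_single]
    rw [hW.lintegral_enorm_sum_comp_sq (s ×ˢ m.range) (fun q => q.2 • T q.1) B hBd,
      Finset.sum_product, Finset.mul_sum]
    refine Finset.sum_le_sum fun i _ => ?_
    have h1 : ∀ c ∈ m.range, opScalar μ (c • T i) (B (i, c)) ≤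
        (C : ℝ≥0∞) ^ 2 * opScalar μ (T i) (B (i, c)) := by
      intro c hc
      obtain ⟨x, rfl⟩ := SimpleFunc.mem_range.1 hc
      rw [← hW.lintegral_enorm_comp_sq, ← hW.lintegral_enorm_comp_sq,
        ← lintegral_const_mul' _ _ (by simp)]
      refine lintegral_mono fun ω => ?_
      rw [smul_apply, enorm_smul, mul_pow]
      gcongr
      exact hC x
    refine (Finset.sum_le_sum h1).trans ?_
    rw [← Finset.mul_sum]
    gcongr
    rw [← measure_biUnion_finset (fun c _ e _ hne => hBd fun h => hne (Prod.ext_iff.1 h).2)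
      fun c _ => (B (i, c)).2.1]
    exact measure_mono (Set.iUnion₂_subset fun c _ => Set.inter_subset_left)

/-- Scalar multipliers act boundedly on stochastic integrals. -/
theorem IsCircularNoise.lintegral_sq_mul_le (hW : IsCircularNoise P μ W) {m : Polar d → ℂ}
    (hm : Measurable m) {C : ℝ≥0} (hC : ∀ x, ‖m x‖ₑ ≤ C) (hI : IsStochInt μ W P f I)
    (hJ : IsStochInt μ W P (fun x => m x • f x) J) :
    ∫⁻ ω, ‖J ω‖ₑ ^ 2 ∂P ≤ (C : ℝ≥0∞) ^ 2 * ∫⁻ ω, ‖I ω‖ₑ ^ 2 ∂P := by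
  have hC' : ∀ x, m x ∈ Metric.closedBall (0 : ℂ) C := fun x => by
    have := hC x
    rw [mem_closedBall_zero_iff]
    rw [enorm_le_coe] at this
    exact_mod_cast this
  have h0 : (0 : ℂ) ∈ Metric.closedBall (0 : ℂ) C := by simp
  set mn : ℕ → SimpleFunc (Polar d) ℂ := fun n =>
    SimpleFunc.approxOn m hm (Metric.closedBall (0 : ℂ) C) 0 h0 n with hmn
  have hmnC : ∀ n x, ‖mn n x‖ₑ ≤ C := fun n x => by
    have := SimpleFunc.approxOn_mem hm h0 n x
    rw [mem_closedBall_zero_iff] at this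
    rw [enorm_le_coe]
    exact_mod_cast this
  have hmnlim : ∀ x, Tendsto (fun n => mn n x) atTop (𝓝 (m x)) := fun x =>
    SimpleFunc.tendsto_approxOn hm h0 (subset_closure (hC' x))
  obtain ⟨-, φ, hφ, -⟩ := isStochInt_iff.1 hI
  choose ψ hψ hψle using fun n => hW.exists_simpleFunc_mul (φ n) (mn n) (hmnC n)
  have hψa : IsApprox μ (fun x => m x • f x) ψ := by
    obtain ⟨g, hgm, hgi, hg, hl⟩ := hφ
    refine ⟨fun x => C * g x, hgm.const_mul _, ?_, fun n => ?_, ?_⟩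
    · simp only [mul_pow]
      rw [lintegral_const_mul' _ _ (by simp)]
      exact ENNReal.mul_lt_top (by simp) hgi
    · filter_upwards [hg n] with x hx
      rw [hψ, enorm_smul]
      exact mul_le_mul' (hmnC n x) hx
    · filter_upwards [hl] with x hx v
      simp only [hψ, smul_apply]
      exact (hmnlim x).smul (hx v)
  exact le_of_tendsto_of_tendsto' (hW.tendsto_lintegral_sq hJ hψa)
    (ENNReal.Tendsto.const_mul (hW.tendsto_lintegral_sq hI hφ) (Or.inr (by simp))) hψle

/-- The bound with `C = 1` applies to `m` and to `m⁻¹`. -/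
theorem IsCircularNoise.lintegral_sq_mul_eq (hW : IsCircularNoise P μ W) {m : Polar d → ℂ}
    (hm : Measurable m) (hm1 : ∀ x, ‖m x‖ = 1) (hI : IsStochInt μ W P f I)
    (hJ : IsStochInt μ W P (fun x => m x • f x) J) :
    ∫⁻ ω, ‖J ω‖ₑ ^ 2 ∂P = ∫⁻ ω, ‖I ω‖ₑ ^ 2 ∂P := by
  have h1 : ∀ x, ‖m x‖ₑ ≤ (1 : ℝ≥0) := fun x => by
    rw [enorm_le_coe]
    exact_mod_cast (hm1 x).le
  have h2 : ∀ x, ‖(m x)⁻¹‖ₑ ≤ (1 : ℝ≥0) := fun x => by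
    rw [enorm_le_coe, nnnorm_inv]
    have : ‖m x‖₊ = 1 := NNReal.eq (hm1 x)
    simp [this]
  refine le_antisymm ?_ ?_
  · simpa using hW.lintegral_sq_mul_le hm h1 hI hJ
  · have h3 : IsStochInt μ W P (fun x => (m x)⁻¹ • (m x • f x)) I := by
      have e : (fun x => (m x)⁻¹ • (m x • f x)) = f := by
        funext x
        rw [smul_smul, inv_mul_cancel₀, one_smul]
        intro h
        simpa [h] using hm1 x
      rwa [e]
    simpa using hW.lintegral_sq_mul_le hm.inv h2 hJ h3

end Operations

/-! ### Scaling -/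

section Scaling

variable {d : ℕ} {V : Type*} [NormedAddCommGroup V] [InnerProductSpace ℂ V] [CompleteSpace V]
  {Ω : Type*} [MeasurableSpace Ω] {P : Measure Ω} {μ : TraceClassMeasure V (USphere d)}
  {W : BddBorel d → Ω → V}

/-- Multiplication by `c > 0` on `(0, ∞)`. -/
def mulPos (c : ℝ) (hc : 0 < c) (u : Set.Ioi (0 : ℝ)) : Set.Ioi (0 : ℝ) := ⟨c * u, mul_pos hc u.2⟩

theorem measurable_mulPos (c : ℝ) (hc : 0 < c) : Measurable (mulPos c hc) :=
  (measurable_subtype_coe.const_mul c).subtype_mk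

theorem map_mulPos (c : ℝ) (hc : 0 < c) :
    radial.map (mulPos c hc) = ENNReal.ofReal c⁻¹ • radial := by
  ext s hs
  have hE : MeasurableEmbedding (Subtype.val : Set.Ioi (0 : ℝ) → ℝ) :=
    MeasurableEmbedding.subtype_coe measurableSet_Ioi
  rw [Measure.map_apply (measurable_mulPos c hc) hs, Measure.smul_apply, radial,
    hE.comap_apply, hE.comap_apply, smul_eq_mul]
  have e : Subtype.val '' (mulPos c hc ⁻¹' s) = (c * ·) ⁻¹' (Subtype.val '' s) := by
    ext x
    simp only [Set.mem_image, Set.mem_preimage, Subtype.exists, exists_and_right, exists_eq_right,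
      mulPos]
    constructor
    · rintro ⟨h1, h2⟩
      exact ⟨mul_pos hc h1, h2⟩
    · rintro ⟨h1, h2⟩
      exact ⟨(pos_iff_pos_of_mul_pos h1).1 hc, h2⟩
  rw [e, Real.volume_preimage_mul_left hc.ne', abs_of_pos (inv_pos.2 hc)]

theorem dilate_eq (c : ℝ) (hc : 0 < c) :
    (dilate c hc : Polar d → Polar d) = Prod.map (mulPos c hc) id := rfl

theorem measurable_dilate (c : ℝ) (hc : 0 < c) : Measurable (dilate c hc : Polar d → Polar d) :=
  (measurable_mulPos c hc).prodMap measurable_id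

theorem map_dilate_controlTrace (μ : TraceClassMeasure V (USphere d)) (c : ℝ) (hc : 0 < c) :
    (controlTrace μ).map (dilate c hc) = ENNReal.ofReal c⁻¹ • controlTrace μ := by
  rw [dilate_eq, controlTrace, ← Measure.map_prod_map _ _ (measurable_mulPos c hc) measurable_id,
    map_mulPos, Measure.map_id, Measure.prod_smul_left]

/-- The preimage of a bounded Borel set under a dilation. -/
def BddBorel.dilatePreimage (c : ℝ) (hc : 0 < c) (B : BddBorel d) : BddBorel d :=
  ⟨dilate c hc ⁻¹' B, measurable_dilate c hc B.2.1, by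
    obtain ⟨R, hR⟩ := B.2.2
    refine ⟨R / c, fun x hx => ?_⟩
    rw [le_div_iff₀' hc]
    exact hR _ hx⟩

theorem controlMeasure_dilatePreimage (c : ℝ) (hc : 0 < c) {B : Set (Polar d)}
    (hB : MeasurableSet B) :
    controlMeasure μ (dilate c hc ⁻¹' B) = (c⁻¹ : ℝ) • controlMeasure μ B := by
  have h1 : controlMeasure μ (dilate c hc ⁻¹' B) =
      ∫ u, μ.toVec {θ | (u, θ) ∈ B} ∂(radial.map (mulPos c hc)) := by
    rw [integral_map (measurable_mulPos c hc).aemeasurable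
      (μ.stronglyMeasurable_section hB).aestronglyMeasurable]
    rfl
  rw [h1, map_mulPos, integral_smul_measure, ENNReal.toReal_ofReal (inv_pos.2 hc).le]
  rfl

variable [SecondCountableTopology V]

/-- The dilation multiplies every `ν(B ∩ C)` by `c⁻¹`, and each coordinate of the second moment is a
double sum of such terms. -/
theorem IsCircularNoise.lintegral_sum_dilatePreimage_sq (hW : IsCircularNoise P μ W) (c : ℝ)
    (hc : 0 < c) (φ : SimpleOp d V) :
    ∫⁻ ω, ‖φ.sum fun B T => T (W (B.dilatePreimage c hc) ω)‖ₑ ^ 2 ∂P =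
      ENNReal.ofReal c⁻¹ * ∫⁻ ω, ‖φ.integral W ω‖ₑ ^ 2 ∂P := by
  have hm : ∀ B : BddBorel d → BddBorel d, MemLp (fun ω => φ.sum fun C T => T (W (B C) ω)) 2 P := fun B =>
    memLp_finsetSum _ fun C _ => (φ C).comp_memLp' (hW.memLp _)
  rw [lintegral_enorm_sq_eq_tsum (hm _).1, lintegral_enorm_sq_eq_tsum (hW.memLp_integral φ).1,
    ← ENNReal.tsum_mul_left]
  refine tsum_congr fun e => ?_
  have hm' : ∀ B : BddBorel d → BddBorel d,
      MemLp (fun ω => inner ℂ (e : V) (φ.sum fun C T => T (W (B C) ω))) 2 P :=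
    fun B => (hm B).const_inner (e : V)
  have hi : ∀ (B : BddBorel d → BddBorel d) ω,
      inner ℂ (e : V) (φ.sum fun C T => T (W (B C) ω)) =
      ∑ C ∈ φ.support, inner ℂ (ContinuousLinearMap.adjoint (φ C) (e : V)) (W (B C) ω) := by
    intro B ω
    rw [Finsupp.sum, inner_sum]
    refine Finset.sum_congr rfl fun C _ => ?_
    rw [ContinuousLinearMap.adjoint_inner_left]
  have hm1 := hm' fun B => B.dilatePreimage c hc
  have hm2 := hm' id
  simp only [SimpleOp.integral]
  simp only [hi] at hm1
  have hi2 := hi id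
  simp only [id] at hi2 hm2
  simp only [hi2] at hm2
  simp only [hi]
  rw [lintegral_enorm_sq_eq hm1, lintegral_enorm_sq_eq hm2, ← ENNReal.ofReal_mul
    (inv_pos.2 hc).le]
  congr 1
  have h1 := hW.integral_norm_sum_sq φ.support (fun C => ContinuousLinearMap.adjoint (φ C) (e : V))
    fun B => B.dilatePreimage c hc
  have h2 := hW.integral_norm_sum_sq φ.support (fun C => ContinuousLinearMap.adjoint (φ C) (e : V))
    id
  have h3 : ∀ B C : BddBorel d, controlMeasure μ
      ((B.dilatePreimage c hc : Set (Polar d)) ∩ C.dilatePreimage c hc) =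
      (c⁻¹ : ℝ) • controlMeasure μ ((B : Set (Polar d)) ∩ C) := fun B C =>
    controlMeasure_dilatePreimage c hc (B.2.1.inter C.2.1)
  have h4 : ∀ (T : V →L[ℂ] V) a b, inner ℂ a (((c⁻¹ : ℝ) • T) b) = ((c⁻¹ : ℝ) : ℂ) * inner ℂ a (T b) := by
    intro T a b
    rw [← Complex.coe_smul, smul_apply, inner_smul_right]
  simp only [h3, h4, ← Finset.mul_sum] at h1
  simp only [id] at h2
  rw [← h2] at h1
  exact_mod_cast h1

/-- A dilation of the integrand rescales the second moment. -/
theorem IsCircularNoise.lintegral_sq_dilate (hW : IsCircularNoise P μ W) (c : ℝ) (hc : 0 < c)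
    {f : Polar d → V →L[ℂ] V} {I J : Ω → V} (hI : IsStochInt μ W P f I)
    (hJ : IsStochInt μ W P (fun x => f (dilate c hc x)) J) :
    ∫⁻ ω, ‖J ω‖ₑ ^ 2 ∂P = ENNReal.ofReal c⁻¹ * ∫⁻ ω, ‖I ω‖ₑ ^ 2 ∂P := by
  obtain ⟨-, φ, hφ, -⟩ := isStochInt_iff.1 hI
  set ψ : ℕ → SimpleOp d V := fun n =>
    (φ n).sum fun B T => Finsupp.single (B.dilatePreimage c hc) T with hψ
  have hψf : ∀ n x, (ψ n).toFun x = (φ n).toFun (dilate c hc x) := by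
    intro n x
    simp only [hψ, Finsupp.sum]
    rw [SimpleOp.toFun_sum, SimpleOp.toFun, Finsupp.sum]
    refine Finset.sum_congr rfl fun B _ => ?_
    rw [SimpleOp.toFun_single]
    rfl
  have hψi : ∀ n ω, (ψ n).integral W ω = (φ n).sum fun B T => T (W (B.dilatePreimage c hc) ω) := by
    intro n ω
    simp only [hψ, Finsupp.sum]
    rw [SimpleOp.integral_sum]
    exact Finset.sum_congr rfl fun B _ => SimpleOp.integral_single _ _ _ _
  have hq : Measure.QuasiMeasurePreserving (dilate c hc) (controlTrace μ) (controlTrace μ) := by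
    refine ⟨measurable_dilate c hc, ?_⟩
    rw [map_dilate_controlTrace]
    exact Measure.smul_absolutelyContinuous
  have hψa : IsApprox μ (fun x => f (dilate c hc x)) ψ := by
    obtain ⟨g, hgm, hgi, hg, hl⟩ := hφ
    refine ⟨fun x => g (dilate c hc x), hgm.comp (measurable_dilate c hc), ?_, fun n => ?_, ?_⟩
    · rw [← lintegral_map (f := fun x => g x ^ 2) (hgm.pow_const 2) (measurable_dilate c hc),
        map_dilate_controlTrace, lintegral_smul_measure]
      exact ENNReal.mul_lt_top ENNReal.ofReal_lt_top hgi
    · filter_upwards [hq.ae (hg n)] with x hx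
      rw [hψf]
      exact hx
    · filter_upwards [hq.ae hl] with x hx v
      simp only [hψf]
      exact hx v
  refine tendsto_nhds_unique (hW.tendsto_lintegral_sq hJ hψa) ?_
  simp only [hψi, hW.lintegral_sum_dilatePreimage_sq]
  exact ENNReal.Tendsto.const_mul (hW.tendsto_lintegral_sq hI hφ) (Or.inr (by simp))

end Scaling

/-! ### The complex noise -/

section Noise

variable {d : ℕ} {V : Type*} [NormedAddCommGroup V] [InnerProductSpace ℂ V] [CompleteSpace V]
  {Ω : Type*} [MeasurableSpace Ω] {P : Measure Ω} {μ : TraceClassMeasure V (USphere d)}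

omit [CompleteSpace V] in
-- An isometry preserves the real part by polarization; replacing `y` by `i y` and using
-- antilinearity reverses the sign of the imaginary part.
theorem inner_conj_conj (conj : V ≃ₗᵢ⋆[ℂ] V) (x y : V) :
    inner ℂ (conj x) (conj y) = inner ℂ y x := by
  have hre : ∀ x y : V, RCLike.re (inner ℂ (conj x) (conj y)) = RCLike.re (inner ℂ x y) := by
    intro x y
    rw [re_inner_eq_norm_add_mul_self_sub_norm_sub_mul_self_div_four,
      re_inner_eq_norm_add_mul_self_sub_norm_sub_mul_self_div_four, ← map_add, ← map_sub,
      conj.norm_map, conj.norm_map]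
  rw [← inner_conj_symm y x]
  have h1 := hre x y
  have h2 := hre x (Complex.I • y)
  rw [map_smulₛₗ, inner_smul_right, inner_smul_right] at h2
  simp at h1 h2
  refine Complex.ext ?_ ?_
  · rw [Complex.conj_re]; exact h1
  · rw [Complex.conj_im]; exact h2

omit [CompleteSpace V] in

theorem continuous_rankOne : Continuous fun q : V × V =>
    (InnerProductSpace.rankOne ℂ q.1 q.2 : V →L[ℂ] V) := by
  have h1 : Continuous fun q : V × V => innerSL ℂ q.2 :=
    (innerSL ℂ).continuous.comp continuous_snd
  exact (ContinuousLinearMap.smulRightL ℂ V V).continuous₂.comp (h1.prodMk continuous_fst)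

theorem aestronglyMeasurable_rankOne {X Y : Ω → V} (hX : AEStronglyMeasurable X P)
    (hY : AEStronglyMeasurable Y P) :
   AEStronglyMeasurable (fun ω => (InnerProductSpace.rankOne ℂ (X ω) (Y ω) : V →L[ℂ] V)) P := by
  have := (continuous_rankOne (V := V)).comp_aestronglyMeasurable (hX.prodMk hY)
  exact this

theorem integrable_rankOne {X Y : Ω → V} (hX : MemLp X 2 P) (hY : MemLp Y 2 P) :
   Integrable (fun ω => (InnerProductSpace.rankOne ℂ (X ω) (Y ω) : V →L[ℂ] V)) P := by
  refine (integrable_norm_iff (aestronglyMeasurable_rankOne hX.1 hY.1)).1 ?_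
  simp only [InnerProductSpace.norm_rankOne]
  exact hX.norm.integrable_mul hY.norm

theorem inner_crossCov {X Y : Ω → V} (hX : MemLp X 2 P) (hY : MemLp Y 2 P) (a b : V) :
    inner ℂ a (crossCov P X Y b) = ∫ ω, inner ℂ a (X ω) * inner ℂ (Y ω) b ∂P := by
  have hi := integrable_rankOne hX hY
  rw [crossCov, ContinuousLinearMap.integral_apply hi, ← integral_inner
    (hi.apply_continuousLinearMap b)]
  refine integral_congr_ae (Eventually.of_forall fun ω => ?_)
  simp only [InnerProductSpace.rankOne_apply, inner_smul_right]
  ring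

variable [MeasurableSpace V] [BorelSpace V] {conj : V ≃ₗᵢ⋆[ℂ] V} {ξ : BddBorel d → Ω → V}

theorem IsRealGaussianMeasure.integral_inner_mul_inner (hξ : IsRealGaussianMeasure conj P μ ξ)
    (B C : BddBorel d) (a b : V) :
    ∫ ω, inner ℂ a (ξ B ω) * inner ℂ (ξ C ω) b ∂P =
      2⁻¹ * inner ℂ a (controlMeasure μ ((B : Set (Polar d)) ∩ C) b) := by
  rw [← inner_crossCov (hξ.memLp B) (hξ.memLp C), hξ.cov, smul_apply, inner_smul_right]

/-- As `ξ` is real, `⟨b, ξ(C)⟩ = ⟨ξ(C), conj b⟩`. The pseudo-covariance is thus also given by the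
control measure, and is the same for `WR` and `WI`. -/
theorem IsRealGaussianMeasure.integral_inner_mul_inner' (hξ : IsRealGaussianMeasure conj P μ ξ)
    (B C : BddBorel d) (a b : V) :
    ∫ ω, inner ℂ a (ξ B ω) * inner ℂ b (ξ C ω) ∂P =
      2⁻¹ * inner ℂ a (controlMeasure μ ((B : Set (Polar d)) ∩ C) (conj b)) := by
  rw [← hξ.integral_inner_mul_inner]
  refine integral_congr_ae ?_
  filter_upwards [hξ.real C] with ω hω
  rw [← inner_conj_conj conj (ξ C ω) b, hω]

theorem integral_cexp_of_hasGaussianLaw {X : Ω → ℝ} (hX : HasGaussianLaw X P)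
    (h0 : ∫ ω, X ω ∂P = 0) :
    ∫ ω, Complex.exp (Complex.I * (X ω : ℝ)) ∂P =
      Complex.exp (-(2⁻¹ * (∫ ω, X ω ^ 2 ∂P : ℝ))) := by
  have h1 := charFun_apply_real (μ := P.map X) 1
  rw [hX.map_eq_gaussianReal, charFun_gaussianReal, ← hX.map_eq_gaussianReal,
    integral_map hX.aemeasurable (by fun_prop), h0, variance_of_integral_eq_zero hX.aemeasurable h0,
    Real.coe_toNNReal _ (integral_nonneg fun ω => sq_nonneg _)] at h1
  have h2 : ∀ ω, Complex.exp (Complex.I * (X ω : ℝ)) =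
      Complex.exp (((1 : ℝ) : ℂ) * (X ω : ℝ) * Complex.I) := fun ω => by
    rw [Complex.ofReal_one, one_mul, mul_comm]
  simp only [h2]
  rw [← h1]
  congr 1
  simp
  ring

variable [SecondCountableTopology V]

theorem IsRealGaussianMeasure.hasGaussianLaw_sum (hξ : IsRealGaussianMeasure conj P μ ξ)
    (s : Finset (BddBorel d)) (g : BddBorel d → V) (L : ℂ →L[ℝ] ℝ) :
    HasGaussianLaw (fun ω => L (∑ B ∈ s, inner ℂ (g B) (ξ B ω))) P := by
  have h := (hξ.gaussian.hasGaussianLaw s).map_fun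
    (∑ B : s, (L ∘L ((innerSL ℂ (g B)).restrictScalars ℝ)) ∘L
      ContinuousLinearMap.proj (R := ℝ) (φ := fun _ : s => V) B)
  convert! h using 2 with ω
  rw [map_sum, ← Finset.sum_coe_sort s, sum_apply]
  rfl

theorem IsRealGaussianMeasure.integral_sum (hξ : IsRealGaussianMeasure conj P μ ξ)
    [IsProbabilityMeasure P]
    (s : Finset (BddBorel d)) (g : BddBorel d → V) (L : ℂ →L[ℝ] ℝ) :
    ∫ ω, L (∑ B ∈ s, inner ℂ (g B) (ξ B ω)) ∂P = 0 := by
  have hi : ∀ B, Integrable (ξ B) P := fun B => (hξ.memLp B).integrable (by norm_num)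
  have hi2 : ∀ B, Integrable (fun ω => inner ℂ (g B) (ξ B ω)) P := fun B => (hi B).const_inner _
  rw [L.integral_comp_comm (integrable_finsetSum _ fun B _ => hi2 B),
    MeasureTheory.integral_finsetSum _ fun B _ => hi2 B, Finset.sum_eq_zero, map_zero]
  intro B _
  rw [integral_inner (hi B), hξ.centered, inner_zero_right]

theorem IsRealGaussianMeasure.memLp_sum (hξ : IsRealGaussianMeasure conj P μ ξ)
    (s : Finset (BddBorel d)) (g : BddBorel d → V) :
    MemLp (fun ω => ∑ B ∈ s, inner ℂ (g B) (ξ B ω)) 2 P :=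
  memLp_finsetSum _ fun B _ => (hξ.memLp B).const_inner _

theorem IsRealGaussianMeasure.integral_sq (hξ : IsRealGaussianMeasure conj P μ ξ)
    (s : Finset (BddBorel d)) (g : BddBorel d → V) :
    ∫ ω, (∑ B ∈ s, inner ℂ (g B) (ξ B ω)) ^ 2 ∂P = ∑ B ∈ s, ∑ C ∈ s,
      2⁻¹ * inner ℂ (g B) (controlMeasure μ ((B : Set (Polar d)) ∩ C) (conj (g C))) := by
  simp only [sq, Finset.sum_mul_sum]
  have hi : ∀ B C, Integrable (fun ω => inner ℂ (g B) (ξ B ω) * inner ℂ (g C) (ξ C ω)) P :=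
    fun B C => ((hξ.memLp B).const_inner _).integrable_mul ((hξ.memLp C).const_inner _)
  rw [MeasureTheory.integral_finsetSum _ fun B _ => integrable_finsetSum _ fun C _ => hi B C]
  refine Finset.sum_congr rfl fun B _ => ?_
  rw [MeasureTheory.integral_finsetSum _ fun C _ => hi B C]
  exact Finset.sum_congr rfl fun C _ => hξ.integral_inner_mul_inner' B C _ _

theorem integral_norm_sum_sq_of_memLp (hξ : ∀ B, MemLp (ξ B) 2 P)
    (s : Finset (BddBorel d)) (g : BddBorel d → V) :
    ((∫ ω, ‖∑ B ∈ s, inner ℂ (g B) (ξ B ω)‖ ^ 2 ∂P : ℝ) : ℂ) = ∑ B ∈ s, ∑ C ∈ s,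
      ∫ ω, inner ℂ (g B) (ξ B ω) * inner ℂ (ξ C ω) (g C) ∂P := by
  have h1 : ∀ ω, ((‖∑ B ∈ s, inner ℂ (g B) (ξ B ω)‖ ^ 2 : ℝ) : ℂ) =
      ∑ B ∈ s, ∑ C ∈ s, inner ℂ (g B) (ξ B ω) * inner ℂ (ξ C ω) (g C) := by
    intro ω
    rw [← Finset.sum_mul_sum]
    have h2 : ∑ C ∈ s, inner ℂ (ξ C ω) (g C) =
        (starRingEnd ℂ) (∑ C ∈ s, inner ℂ (g C) (ξ C ω)) := by
      rw [map_sum]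
      exact Finset.sum_congr rfl fun j _ => (inner_conj_symm _ _).symm
    rw [h2, Complex.mul_conj, Complex.normSq_eq_norm_sq]
  rw [← integral_complex_ofReal]
  simp only [h1]
  have hi : ∀ B C, Integrable (fun ω => inner ℂ (g B) (ξ B ω) * inner ℂ (ξ C ω) (g C)) P :=
    fun B C => ((hξ B).const_inner _).integrable_mul ((hξ C).inner_const _)
  rw [MeasureTheory.integral_finsetSum _ fun B _ => integrable_finsetSum _ fun C _ => hi B C]
  refine Finset.sum_congr rfl fun B _ => ?_
  rw [MeasureTheory.integral_finsetSum _ fun C _ => hi B C]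

theorem IsRealGaussianMeasure.integral_norm_sq (hξ : IsRealGaussianMeasure conj P μ ξ)
    (s : Finset (BddBorel d)) (g : BddBorel d → V) :
    ((∫ ω, ‖∑ B ∈ s, inner ℂ (g B) (ξ B ω)‖ ^ 2 ∂P : ℝ) : ℂ) = ∑ B ∈ s, ∑ C ∈ s,
      2⁻¹ * inner ℂ (g B) (controlMeasure μ ((B : Set (Polar d)) ∩ C) (g C)) := by
  rw [integral_norm_sum_sq_of_memLp hξ.memLp]
  simp only [hξ.integral_inner_mul_inner]

theorem integral_re_sq {Z : Ω → ℂ} (hZ : MemLp Z 2 P) :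
    ∫ ω, (Z ω).re ^ 2 ∂P = 2⁻¹ * (∫ ω, ‖Z ω‖ ^ 2 ∂P + (∫ ω, Z ω ^ 2 ∂P).re) := by
  have h2 : Integrable (fun ω => Z ω ^ 2) P := by
    simp only [sq]
    exact hZ.integrable_mul hZ
  have h4 : Integrable (fun ω => (Z ω ^ 2).re) P := h2.re
  have h3 : (∫ ω, Z ω ^ 2 ∂P).re = ∫ ω, (Z ω ^ 2).re ∂P := (integral_re h2).symm
  rw [h3, ← integral_add (integrable_norm_sq hZ) h4, ← integral_const_mul]
  refine integral_congr_ae (Eventually.of_forall fun ω => ?_)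
  simp only
  rw [← Complex.normSq_eq_norm_sq, Complex.normSq_apply, sq (Z ω), Complex.mul_re]
  ring

theorem integral_im_sq {Z : Ω → ℂ} (hZ : MemLp Z 2 P) :
    ∫ ω, (Z ω).im ^ 2 ∂P = 2⁻¹ * (∫ ω, ‖Z ω‖ ^ 2 ∂P - (∫ ω, Z ω ^ 2 ∂P).re) := by
  have h2 : Integrable (fun ω => Z ω ^ 2) P := by
    simp only [sq]
    exact hZ.integrable_mul hZ
  have h4 : Integrable (fun ω => (Z ω ^ 2).re) P := h2.re
  have h3 : (∫ ω, Z ω ^ 2 ∂P).re = ∫ ω, (Z ω ^ 2).re ∂P := (integral_re h2).symm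
  rw [h3, ← integral_sub (integrable_norm_sq hZ) h4, ← integral_const_mul]
  refine integral_congr_ae (Eventually.of_forall fun ω => ?_)
  simp only
  rw [← Complex.normSq_eq_norm_sq, Complex.normSq_apply, sq (Z ω), Complex.mul_re]
  ring

variable {WR WI W : BddBorel d → Ω → V}

theorem integral_inner_mul_inner_of_indep [IsProbabilityMeasure P]
    (hWR : IsRealGaussianMeasure conj P μ WR)
    (hWI : IsRealGaussianMeasure conj P μ WI)
    (hind : IndepFun (fun ω B => WR B ω) (fun ω B => WI B ω) P) (B C : BddBorel d) (a b : V) :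
    ∫ ω, inner ℂ a (WR B ω) * inner ℂ (WI C ω) b ∂P = 0 := by
  have hm1 : Measurable fun x : BddBorel d → V => inner ℂ a (x B) :=
    (by fun_prop : Continuous fun v : V => inner ℂ a v).measurable.comp (measurable_pi_apply B)
  have hm2 : Measurable fun x : BddBorel d → V => inner ℂ (x C) b :=
    (by fun_prop : Continuous fun v : V => inner ℂ v b).measurable.comp (measurable_pi_apply C)
  have h := hind.integral_fun_comp_mul_comp (measurable_pi_lambda _ hWR.measurable).aemeasurable
    (measurable_pi_lambda _ hWI.measurable).aemeasurable hm1.aestronglyMeasurable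
    hm2.aestronglyMeasurable
  rw [h, integral_inner ((hWR.memLp B).integrable (by norm_num)), hWR.centered,
    inner_zero_right, zero_mul]

/-- Independent real and imaginary parts with the same law give a circular noise. -/
theorem isCircularNoise_of_isRealGaussianMeasure [IsProbabilityMeasure P]
    (hWR : IsRealGaussianMeasure conj P μ WR) (hWI : IsRealGaussianMeasure conj P μ WI)
    (hind : IndepFun (fun ω B => WR B ω) (fun ω B => WI B ω) P)
    (hW : ∀ B ω, W B ω = WR B ω + Complex.I • WI B ω) : IsCircularNoise P μ W := by
  have hmem : ∀ B, MemLp (W B) 2 P := fun B => by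
    have : W B = fun ω => WR B ω + Complex.I • WI B ω := funext (hW B)
    rw [this]
    exact (hWR.memLp B).add ((hWI.memLp B).const_smul Complex.I)
  have hcov : ∀ (B C : BddBorel d) (a b : V), ∫ ω, inner ℂ a (W B ω) * inner ℂ (W C ω) b ∂P =
      inner ℂ a (controlMeasure μ ((B : Set (Polar d)) ∩ C) b) := by
    intro B C a b
    have e : ∀ ω, inner ℂ a (W B ω) * inner ℂ (W C ω) b =
        (inner ℂ a (WR B ω) * inner ℂ (WR C ω) b + inner ℂ a (WI B ω) * inner ℂ (WI C ω) b) +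
        ((-Complex.I) * (inner ℂ a (WR B ω) * inner ℂ (WI C ω) b) +
          Complex.I * (inner ℂ a (WI B ω) * inner ℂ (WR C ω) b)) := by
      intro ω
      simp only [hW, inner_add_left, inner_add_right, inner_smul_left, inner_smul_right,
        Complex.conj_I]
      linear_combination (-(inner ℂ a (WI B ω) * inner ℂ (WI C ω) b)) * Complex.I_sq
    have hi : ∀ (ξ η : BddBorel d → Ω → V), (∀ B, MemLp (ξ B) 2 P) → (∀ B, MemLp (η B) 2 P) →
        Integrable (fun ω => inner ℂ a (ξ B ω) * inner ℂ (η C ω) b) P := fun ξ η h1 h2 =>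
      ((h1 B).const_inner _).integrable_mul ((h2 C).inner_const _)
    have i1 := hi WR WR hWR.memLp hWR.memLp
    have i2 := hi WI WI hWI.memLp hWI.memLp
    have i3 := hi WR WI hWR.memLp hWI.memLp
    have i4 := hi WI WR hWI.memLp hWR.memLp
    simp only [e]
    have i5 := i3.const_mul (-Complex.I)
    have i6 := i4.const_mul Complex.I
    have i12 : Integrable (fun ω => inner ℂ a (WR B ω) * inner ℂ (WR C ω) b +
      inner ℂ a (WI B ω) * inner ℂ (WI C ω) b) P := i1.add i2
    have i56 : Integrable (fun ω => (-Complex.I) * (inner ℂ a (WR B ω) * inner ℂ (WI C ω) b) +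
      Complex.I * (inner ℂ a (WI B ω) * inner ℂ (WR C ω) b)) P := i5.add i6
    rw [integral_add i12 i56, integral_add i1 i2,
      integral_add i5 i6, integral_const_mul, integral_const_mul,
      integral_inner_mul_inner_of_indep hWR hWI hind,
      integral_inner_mul_inner_of_indep hWI hWR hind.symm, hWR.integral_inner_mul_inner,
      hWI.integral_inner_mul_inner]
    ring
  refine ⟨hmem, hcov, fun φ h => ?_⟩
  set s := φ.support
  set g : BddBorel d → V := fun B => ContinuousLinearMap.adjoint (φ B) h
  have hZ : ∀ (ξ : BddBorel d → Ω → V) ω, inner ℂ h (φ.integral ξ ω) =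
      ∑ B ∈ s, inner ℂ (g B) (ξ B ω) := by
    intro ξ ω
    rw [SimpleOp.integral, Finsupp.sum, inner_sum]
    refine Finset.sum_congr rfl fun C _ => ?_
    rw [ContinuousLinearMap.adjoint_inner_left]
  set ZR : Ω → ℂ := fun ω => ∑ B ∈ s, inner ℂ (g B) (WR B ω) with hZR
  set ZI : Ω → ℂ := fun ω => ∑ B ∈ s, inner ℂ (g B) (WI B ω) with hZI
  have hsum : ∀ ω, inner ℂ h (φ.integral W ω) = ZR ω + Complex.I * ZI ω := by
    intro ω
    rw [hZ]
    simp only [hW, inner_add_right, inner_smul_right, Finset.sum_add_distrib, ← Finset.mul_sum,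
      hZR, hZI]
  have hmR : MemLp ZR 2 P := hWR.memLp_sum s g
  have hmI : MemLp ZI 2 P := hWI.memLp_sum s g
  have hn : ∫ ω, ‖ZR ω‖ ^ 2 ∂P = ∫ ω, ‖ZI ω‖ ^ 2 ∂P := by
    have h1 := hWR.integral_norm_sq s g
    rw [← hWI.integral_norm_sq s g] at h1
    exact_mod_cast h1
  have hq : ∫ ω, ZR ω ^ 2 ∂P = ∫ ω, ZI ω ^ 2 ∂P := by
    rw [hWR.integral_sq s g, hWI.integral_sq s g]
  have hW2 : ∫ ω, ‖inner ℂ h (φ.integral W ω)‖ ^ 2 ∂P = 2 * ∫ ω, ‖ZR ω‖ ^ 2 ∂P := by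
    have h1 := integral_norm_sum_sq_of_memLp hmem s g
    simp only [hcov] at h1
    have h2 := hWR.integral_norm_sq s g
    simp only [← Finset.mul_sum] at h2
    simp only [hZ]
    apply Complex.ofReal_injective
    rw [h1, Complex.ofReal_mul, h2]
    push_cast
    rw [← mul_assoc, mul_inv_cancel₀ two_ne_zero, one_mul]
  have hexp : ∀ ω, Complex.exp (Complex.I * ((inner ℂ h (φ.integral W ω)).re : ℝ)) =
      Complex.exp (Complex.I * ((ZR ω).re : ℝ)) * Complex.exp (Complex.I * ((-(ZI ω).im : ℝ) : ℂ)) := by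
    intro ω
    rw [hsum, ← Complex.exp_add]
    congr 1
    simp
    ring
  have hmeas : ∀ L : ℂ →L[ℝ] ℝ, Measurable fun x : BddBorel d → V =>
      Complex.exp (Complex.I * (L (∑ B ∈ s, inner ℂ (g B) (x B)) : ℝ)) := by
    intro L
    have h1 : Measurable fun x : BddBorel d → V => ∑ B ∈ s, inner ℂ (g B) (x B) :=
      Finset.measurable_fun_sum s fun B _ =>
        (by fun_prop : Continuous fun v : V => inner ℂ (g B) v).measurable.comp
          (measurable_pi_apply B)
    have h2 : Continuous fun z : ℂ => Complex.exp (Complex.I * (L z : ℝ)) := by fun_prop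
    exact h2.measurable.comp h1
  simp only [hexp]
  have hprod := hind.integral_fun_comp_mul_comp
    (measurable_pi_lambda _ hWR.measurable).aemeasurable
    (measurable_pi_lambda _ hWI.measurable).aemeasurable
    (hmeas Complex.reCLM).aestronglyMeasurable (hmeas (-Complex.imCLM)).aestronglyMeasurable
  refine hprod.trans ?_
  rw [integral_cexp_of_hasGaussianLaw (hWR.hasGaussianLaw_sum s g Complex.reCLM)
      (hWR.integral_sum s g _),
    integral_cexp_of_hasGaussianLaw (hWI.hasGaussianLaw_sum s g (-Complex.imCLM))
      (hWI.integral_sum s g _), ← Complex.exp_add]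
  congr 1
  have h1 : ∫ ω, (Complex.reCLM (∑ B ∈ s, inner ℂ (g B) (WR B ω))) ^ 2 ∂P =
      2⁻¹ * (∫ ω, ‖ZR ω‖ ^ 2 ∂P + (∫ ω, ZR ω ^ 2 ∂P).re) :=
    integral_re_sq (Z := fun ω => ∑ B ∈ s, inner ℂ (g B) (WR B ω)) hmR
  have h2 : ∫ ω, (((-Complex.imCLM : ℂ →L[ℝ] ℝ)) (∑ B ∈ s, inner ℂ (g B) (WI B ω))) ^ 2 ∂P =
      2⁻¹ * (∫ ω, ‖ZI ω‖ ^ 2 ∂P - (∫ ω, ZI ω ^ 2 ∂P).re) := by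
    rw [← integral_im_sq (Z := fun ω => ∑ B ∈ s, inner ℂ (g B) (WI B ω)) hmI]
    refine integral_congr_ae (Eventually.of_forall fun ω => ?_)
    simp only [neg_apply, neg_sq, Complex.imCLM_apply]
  -- The exponent involves the real part of `ZR` and the imaginary part of `ZI`, so the
  -- pseudo-variances enter with opposite signs and cancel.
  rw [h1, h2, hW2, hq, hn]
  push_cast
  ring

end Noise

/-! ### Laws of stochastic integrals -/

section Gaussian

/-- This is Riesz representation for the real inner product `Re⟨·,·⟩`, coordinate by coordinate. -/
theorem exists_eq_sum_re_inner {V : Type*} [NormedAddCommGroup V] [InnerProductSpace ℂ V]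
    [CompleteSpace V] {ι : Type*} [Fintype ι] (L : StrongDual ℝ (ι → V)) :
    ∃ h : ι → V, ∀ x, L x = ∑ i, (inner ℂ (h i) (x i)).re := by
  classical
  have key : ∀ M : V →L[ℝ] ℝ, ∃ h : V, ∀ x, M x = (inner ℂ h x).re := by
    intro M
    let _ : InnerProductSpace ℝ V := InnerProductSpace.complexToReal
    refine ⟨(InnerProductSpace.toDual ℝ V).symm M, fun x => ?_⟩
    exact (InnerProductSpace.toDual_symm_apply (𝕜 := ℝ) (x := x) (y := M)).symm
  choose h hh using fun i => key (L ∘L ContinuousLinearMap.single ℝ (fun _ : ι => V) i)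
  refine ⟨h, fun x => ?_⟩
  simp only [← hh]
  conv_lhs => rw [← Finset.univ_sum_single x, map_sum]
  rfl

theorem eLpNorm_natCast_pow {α E : Type*} [MeasurableSpace α] {m : Measure α}
    [NormedAddCommGroup E] (f : α → E) {p : ℕ} (hp : p ≠ 0) :
    eLpNorm f p m ^ p = ∫⁻ x, ‖f x‖ₑ ^ p ∂m := by
  have h := eLpNorm_nnreal_pow_eq_lintegral (f := f) (μ := m) (p := (p : ℝ≥0))
    (by exact_mod_cast hp)
  simpa using h

theorem exists_lintegral_gaussianReal_pow (m : ℕ) : ∃ c : ℝ≥0∞, c ≠ ∞ ∧ ∀ v : ℝ≥0,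
    ∫⁻ x, ‖x‖ₑ ^ (2 * m) ∂(gaussianReal 0 v) ≤ c * (v : ℝ≥0∞) ^ m := by
  refine ⟨∫⁻ x, ‖x‖ₑ ^ (2 * m) ∂(gaussianReal 0 1), ?_, fun v => ?_⟩
  · rcases Nat.eq_zero_or_pos m with rfl | hm
    · simp
    have h := memLp_id_gaussianReal' (μ := 0) (v := 1) ((2 * m : ℕ) : ℝ≥0∞)
      (ENNReal.natCast_ne_top _)
    have h2 := ENNReal.pow_lt_top (n := 2 * m) h.eLpNorm_lt_top
    rw [eLpNorm_natCast_pow _ (by positivity)] at h2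
    exact h2.ne
  · have h := gaussianReal_map_const_mul (μ := 0) (v := 1) (NNReal.sqrt v : ℝ)
    have e : (NNReal.mk ((NNReal.sqrt v : ℝ) ^ 2) (sq_nonneg _)) * 1 = v := by
      apply NNReal.eq
      simp
    rw [mul_zero, e] at h
    rw [← h, lintegral_map (by fun_prop) (by fun_prop), mul_comm _ ((v : ℝ≥0∞) ^ m),
      ← lintegral_const_mul' _ _ (by finiteness)]
    refine lintegral_mono fun x => ?_
    rw [enorm_mul, mul_pow]
    refine mul_le_mul' (le_of_eq ?_) le_rfl
    rw [pow_mul, Real.enorm_eq_ofReal (NNReal.coe_nonneg _), ENNReal.ofReal_coe_nnreal]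
    norm_cast
    rw [NNReal.sq_sqrt]

variable {d : ℕ} {V : Type*} [NormedAddCommGroup V] [InnerProductSpace ℂ V] [CompleteSpace V]
  [SecondCountableTopology V]
  {Ω : Type*} [MeasurableSpace Ω] {P : Measure Ω} [IsProbabilityMeasure P]
  {μ : TraceClassMeasure V (USphere d)}
  {W : BddBorel d → Ω → V} {f : Polar d → V →L[ℂ] V} {I : Ω → V}

/-- The formula for simple integrals passes to the limit: the left side along an almost surely
convergent subsequence, the right side by convergence of second moments. -/
theorem IsCircularNoise.integral_cexp (hW : IsCircularNoise P μ W) (hI : IsStochInt μ W P f I)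
    (h : V) : ∫ ω, Complex.exp (Complex.I * ((inner ℂ h (I ω)).re : ℝ)) ∂P =
      Complex.exp (-(4⁻¹ * (∫ ω, ‖inner ℂ h (I ω)‖ ^ 2 ∂P : ℝ))) := by
  obtain ⟨hIm, φ, -, hlim⟩ := isStochInt_iff.1 hI
  have hm := fun n => hW.memLp_integral (φ n)
  have hIM : TendstoInMeasure P (fun n => (φ n).integral W) atTop I := by
    refine tendstoInMeasure_of_tendsto_eLpNorm two_ne_zero (fun n => (hm n).1) hIm.1 ?_
    refine hlim.congr fun n => ?_
    rw [eLpNorm_sub_comm]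
    rfl
  obtain ⟨ns, hns, hae⟩ := hIM.exists_seq_tendsto_ae
  have h1 : Tendsto (fun i => ∫ ω, Complex.exp (Complex.I *
      ((inner ℂ h ((φ (ns i)).integral W ω)).re : ℝ)) ∂P) atTop
      (𝓝 (∫ ω, Complex.exp (Complex.I * ((inner ℂ h (I ω)).re : ℝ)) ∂P)) := by
    have hc : Continuous fun v : V => Complex.exp (Complex.I * ((inner ℂ h v).re : ℝ)) := by
      fun_prop
    refine tendsto_integral_of_dominated_convergence (fun _ => 1)
      (fun n => hc.comp_aestronglyMeasurable (hm _).1) (integrable_const _)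
      (fun n => Eventually.of_forall fun ω => ?_) ?_
    · rw [mul_comm, Complex.norm_exp_ofReal_mul_I]
    · filter_upwards [hae] with ω hω
      exact (hc.tendsto _).comp hω
  have h2 : Tendsto (fun n => ∫ ω, ‖inner ℂ h ((φ n).integral W ω)‖ ^ 2 ∂P) atTop
      (𝓝 (∫ ω, ‖inner ℂ h (I ω)‖ ^ 2 ∂P)) := by
    have h3 : Tendsto (fun n => eLpNorm (fun ω => inner ℂ h ((φ n).integral W ω)) 2 P) atTop
        (𝓝 (eLpNorm (fun ω => inner ℂ h (I ω)) 2 P)) := by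
      refine tendsto_eLpNorm_of_sub (hIm.const_inner h) (fun n => ((hm n).const_inner h).1) ?_
      have h4 := ENNReal.Tendsto.const_mul (a := ENNReal.ofReal ‖h‖) hlim (Or.inr (by simp))
      rw [mul_zero] at h4
      refine tendsto_of_tendsto_of_tendsto_of_le_of_le tendsto_const_nhds h4 (fun _ => zero_le)
        fun n => eLpNorm_le_mul_eLpNorm_of_ae_le_mul (Eventually.of_forall fun ω => ?_) _
      rw [← inner_sub_right]
      exact norm_inner_le_norm _ _
    have h5 := ENNReal.Tendsto.pow (n := 2) h3
    simp only [← lintegral_enorm_sq_eq_eLpNorm] at h5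
    rw [lintegral_enorm_sq_eq (hIm.const_inner h)] at h5
    have h6 := (ENNReal.tendsto_toReal (by simp)).comp h5
    rw [ENNReal.toReal_ofReal (integral_nonneg fun ω => sq_nonneg _)] at h6
    refine h6.congr fun n => ?_
    simp only [Function.comp_apply]
    rw [lintegral_enorm_sq_eq ((hm n).const_inner h),
      ENNReal.toReal_ofReal (integral_nonneg fun ω => sq_nonneg _)]
  refine tendsto_nhds_unique h1 ?_
  simp only [hW.charFun]
  have hc : Continuous fun x : ℝ => Complex.exp (-(4⁻¹ * (x : ℂ))) := by fun_prop
  exact (hc.tendsto _).comp (h2.comp hns.tendsto_atTop)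

/-- The real part of a functional of a stochastic integral is Gaussian. -/
theorem IsCircularNoise.map_re_inner (hW : IsCircularNoise P μ W) (hI : IsStochInt μ W P f I)
    (h : V) : P.map (fun ω => (inner ℂ h (I ω)).re) =
      gaussianReal 0 (2⁻¹ * ∫ ω, ‖inner ℂ h (I ω)‖ ^ 2 ∂P).toNNReal := by
  have hm : AEMeasurable (fun ω => (inner ℂ h (I ω)).re) P :=
    (Complex.continuous_re.comp_aestronglyMeasurable (hI.1.const_inner h).1).aemeasurable
  have := P.isProbabilityMeasure_map hm
  refine Measure.ext_of_charFun (funext fun t => ?_)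
  rw [charFun_gaussianReal, charFun_apply_real, integral_map hm (by fun_prop)]
  have h1 := hW.integral_cexp hI ((t : ℂ) • h)
  simp only [inner_smul_left, Complex.conj_ofReal, norm_mul, mul_pow] at h1
  rw [integral_const_mul] at h1
  refine Eq.trans (integral_congr_ae (Eventually.of_forall fun ω => ?_)) (h1.trans ?_)
  · simp
    ring_nf
  · congr 1
    rw [Real.coe_toNNReal _ (mul_nonneg (by norm_num) (integral_nonneg fun ω => sq_nonneg _))]
    simp
    ring

/-! ### Gaussian families of stochastic integrals -/

section Field

variable [MeasurableSpace V] [BorelSpace V]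

/-- Rank one operators with values in the line of a unit vector `e` collect all functionals into one
integral `∑ T_i I_i`, for which the modulus of the `e`-coordinate is the norm. Real functionals of
families are thereby reduced to a single stochastic integral. -/
theorem IsCircularNoise.exists_isStochInt_functional (hW : IsCircularNoise P μ W) {ι : Type*}
    [Fintype ι] [Nontrivial V] {f : ι → Polar d → V →L[ℂ] V} {I : ι → Ω → V}
    (hI : ∀ i, IsStochInt μ W P (f i) (I i)) (L : StrongDual ℝ (ι → V)) :
    ∃ (T : ι → V →L[ℂ] V) (e : V), ‖e‖ = 1 ∧
      (∀ x : ι → V, L x = (inner ℂ e (∑ i, T i (x i))).re) ∧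
      (∀ x : ι → V, ‖inner ℂ e (∑ i, T i (x i))‖ = ‖∑ i, T i (x i)‖) ∧
      IsStochInt μ W P (fun x => ∑ i, T i ∘L f i x) (fun ω => ∑ i, T i (I i ω)) := by
  obtain ⟨h, hL⟩ := exists_eq_sum_re_inner L
  obtain ⟨e, he⟩ := exists_norm_eq V zero_le_one
  have hs : ∀ x : ι → V, ∑ i, InnerProductSpace.rankOne ℂ e (h i) (x i) =
      (∑ i, inner ℂ (h i) (x i)) • e := fun x => by
    simp only [InnerProductSpace.rankOne_apply, Finset.sum_smul]
  have he2 : inner ℂ e e = 1 := by rw [inner_self_eq_norm_sq_to_K, he]; simp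
  refine ⟨fun i => InnerProductSpace.rankOne ℂ e (h i), e, he, fun x => ?_, fun x => ?_,
    hW.isStochInt_sum Finset.univ fun i _ => (hI i).comp _⟩
  · rw [hs, inner_smul_right, he2, mul_one, hL]
    simp
  · rw [hs, inner_smul_right, he2, mul_one, norm_smul, he, mul_one]

theorem IsCircularNoise.isGaussianProcess (hW : IsCircularNoise P μ W) {T : Type*}
    {f : T → Polar d → V →L[ℂ] V} {X : T → Ω → V} (hX : ∀ t, IsStochInt μ W P (f t) (X t)) :
    IsGaussianProcess X P := by
  refine ⟨fun s => ⟨?_⟩⟩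
  have hm : AEMeasurable (fun ω => s.restrict (X · ω)) P :=
    aemeasurable_pi_lambda _ fun t => (hX t).1.1.aemeasurable
  have := P.isProbabilityMeasure_map hm
  rcases subsingleton_or_nontrivial V with hV | hV
  · exact IsGaussian.of_subsingleton
  refine isGaussian_of_map_eq_gaussianReal fun L => ?_
  obtain ⟨S, e, -, hL, -, hS⟩ := hW.exists_isStochInt_functional (fun t : s => hX t) L
  refine ⟨0, (2⁻¹ * ∫ ω, ‖inner ℂ e (∑ t, S t (X t ω))‖ ^ 2 ∂P).toNNReal, ?_⟩
  rw [AEMeasurable.map_map_of_aemeasurable L.continuous.measurable.aemeasurable hm, ← hW.map_re_inner hS e]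
  congr 1
  funext ω
  simp [hL]

theorem IsCircularNoise.integral_eq_zero (hW : IsCircularNoise P μ W)
    (hI : IsStochInt μ W P f I) : ∫ ω, I ω ∂P = 0 := by
  have hi : Integrable I P := hI.1.integrable (by norm_num)
  have h1 : ∀ h : V, ∫ ω, (inner ℂ h (I ω)).re ∂P = 0 := by
    intro h
    have hm : AEMeasurable (fun ω => (inner ℂ h (I ω)).re) P :=
      (Complex.continuous_re.comp_aestronglyMeasurable (hI.1.const_inner h).1).aemeasurable
    have := integral_map (f := fun x : ℝ => x) hm (by fun_prop)
    rw [← this, hW.map_re_inner hI h, integral_id_gaussianReal]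
  -- Testing the vanishing of all means `Re⟨h, ·⟩` with `h` the mean itself.
  have h2 := h1 (∫ ω, I ω ∂P)
  have h3 : (∫ ω, inner ℂ (∫ ω, I ω ∂P) (I ω) ∂P).re = 0 := by
    rw [← h2]
    exact (integral_re (hi.const_inner (𝕜 := ℂ) _)).symm
  rw [integral_inner hi, inner_self_eq_norm_sq_to_K] at h3
  have h4 : ‖∫ ω, I ω ∂P‖ ^ 2 = 0 := by exact_mod_cast h3
  simpa using h4

/-- Families of stochastic integrals are identically distributed if all linear combinations have
the same second moments. -/
theorem IsCircularNoise.identDistrib (hW : IsCircularNoise P μ W) {ι : Type*} [Fintype ι]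
    {f g : ι → Polar d → V →L[ℂ] V} {I J : ι → Ω → V}
    (hI : ∀ i, IsStochInt μ W P (f i) (I i)) (hJ : ∀ i, IsStochInt μ W P (g i) (J i))
    (h : ∀ T : ι → V →L[ℂ] V, ∫⁻ ω, ‖∑ i, T i (I i ω)‖ₑ ^ 2 ∂P =
      ∫⁻ ω, ‖∑ i, T i (J i ω)‖ₑ ^ 2 ∂P) :
    IdentDistrib (fun ω i => I i ω) (fun ω i => J i ω) P P := by
  have hmI : AEMeasurable (fun ω i => I i ω) P :=
    aemeasurable_pi_lambda _ fun t => (hI t).1.1.aemeasurable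
  have hmJ : AEMeasurable (fun ω i => J i ω) P :=
    aemeasurable_pi_lambda _ fun t => (hJ t).1.1.aemeasurable
  refine ⟨hmI, hmJ, ?_⟩
  have := P.isProbabilityMeasure_map hmI
  have := P.isProbabilityMeasure_map hmJ
  rcases subsingleton_or_nontrivial V with hV | hV
  · congr 1
    funext ω i
    exact Subsingleton.elim _ _
  have key : ∀ {f : ι → Polar d → V →L[ℂ] V} {I : ι → Ω → V}
      (hI : ∀ i, IsStochInt μ W P (f i) (I i)) (T : ι → V →L[ℂ] V) (e : V)
      (L : StrongDual ℝ (ι → V)) (hL : ∀ x : ι → V, L x = (inner ℂ e (∑ i, T i (x i))).re)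
      (hn : ∀ x : ι → V, ‖inner ℂ e (∑ i, T i (x i))‖ = ‖∑ i, T i (x i)‖),
      charFunDual (P.map fun ω i => I i ω) L = Complex.exp (-(4⁻¹ *
        ((∫⁻ ω, ‖∑ i, T i (I i ω)‖ₑ ^ 2 ∂P).toReal : ℝ))) := by
    intro f I hI T e L hL hn
    have hS := hW.isStochInt_sum Finset.univ fun i _ => (hI i).comp (T i)
    rw [charFunDual_apply, integral_map
      (aemeasurable_pi_lambda _ fun t => (hI t).1.1.aemeasurable) (by fun_prop)]
    have h1 := hW.integral_cexp hS e
    simp only [hn fun i => I i _] at h1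
    rw [lintegral_enorm_sq_eq hS.1, ENNReal.toReal_ofReal (integral_nonneg fun ω => sq_nonneg _),
      ← h1]
    refine integral_congr_ae (Eventually.of_forall fun ω => ?_)
    simp only [hL, mul_comm]
  refine Measure.ext_of_charFunDual (funext fun L => ?_)
  obtain ⟨T, e, -, hL, hn, -⟩ := hW.exists_isStochInt_functional hI L
  rw [key hI T e L hL hn, key hJ T e L hL hn, h T]

end Field

/-! ### Moments -/

/-- The real part of `⟨h, I⟩` is Gaussian, and the imaginary part is the real part of `⟨i h, I⟩`.
The constant is uniform in the probability space and the integrand. -/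
theorem IsCircularNoise.exists_inner_moment_bound (m : ℕ) : ∃ c : ℝ≥0∞, c ≠ ∞ ∧
    ∀ {Ω : Type*} [MeasurableSpace Ω] {P : Measure Ω} [IsProbabilityMeasure P]
      {W : BddBorel d → Ω → V} (_ : IsCircularNoise P μ W)
      {f : Polar d → V →L[ℂ] V} {I : Ω → V} (_ : IsStochInt μ W P f I) (h : V),
      ∫⁻ ω, ‖inner ℂ h (I ω)‖ₑ ^ (2 * m) ∂P ≤ c * (∫⁻ ω, ‖inner ℂ h (I ω)‖ₑ ^ 2 ∂P) ^ m := by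
  obtain ⟨c, hc, hcb⟩ := exists_lintegral_gaussianReal_pow m
  refine ⟨2 ^ (2 * m) * (2 * c), by finiteness, ?_⟩
  intro Ω _ P _ W hW f I hI h
  have hm : ∀ h, AEMeasurable (fun ω => (inner ℂ h (I ω)).re) P := fun h =>
    (Complex.continuous_re.comp_aestronglyMeasurable (hI.1.const_inner h).1).aemeasurable
  have h1 : ∀ h : V, ∫⁻ ω, ‖(inner ℂ h (I ω)).re‖ₑ ^ (2 * m) ∂P ≤
      c * (∫⁻ ω, ‖inner ℂ h (I ω)‖ₑ ^ 2 ∂P) ^ m := by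
    intro h
    have h2 := lintegral_map' (f := fun x : ℝ => ‖x‖ₑ ^ (2 * m)) (by fun_prop) (hm h)
    rw [← h2, hW.map_re_inner hI h]
    refine (hcb _).trans ?_
    gcongr
    rw [lintegral_enorm_sq_eq (hI.1.const_inner h)]
    refine ENNReal.ofReal_le_ofReal ?_
    have : 0 ≤ ∫ ω, ‖inner ℂ h (I ω)‖ ^ 2 ∂P := integral_nonneg fun ω => sq_nonneg _
    linarith
  have h3 : ∀ ω, (inner ℂ (Complex.I • h) (I ω)).re = (inner ℂ h (I ω)).im := by
    intro ω
    simp [inner_smul_left]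
  have h4 := h1 (Complex.I • h)
  simp only [h3] at h4
  have h5 : ∀ ω, ‖inner ℂ (Complex.I • h) (I ω)‖ₑ = ‖inner ℂ h (I ω)‖ₑ := by
    intro ω
    rw [inner_smul_left, enorm_mul, Complex.conj_I, enorm_neg, ← ofReal_norm Complex.I,
      Complex.norm_I, ENNReal.ofReal_one, one_mul]
  simp only [h5] at h4
  calc ∫⁻ ω, ‖inner ℂ h (I ω)‖ₑ ^ (2 * m) ∂P
      ≤ ∫⁻ ω, 2 ^ (2 * m) * (‖(inner ℂ h (I ω)).re‖ₑ ^ (2 * m) +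
          ‖(inner ℂ h (I ω)).im‖ₑ ^ (2 * m)) ∂P := by
        refine lintegral_mono fun ω => ?_
        set z : ℂ := inner ℂ h (I ω)
        have hz : ‖z‖ₑ ≤ 2 * max ‖z.re‖ₑ ‖z.im‖ₑ := by
          have e1 : ‖z‖ₑ ≤ ‖z.re‖ₑ + ‖z.im‖ₑ := by
            simp only [← ofReal_norm]
            rw [← ENNReal.ofReal_add (norm_nonneg _) (norm_nonneg _)]
            exact ENNReal.ofReal_le_ofReal (Complex.norm_le_abs_re_add_abs_im z)
          rw [two_mul]
          exact e1.trans (add_le_add (le_max_left _ _) (le_max_right _ _))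
        refine (pow_le_pow_left' hz _).trans ?_
        rw [mul_pow]
        gcongr
        rcases max_cases ‖z.re‖ₑ ‖z.im‖ₑ with ⟨h6, -⟩ | ⟨h6, -⟩ <;> rw [h6]
        · exact le_self_add
        · exact le_add_self
    _ = 2 ^ (2 * m) * (∫⁻ ω, ‖(inner ℂ h (I ω)).re‖ₑ ^ (2 * m) ∂P +
          ∫⁻ ω, ‖(inner ℂ h (I ω)).im‖ₑ ^ (2 * m) ∂P) := by
        rw [lintegral_const_mul' _ _ (by finiteness), lintegral_add_left']
        exact ((hm h).enorm.pow_const _)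
    _ ≤ 2 ^ (2 * m) * (c * (∫⁻ ω, ‖inner ℂ h (I ω)‖ₑ ^ 2 ∂P) ^ m +
          c * (∫⁻ ω, ‖inner ℂ h (I ω)‖ₑ ^ 2 ∂P) ^ m) := by
        gcongr
        exact h1 h
    _ = _ := by ring

/-- All moments of a stochastic integral are controlled by the second moment. -/
theorem IsCircularNoise.exists_even_moment_bound {m : ℕ} (hm : m ≠ 0) : ∃ c : ℝ≥0∞, c ≠ ∞ ∧
    ∀ {Ω : Type*} [MeasurableSpace Ω] {P : Measure Ω} [IsProbabilityMeasure P]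
      {W : BddBorel d → Ω → V} (_ : IsCircularNoise P μ W)
      {f : Polar d → V →L[ℂ] V} {I : Ω → V} (_ : IsStochInt μ W P f I),
      ∫⁻ ω, ‖I ω‖ₑ ^ (2 * m) ∂P ≤ c * (∫⁻ ω, ‖I ω‖ₑ ^ 2 ∂P) ^ m := by
  obtain ⟨c, hc, hcb⟩ := exists_inner_moment_bound (V := V) (μ := μ) m
  refine ⟨c, hc, ?_⟩
  intro Ω _ P _ W hW f I hI
  -- Partial sums of Parseval's identity. Minkowski's inequality in `L^m` for `|⟨e, I⟩|²` sums the
  -- scalar bounds without any independence of coordinates; Fatou's lemma passes to `‖I‖²`.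
  set S : Finset (onSystem V) → Ω → ℝ := fun F ω => ∑ e ∈ F, ‖inner ℂ (e : V) (I ω)‖ ^ 2 with hS
  have hmem : ∀ e : onSystem V, MemLp (fun ω => inner ℂ (e : V) (I ω)) 2 P := fun e =>
    hI.1.const_inner _
  have hSe : ∀ F ω, ‖S F ω‖ₑ = ∑ e ∈ F, ‖inner ℂ (e : V) (I ω)‖ₑ ^ 2 := by
    intro F ω
    rw [Real.enorm_eq_ofReal (Finset.sum_nonneg fun _ _ => sq_nonneg _),
      ENNReal.ofReal_sum_of_nonneg fun _ _ => sq_nonneg _]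
    refine Finset.sum_congr rfl fun e _ => ?_
    rw [ENNReal.ofReal_pow (norm_nonneg _), ofReal_norm]
  have hSm : ∀ F, AEStronglyMeasurable (S F) P := fun F =>
    Finset.aestronglyMeasurable_fun_sum _ fun e _ => ((hmem e).1.norm.pow 2)
  have hF : ∀ F, ∫⁻ ω, ‖S F ω‖ₑ ^ m ∂P ≤ c * (∫⁻ ω, ‖I ω‖ₑ ^ 2 ∂P) ^ m := by
    intro F
    have h1 : ∀ (g : Ω → ℝ), ∫⁻ ω, ‖g ω‖ₑ ^ m ∂P = eLpNorm g m P ^ m := by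
      intro g
      exact (eLpNorm_natCast_pow g hm).symm
    have h2 : ∀ e : onSystem V, eLpNorm (fun ω => ‖inner ℂ (e : V) (I ω)‖ ^ 2) m P ≤
        c ^ ((m : ℝ)⁻¹) * ∫⁻ ω, ‖inner ℂ (e : V) (I ω)‖ₑ ^ 2 ∂P := by
      intro e
      have h3 := hcb hW hI (e : V)
      have h4 : ∫⁻ ω, ‖inner ℂ (e : V) (I ω)‖ₑ ^ (2 * m) ∂P =
          eLpNorm (fun ω => ‖inner ℂ (e : V) (I ω)‖ ^ 2) m P ^ m := by
        rw [← h1]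
        refine lintegral_congr fun ω => ?_
        rw [enorm_pow, enorm_norm, pow_mul]
      rw [h4] at h3
      have h5 := ENNReal.rpow_le_rpow h3 (z := (m : ℝ)⁻¹) (by positivity)
      rw [ENNReal.mul_rpow_of_nonneg _ _ (by positivity), ENNReal.pow_rpow_inv_natCast hm,
        ENNReal.pow_rpow_inv_natCast hm] at h5
      exact h5
    rw [h1]
    have h6 : eLpNorm (S F) m P ≤ c ^ ((m : ℝ)⁻¹) * ∫⁻ ω, ‖I ω‖ₑ ^ 2 ∂P := by
      have e : S F = ∑ e ∈ F, fun ω => ‖inner ℂ (e : V) (I ω)‖ ^ 2 := by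
        funext ω
        simp [hS]
      rw [e]
      refine (eLpNorm_sum_le (fun e _ => (hmem e).1.norm.pow 2)
        (by exact_mod_cast Nat.one_le_iff_ne_zero.2 hm)).trans ?_
      refine (Finset.sum_le_sum fun e _ => h2 e).trans ?_
      rw [← Finset.mul_sum]
      gcongr
      rw [lintegral_enorm_sq_eq_tsum hI.1.1]
      exact ENNReal.sum_le_tsum F
    refine (pow_le_pow_left' h6 m).trans ?_
    rw [mul_pow, ENNReal.rpow_inv_natCast_pow hm]
  obtain ⟨F, -, hFt⟩ := exists_seq_monotone_tendsto_atTop_atTop (Finset (onSystem V))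
  have h7 : ∀ ω, Tendsto (fun n => ‖S (F n) ω‖ₑ ^ m) atTop (𝓝 (‖I ω‖ₑ ^ (2 * m))) := by
    intro ω
    have h8 : Tendsto (fun G => ‖S G ω‖ₑ) atTop (𝓝 (‖I ω‖ₑ ^ 2)) := by
      simp only [hSe]
      rw [← tsum_enorm_inner_sq]
      exact ENNReal.summable.hasSum
    rw [pow_mul]
    exact (ENNReal.Tendsto.pow h8).comp hFt
  calc ∫⁻ ω, ‖I ω‖ₑ ^ (2 * m) ∂P
      = ∫⁻ ω, liminf (fun n => ‖S (F n) ω‖ₑ ^ m) atTop ∂P :=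
        lintegral_congr fun ω => (h7 ω).liminf_eq.symm
    _ ≤ liminf (fun n => ∫⁻ ω, ‖S (F n) ω‖ₑ ^ m ∂P) atTop :=
        lintegral_liminf_le' fun n => (hSm _).enorm.pow_const m
    _ ≤ _ := liminf_le_of_le (by isBoundedDefault) fun b hb => by
        obtain ⟨n, hn⟩ := hb.exists
        exact hn.trans (hF _)

/-- On a probability space the `L^p` norm is at most the `L^{2p}` norm, which is even; the constant
becomes a square root. -/
theorem IsCircularNoise.exists_moment_bound {p : ℕ} (hp : p ≠ 0) : ∃ c : ℝ≥0∞, c ≠ ∞ ∧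
    ∀ {Ω : Type*} [MeasurableSpace Ω] {P : Measure Ω} [IsProbabilityMeasure P]
      {W : BddBorel d → Ω → V} (_ : IsCircularNoise P μ W)
      {f : Polar d → V →L[ℂ] V} {I : Ω → V} (_ : IsStochInt μ W P f I),
      ∫⁻ ω, ‖I ω‖ₑ ^ p ∂P ≤ c * eLpNorm I 2 P ^ p := by
  obtain ⟨c, hc, hcb⟩ := exists_even_moment_bound (V := V) (μ := μ) hp
  refine ⟨c ^ (2⁻¹ : ℝ), by finiteness, ?_⟩
  intro Ω _ P _ W hW f I hI
  have h1 := hcb hW hI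
  rw [lintegral_enorm_sq_eq_eLpNorm, ← eLpNorm_natCast_pow _ (by positivity)] at h1
  rw [← eLpNorm_natCast_pow _ hp]
  have h2 : eLpNorm I p P ≤ eLpNorm I ((2 * p : ℕ) : ℝ≥0∞) P := by
    refine eLpNorm_le_eLpNorm_of_exponent_le ?_ hI.1.1
    exact_mod_cast Nat.le_mul_of_pos_left p two_pos
  have h3 : (eLpNorm I p P ^ p) ^ 2 ≤ (c ^ (2⁻¹ : ℝ) * eLpNorm I 2 P ^ p) ^ 2 := by
    rw [mul_pow, ← ENNReal.rpow_natCast (c ^ (2⁻¹ : ℝ)), ← ENNReal.rpow_mul, ← pow_mul, ← pow_mul,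
      mul_comm p 2, pow_mul (eLpNorm I 2 P)]
    simp only [Nat.cast_ofNat, ne_eq, OfNat.ofNat_ne_zero, not_false_eq_true, inv_mul_cancel₀,
      ENNReal.rpow_one]
    exact (pow_le_pow_left' h2 _).trans h1
  exact (ENNReal.pow_le_pow_left_iff two_ne_zero).1 h3

end Gaussian

/-! ### Integrands built from a radial weight -/

section BaseKernel

variable {d : ℕ} {V : Type*} [NormedAddCommGroup V] [InnerProductSpace ℂ V] [CompleteSpace V]
  {μ : TraceClassMeasure V (USphere d)}

/-- The weight `u^{k+1}` for `u ≤ 1`, `u^γ` for `u > 1`. -/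
noncomputable def weight (k : ℕ) (γ : ℝ) (u : Set.Ioi (0 : ℝ)) : ℝ≥0∞ :=
  if (u : ℝ) ≤ 1 then ENNReal.ofReal ((u : ℝ) ^ (k + 1)) else ENNReal.ofReal ((u : ℝ) ^ γ)

theorem measurable_weight (k : ℕ) (γ : ℝ) : Measurable (weight k γ) :=
  Measurable.ite (measurableSet_le measurable_subtype_coe measurable_const)
    ((measurable_subtype_coe.pow_const _).ennreal_ofReal)
    ((measurable_subtype_coe.pow_const _).ennreal_ofReal)

/-- Operator valued kernels whose products with functions of size `weight k γ`, `γ < ε`, are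
square integrable. -/
structure IsBaseKernel (μ : TraceClassMeasure V (USphere d)) (k : ℕ) (ε : ℝ)
    (Φ : Polar d → V →L[ℂ] V) (w : Set.Ioi (0 : ℝ) → ℝ≥0∞) (a : USphere d → ℝ≥0∞) : Prop where
  measurable : ∀ v, StronglyMeasurable fun x => Φ x v
  measurable_radial : Measurable w
  measurable_angular : Measurable a
  enorm_le : ∀ x, ‖Φ x‖ₑ ≤ w x.1 * a x.2
  radial_lt_top : ∀ γ, γ < ε → ∫⁻ u, (weight k γ u * w u) ^ 2 ∂radial < ∞
  angular_lt_top : ∫⁻ θ, a θ ^ 2 ∂μ.traceMeasure < ∞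

variable {k : ℕ} {ε γ : ℝ} {Φ : Polar d → V →L[ℂ] V} {w : Set.Ioi (0 : ℝ) → ℝ≥0∞}
  {a : USphere d → ℝ≥0∞} {m : Polar d → ℂ} {C : ℝ≥0∞}

theorem IsBaseKernel.lintegral_le (hΦ : IsBaseKernel μ k ε Φ w a) (hC : C ≠ ∞)
    {S : Set (Set.Ioi (0 : ℝ))} (hS : MeasurableSet S)
    (hm : ∀ x, ‖m x‖ₑ ≤ C * S.indicator (weight k γ) x.1) :
    ∫⁻ x, ‖m x • Φ x‖ₑ ^ 2 ∂(controlTrace μ) ≤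
      C ^ 2 * ((∫⁻ u in S, (weight k γ u * w u) ^ 2 ∂radial) * ∫⁻ θ, a θ ^ 2 ∂μ.traceMeasure) := by
  have hmw : Measurable fun u => (weight k γ u * w u) ^ 2 :=
    ((measurable_weight k γ).mul hΦ.measurable_radial).pow_const 2
  rw [← lintegral_indicator hS, ← lintegral_prod_mul (hmw.indicator hS).aemeasurable
    (hΦ.measurable_angular.pow_const 2).aemeasurable,
    ← lintegral_const_mul' _ _ (ENNReal.pow_ne_top hC)]
  refine lintegral_mono fun x => ?_
  rw [enorm_smul, mul_pow]
  refine (mul_le_mul' (pow_le_pow_left' (hm x) 2) (pow_le_pow_left' (hΦ.enorm_le x) 2)).trans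
    (le_of_eq ?_)
  by_cases hx : x.1 ∈ S
  · simp only [Set.indicator_of_mem hx]
    ring
  · simp [Set.indicator_of_notMem hx]

theorem IsBaseKernel.isL2Kernel (hΦ : IsBaseKernel μ k ε Φ w a) (hγ : γ < ε) (hC : C ≠ ∞)
    (hmm : Measurable m) (hm : ∀ x, ‖m x‖ₑ ≤ C * weight k γ x.1) :
    IsL2Kernel μ (fun x => m x • Φ x) := by
  refine ⟨fun v => hmm.stronglyMeasurable.smul (hΦ.measurable v), ?_⟩
  refine (hΦ.lintegral_le hC MeasurableSet.univ (m := m) (γ := γ) fun x => ?_).trans_lt ?_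
  · simpa using hm x
  · rw [setLIntegral_univ]
    exact ENNReal.mul_lt_top (ENNReal.pow_lt_top hC.lt_top)
      (ENNReal.mul_lt_top (hΦ.radial_lt_top γ hγ) hΦ.angular_lt_top)

theorem lintegral_ite_rpow_lt_top {a b : ℝ} (ha : -1 < a) (hb : b < -1) :
    ∫⁻ u : Set.Ioi (0 : ℝ), ENNReal.ofReal (if (u : ℝ) ≤ 1 then (u : ℝ) ^ a else (u : ℝ) ^ b)
      ∂radial < ∞ := by
  have hm : Measurable fun u : ℝ => ENNReal.ofReal (if u ≤ 1 then u ^ a else u ^ b) :=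
    (Measurable.ite measurableSet_Iic (by fun_prop) (by fun_prop)).ennreal_ofReal
  rw [← lintegral_map (f := fun u : ℝ => ENNReal.ofReal (if u ≤ 1 then u ^ a else u ^ b)) hm
    measurable_subtype_coe, map_val_radial, ← Set.Ioc_union_Ioi_eq_Ioi zero_le_one]
  refine (lintegral_union_le _ _ _).trans_lt (ENNReal.add_lt_top.2 ⟨?_, ?_⟩)
  · have h1 : IntegrableOn (fun u : ℝ => u ^ a) (Set.Ioc 0 1) := by
      have := intervalIntegral.intervalIntegrable_rpow' (a := 0) (b := 1) ha
      rwa [intervalIntegrable_iff_integrableOn_Ioc_of_le zero_le_one] at this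
    rw [setLIntegral_congr_fun measurableSet_Ioc (g := fun u : ℝ => ENNReal.ofReal (u ^ a))
      fun u hu => by simp only [if_pos hu.2]]
    exact h1.lintegral_lt_top
  · have h1 : IntegrableOn (fun u : ℝ => u ^ b) (Set.Ioi 1) :=
      integrableOn_Ioi_rpow_of_lt hb zero_lt_one
    rw [setLIntegral_congr_fun measurableSet_Ioi (g := fun u : ℝ => ENNReal.ofReal (u ^ b))
      fun u hu => by simp only [if_neg (not_le.2 (Set.mem_Ioi.1 hu))]]
    exact h1.lintegral_lt_top

variable [SecondCountableTopology V] [MeasurableSpace V] [BorelSpace V]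

/-- `(u, θ) ↦ u^{-H-1/2} A(θ)`. -/
noncomputable def baseKernel (H : V →L[ℂ] V) (A : USphere d → V →L[ℂ] V) (x : Polar d) : V →L[ℂ] V :=
  opPow (x.1 : ℝ) (-(H + (2⁻¹ : ℂ) • ContinuousLinearMap.id ℂ V)) ∘L A x.2

/-- The weighted squares are multiples of `u^{2(k+1-b)-1}` for `u ≤ 1` and `u^{2(γ-ε)-1}` for `u >
1`. The room at zero is `b < k + 1`, from compactness of the spectrum; the room at infinity is `γ <
ε`. -/
theorem exists_isBaseKernel {H : V →L[ℂ] V}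
    (hH : ∀ z ∈ spectrum ℂ H, ε < z.re ∧ z.re < k + 1)
    {A : USphere d → V →L[ℂ] V} (hA : ∀ v, Measurable fun θ => A θ v)
    (hAint : ∫⁻ θ, ‖A θ‖ₑ ^ 2 ∂μ.traceMeasure < ∞) :
    ∃ w, IsBaseKernel μ k ε (baseKernel H A) w (fun θ => ‖A θ‖ₑ) := by
  obtain ⟨b, hb, hHb⟩ := exists_re_lt_of_spectrum (T := H) (b := (k : ℝ) + 1) fun z hz => (hH z hz).2
  obtain ⟨C₁, hC₁, h₁⟩ := exists_norm_opPow_neg_le' (T := H) hHb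
  obtain ⟨C₂, hC₂, h₂⟩ := exists_norm_opPow_neg_le (T := H) (a := ε) fun z hz => (hH z hz).1
  set C := max C₁ C₂
  have hC : 0 < C := lt_max_of_lt_left hC₁
  have hwm : Measurable fun u : Set.Ioi (0 : ℝ) => ENNReal.ofReal (C * if (u : ℝ) ≤ 1 then
      (u : ℝ) ^ (-b - 2⁻¹) else (u : ℝ) ^ (-ε - 2⁻¹)) :=
    (Measurable.const_mul (Measurable.ite (measurableSet_le measurable_subtype_coe
      measurable_const) (measurable_subtype_coe.pow_const _)
      (measurable_subtype_coe.pow_const _)) C).ennreal_ofReal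
  refine ⟨fun u => ENNReal.ofReal (C * if (u : ℝ) ≤ 1 then (u : ℝ) ^ (-b - 2⁻¹) else
    (u : ℝ) ^ (-ε - 2⁻¹)), fun v => ?_, hwm, ?_, fun x => ?_, fun γ hγ => ?_, hAint⟩
  · have hc : Continuous fun u : Set.Ioi (0 : ℝ) =>
        opPow (u : ℝ) (-(H + (2⁻¹ : ℂ) • ContinuousLinearMap.id ℂ V)) :=
      continuousOn_iff_continuous_domRestrict.1 (continuousOn_opPow _)
    have h1 : StronglyMeasurable fun x : Polar d =>
        opPow (x.1 : ℝ) (-(H + (2⁻¹ : ℂ) • ContinuousLinearMap.id ℂ V)) :=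
      hc.stronglyMeasurable.comp_measurable measurable_fst
    have h2 : StronglyMeasurable fun x : Polar d => A x.2 v :=
      (hA v).stronglyMeasurable.comp_measurable measurable_snd
    exact isBoundedBilinearMap_apply.continuous.comp_stronglyMeasurable (h1.prodMk h2)
  · exact measurable_enorm_of_apply fun v => (hA v).stronglyMeasurable
  · refine (ContinuousLinearMap.opENorm_comp_le _ _).trans (mul_le_mul' ?_ le_rfl)
    have hu : (0 : ℝ) < x.1 := x.1.2
    rw [opPow_neg_add_half hu, ← ofReal_norm]
    refine ENNReal.ofReal_le_ofReal ?_
    rw [norm_smul, Complex.norm_real, Real.norm_eq_abs, abs_of_pos (Real.rpow_pos_of_pos hu _)]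
    split_ifs with h
    · rw [sub_eq_add_neg, Real.rpow_add hu, ← mul_assoc, mul_comm]
      gcongr
      exact (h₁ _ hu h).trans (by gcongr; exact le_max_left _ _)
    · rw [sub_eq_add_neg, Real.rpow_add hu, ← mul_assoc, mul_comm]
      gcongr
      exact (h₂ _ (not_le.1 h).le).trans (by gcongr; exact le_max_right _ _)
  · have e : ∀ u : Set.Ioi (0 : ℝ), (weight k γ u * ENNReal.ofReal (C * if (u : ℝ) ≤ 1 then
        (u : ℝ) ^ (-b - 2⁻¹) else (u : ℝ) ^ (-ε - 2⁻¹))) ^ 2 = ENNReal.ofReal (C ^ 2) *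
        ENNReal.ofReal (if (u : ℝ) ≤ 1 then (u : ℝ) ^ (2 * (k + 1 - b) - 1) else
          (u : ℝ) ^ (2 * (γ - ε) - 1)) := by
      intro u
      have hu : (0 : ℝ) < u := u.2
      have hsq : ∀ p q r : ℝ, p + (q - 2⁻¹) = r → ((u : ℝ) ^ p * (C * (u : ℝ) ^ (q - 2⁻¹))) ^ 2 =
          C ^ 2 * (u : ℝ) ^ (2 * r) := by
        intro p q r hr
        rw [mul_left_comm, ← Real.rpow_add hu, hr, mul_pow, ← Real.rpow_natCast (_ ^ r),
          ← Real.rpow_mul hu.le]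
        congr 2
        push_cast
        ring
      rw [weight]
      split_ifs with h
      · rw [← ENNReal.ofReal_mul (by positivity), ← ENNReal.ofReal_pow (by positivity),
          ← ENNReal.ofReal_mul (by positivity)]
        congr 1
        rw [← Real.rpow_natCast (u : ℝ) (k + 1), hsq _ _ (k + 1 - b - 2⁻¹) (by push_cast; ring)]
        congr 2
        ring
      · rw [← ENNReal.ofReal_mul (by positivity), ← ENNReal.ofReal_pow (by positivity),
          ← ENNReal.ofReal_mul (by positivity)]
        congr 1
        rw [hsq _ _ (γ - ε - 2⁻¹) (by ring)]
        congr 2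
        ring
    simp only [e]
    rw [lintegral_const_mul' _ _ ENNReal.ofReal_ne_top]
    exact ENNReal.mul_lt_top ENNReal.ofReal_lt_top
      (lintegral_ite_rpow_lt_top (by linarith) (by linarith))

end BaseKernel

/-! ### Scalar multipliers -/

section Multipliers

variable {d : ℕ}

/-- `(u, θ) ↦ e^{i u ⟨s, θ⟩}`. -/
noncomputable def phase (s : Eucl d) (x : Polar d) : ℂ :=
  Complex.exp (Complex.I * ((x.1 : ℝ) * inner ℝ s (x.2 : Eucl d) : ℝ))

theorem measurable_phase (s : Eucl d) : Measurable (phase s) := by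
  unfold phase
  fun_prop

theorem norm_phase (s : Eucl d) (x : Polar d) : ‖phase s x‖ = 1 := by
  rw [phase, mul_comm, Complex.norm_exp_ofReal_mul_I]

theorem phase_add (s t : Eucl d) (x : Polar d) : phase (s + t) x = phase s x * phase t x := by
  rw [phase, phase, phase, ← Complex.exp_add, inner_add_left]
  congr 1
  push_cast
  ring

theorem phase_zero (x : Polar d) : phase 0 x = 1 := by simp [phase]

theorem phase_smul (r : ℝ) (hr : 0 < r) (s : Eucl d) (x : Polar d) :
    phase (r • s) x = phase s (dilate r hr x) := by
  simp only [phase, dilate, inner_smul_left]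
  congr 1
  simp
  ring

theorem abs_inner_sphere_le (s : Eucl d) (θ : USphere d) : |inner ℝ s (θ : Eucl d)| ≤ ‖s‖ := by
  have := abs_real_inner_le_norm s (θ : Eucl d)
  rwa [norm_eq_of_mem_sphere, mul_one] at this

/-- From `|e^{iy} - 1| ≤ min(|y|, 2)`, interpolated to the exponent `γ`. -/
theorem norm_phase_sub_le (s t : Eucl d) (x : Polar d) {γ : ℝ} (h0 : 0 ≤ γ) (h1 : γ ≤ 1) :
    ‖phase s x - phase t x‖ ≤ 2 * ((x.1 : ℝ) * ‖s - t‖) ^ γ := by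
  have hx : (0 : ℝ) < x.1 := x.1.2
  have e : phase s x - phase t x = phase t x * (phase (s - t) x - 1) := by
    rw [mul_sub, ← phase_add, add_sub_cancel, mul_one]
  set y := (x.1 : ℝ) * ‖s - t‖ with hy
  have hy0 : 0 ≤ y := by positivity
  rw [e, norm_mul, norm_phase, one_mul]
  rcases le_or_gt y 1 with hy1 | hy1
  · have h2 : ‖phase (s - t) x - 1‖ ≤ y := by
      refine (Real.norm_exp_I_mul_ofReal_sub_one_le).trans ?_
      rw [Real.norm_eq_abs, abs_mul, abs_of_pos hx]
      exact mul_le_mul_of_nonneg_left (abs_inner_sphere_le _ _) hx.le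
    rcases hy0.eq_or_lt with h | h
    · rw [← h] at h2
      refine h2.trans (by positivity)
    · have h3 : y ^ (1 : ℝ) ≤ y ^ γ := Real.rpow_le_rpow_of_exponent_ge h hy1 h1
      rw [Real.rpow_one] at h3
      have : 0 ≤ y ^ γ := by positivity
      linarith
  · have h2 : ‖phase (s - t) x - 1‖ ≤ 2 := by
      refine (norm_sub_le _ _).trans ?_
      rw [norm_phase, norm_one]
      norm_num
    have h3 : 1 ≤ y ^ γ := Real.one_le_rpow hy1.le h0
    linarith

/-- The Taylor remainder of the exponential function. -/
theorem norm_exp_remainder_sub_le (k : ℕ) {R : ℝ} {z w : ℂ} (hz : ‖z‖ ≤ R) (hw : ‖w‖ ≤ R) :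
    ‖(Complex.exp z - ∑ j ∈ Finset.range (k + 1), z ^ j / (j.factorial : ℂ)) -
      (Complex.exp w - ∑ j ∈ Finset.range (k + 1), w ^ j / (j.factorial : ℂ))‖ ≤
      R ^ k * Real.exp R * ‖z - w‖ := by
  have hR : 0 ≤ R := (norm_nonneg _).trans hz
  -- The derivative of the remainder is the remainder of one order less, of size `‖z‖^k e^{‖z‖}`;
  -- the mean value inequality on the convex ball then applies.
  have hd : ∀ z ∈ Metric.closedBall (0 : ℂ) R, HasDerivWithinAt
      (fun z => Complex.exp z - ∑ j ∈ Finset.range (k + 1), z ^ j / (j.factorial : ℂ))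
      (Complex.exp z - ∑ j ∈ Finset.range k, z ^ j / (j.factorial : ℂ))
      (Metric.closedBall (0 : ℂ) R) z := by
    intro z _
    refine HasDerivAt.hasDerivWithinAt ((Complex.hasDerivAt_exp z).sub ?_)
    have h1 : HasDerivAt (fun z : ℂ => ∑ j ∈ Finset.range (k + 1), z ^ j / (j.factorial : ℂ))
        (∑ j ∈ Finset.range (k + 1), ((j : ℂ) * z ^ (j - 1)) / (j.factorial : ℂ)) z :=
      HasDerivAt.fun_sum fun j _ => (hasDerivAt_pow j z).div_const _
    convert! h1 using 1
    rw [Finset.sum_range_succ']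
    simp only [Nat.cast_zero, zero_mul, zero_div, add_zero]
    refine Finset.sum_congr rfl fun j _ => ?_
    have hj : ((j.factorial : ℕ) : ℂ) ≠ 0 := by exact_mod_cast j.factorial_ne_zero
    have hj' : ((j : ℂ) + 1) ≠ 0 := by exact_mod_cast j.succ_ne_zero
    rw [Nat.factorial_succ]
    push_cast
    rw [mul_div_mul_left _ _ hj']
  refine (convex_closedBall (0 : ℂ) R).norm_image_sub_le_of_norm_hasDerivWithin_le hd
    (fun x hx => ?_) (mem_closedBall_zero_iff.2 hw) (mem_closedBall_zero_iff.2 hz)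
  have hx' := mem_closedBall_zero_iff.1 hx
  refine (Complex.norm_exp_sub_sum_le_norm_mul_exp x k).trans ?_
  gcongr

/-- The phase `e^{iu⟨t,θ⟩}`, compensated by its Taylor polynomial of degree `k` for `u ≤ 1` and by
`1` for `u > 1`. -/
noncomputable def compPhase (k : ℕ) (t : Eucl d) (x : Polar d) : ℂ :=
  phase t x - if (x.1 : ℝ) ≤ 1 then ∑ j ∈ Finset.range (k + 1),
    (Complex.I * ((x.1 : ℝ) * inner ℝ t (x.2 : Eucl d) : ℝ)) ^ j / (j.factorial : ℂ) else 1

theorem measurable_compPhase (k : ℕ) (t : Eucl d) : Measurable (compPhase k t) := by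
  refine (measurable_phase t).sub (Measurable.ite
    (measurableSet_le (measurable_subtype_coe.comp measurable_fst) measurable_const) ?_
    measurable_const)
  fun_prop

theorem compPhase_zero (k : ℕ) (x : Polar d) : compPhase k 0 x = 0 := by
  rw [compPhase, phase_zero, Finset.sum_range_succ']
  simp

/-- For `u ≤ 1` the remainder bound with radius `u M` produces `u^k · u = u^{k+1}`, and `1 + 2M`
dominates `‖s - t‖^{1-γ}`. For `u > 1` the constants cancel and the bound for phases remains. The
constant is independent of `γ`. -/
theorem norm_compPhase_sub_le (k : ℕ) {M : ℝ} {s t : Eucl d} (hs : ‖s‖ ≤ M) (ht : ‖t‖ ≤ M)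
    (x : Polar d) {γ : ℝ} (h0 : 0 ≤ γ) (h1 : γ ≤ 1) :
    ‖compPhase k s x - compPhase k t x‖ₑ ≤
      ENNReal.ofReal ((2 + M ^ k * Real.exp M * (1 + 2 * M)) * ‖s - t‖ ^ γ) * weight k γ x.1 := by
  have hx : (0 : ℝ) < x.1 := x.1.2
  have hM : 0 ≤ M := (norm_nonneg _).trans hs
  rw [weight, ← ofReal_norm]
  split_ifs with h
  · rw [← ENNReal.ofReal_mul (by positivity)]
    refine ENNReal.ofReal_le_ofReal ?_
    simp only [compPhase, if_pos h, phase]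
    have hb : ∀ s : Eucl d, ‖s‖ ≤ M →
        ‖Complex.I * (((x.1 : ℝ) * inner ℝ s (x.2 : Eucl d) : ℝ) : ℂ)‖ ≤ x.1 * M := by
      intro s hs
      rw [norm_mul, Complex.norm_I, one_mul, Complex.norm_real, Real.norm_eq_abs, abs_mul,
        abs_of_pos hx]
      gcongr
      exact (abs_inner_sphere_le _ _).trans hs
    refine (norm_exp_remainder_sub_le k (hb s hs) (hb t ht)).trans ?_
    have h2 : ‖Complex.I * (((x.1 : ℝ) * inner ℝ s (x.2 : Eucl d) : ℝ) : ℂ) -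
        Complex.I * (((x.1 : ℝ) * inner ℝ t (x.2 : Eucl d) : ℝ) : ℂ)‖ ≤ x.1 * ‖s - t‖ := by
      rw [← mul_sub, norm_mul, Complex.norm_I, one_mul, ← Complex.ofReal_sub, Complex.norm_real,
        Real.norm_eq_abs, ← mul_sub, ← inner_sub_left, abs_mul, abs_of_pos hx]
      gcongr
      exact abs_inner_sphere_le _ _
    have h3 : ‖s - t‖ ≤ (1 + 2 * M) * ‖s - t‖ ^ γ := by
      have h4 : ‖s - t‖ ≤ 2 * M := (norm_sub_le _ _).trans (by linarith)
      rcases (norm_nonneg (s - t)).eq_or_lt with h5 | h5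
      · rw [← h5]; positivity
      have e : ‖s - t‖ = ‖s - t‖ ^ (1 - γ) * ‖s - t‖ ^ γ := by
        rw [← Real.rpow_add h5, sub_add_cancel, Real.rpow_one]
      conv_lhs => rw [e]
      gcongr
      rcases le_or_gt ‖s - t‖ 1 with h6 | h6
      · exact (Real.rpow_le_one h5.le h6 (by linarith)).trans (by linarith)
      · refine (Real.rpow_le_rpow_of_exponent_le h6.le (by linarith : 1 - γ ≤ 1)).trans ?_
        rw [Real.rpow_one]
        linarith
    calc (x.1 * M) ^ k * Real.exp (x.1 * M) * _
        ≤ (x.1 * M) ^ k * Real.exp M * (x.1 * ‖s - t‖) := by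
          gcongr
          exact mul_le_of_le_one_left hM h
      _ = M ^ k * Real.exp M * ‖s - t‖ * (x.1 : ℝ) ^ (k + 1) := by ring
      _ ≤ M ^ k * Real.exp M * ((1 + 2 * M) * ‖s - t‖ ^ γ) * (x.1 : ℝ) ^ (k + 1) := by gcongr
      _ ≤ _ := by
          have h7 : 0 ≤ ‖s - t‖ ^ γ * (x.1 : ℝ) ^ (k + 1) := by positivity
          linarith
  · rw [← ENNReal.ofReal_mul (by positivity)]
    refine ENNReal.ofReal_le_ofReal ?_
    simp only [compPhase, if_neg h, sub_sub_sub_cancel_right]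
    refine (norm_phase_sub_le s t x h0 h1).trans ?_
    rw [Real.mul_rpow hx.le (norm_nonneg _)]
    have h2 : 0 ≤ M ^ k * Real.exp M * (1 + 2 * M) := by positivity
    have h3 : 0 ≤ (x.1 : ℝ) ^ γ * ‖s - t‖ ^ γ := by positivity
    nlinarith

/-- The low frequency cutoff `(1 ∧ u/r)^{k+1}`. -/
noncomputable def cutoff (k : ℕ) (r : ℝ) (x : Polar d) : ℂ :=
  ((min 1 ((x.1 : ℝ) / r) : ℝ) : ℂ) ^ (k + 1)

theorem measurable_cutoff (k : ℕ) (r : ℝ) : Measurable (cutoff (d := d) k r) := by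
  unfold cutoff
  fun_prop

theorem norm_cutoff_le (k : ℕ) {r : ℝ} (hr : 0 < r) (x : Polar d) : ‖cutoff k r x‖ ≤ 1 := by
  have hx : (0 : ℝ) < x.1 := x.1.2
  have h0 : 0 ≤ min 1 ((x.1 : ℝ) / r) := le_min zero_le_one (by positivity)
  rw [cutoff, norm_pow, Complex.norm_real, Real.norm_eq_abs, abs_of_nonneg h0]
  exact pow_le_one₀ h0 (min_le_left _ _)

theorem cutoff_of_le (k : ℕ) {r : ℝ} (hr : 0 < r) {x : Polar d} (h : r ≤ x.1) :
    cutoff k r x = 1 := by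
  rw [cutoff, min_eq_left ((one_le_div hr).2 h)]
  simp

theorem enorm_cutoff_one_le (k : ℕ) (x : Polar d) {γ : ℝ} (hγ : 0 ≤ γ) :
    ‖cutoff k 1 x‖ₑ ≤ weight k γ x.1 := by
  have hx : (0 : ℝ) < x.1 := x.1.2
  have h0 : 0 ≤ min 1 (x.1 : ℝ) := le_min zero_le_one hx.le
  rw [weight, ← ofReal_norm, cutoff, div_one, norm_pow, Complex.norm_real,
    Real.norm_eq_abs, abs_of_nonneg h0]
  split_ifs with h
  · rw [min_eq_right h]
  · rw [min_eq_left (not_le.1 h).le, one_pow]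
    exact ENNReal.ofReal_le_ofReal (Real.one_le_rpow (not_le.1 h).le hγ)

theorem enorm_cutoff_mul_phase_sub_le (k : ℕ) (s t : Eucl d) (x : Polar d) {γ : ℝ} (h0 : 0 ≤ γ)
    (h1 : γ ≤ 1) : ‖phase s x * cutoff k 1 x - phase t x * cutoff k 1 x‖ₑ ≤
      ENNReal.ofReal (2 * ‖s - t‖ ^ γ) * weight k γ x.1 := by
  have hx : (0 : ℝ) < x.1 := x.1.2
  have hm : 0 ≤ min 1 (x.1 : ℝ) := le_min zero_le_one hx.le
  have h := norm_phase_sub_le s t x h0 h1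
  rw [Real.mul_rpow hx.le (norm_nonneg _)] at h
  rw [weight, ← ofReal_norm, ← sub_mul, norm_mul, cutoff, div_one, norm_pow,
    Complex.norm_real, Real.norm_eq_abs, abs_of_nonneg hm]
  split_ifs with h'
  · rw [min_eq_right h', ← ENNReal.ofReal_mul (by positivity)]
    refine ENNReal.ofReal_le_ofReal ?_
    gcongr
    refine h.trans ?_
    have : (x.1 : ℝ) ^ γ ≤ 1 := Real.rpow_le_one hx.le h' h0
    gcongr
    exact mul_le_of_le_one_left (by positivity) this
  · rw [min_eq_left (not_le.1 h').le, one_pow, mul_one, ← ENNReal.ofReal_mul (by positivity)]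
    refine ENNReal.ofReal_le_ofReal (h.trans (le_of_eq ?_))
    ring

end Multipliers

/-! ### Random continuous functions -/

section RandomFunctions

variable {d : ℕ} {V : Type*} [NormedAddCommGroup V]

instance : MeasurableSpace C(Eucl d, V) := borel _

instance : BorelSpace C(Eucl d, V) := ⟨rfl⟩

/-- By compactness the distance from `g(K)` to the complement of `U` is positive if `g` maps `K`
into `U`; continuity allows it to be tested on a dense subset. -/
theorem mapsTo_iff_infEDist {g : Eucl d → V} (hg : Continuous g) {K D : Set (Eucl d)}
    (hK : IsCompact K) (hDK : D ⊆ K) (hD : K ⊆ closure D) {U : Set V} (hU : IsOpen U) :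
    Set.MapsTo g K U ↔ ∃ n : ℕ, ∀ s ∈ D, ((n : ℝ≥0∞))⁻¹ ≤ Metric.infEDist (g s) Uᶜ := by
  have hc : Continuous fun s => Metric.infEDist (g s) Uᶜ := Metric.continuous_infEDist.comp hg
  constructor
  · intro h
    rcases K.eq_empty_or_nonempty with rfl | hne
    · exact ⟨0, fun s hs => (hDK hs).elim⟩
    obtain ⟨t, ht, hmin⟩ := hK.exists_isMinOn hne hc.continuousOn
    have hpos : 0 < Metric.infEDist (g t) Uᶜ := by
      rw [Metric.infEDist_pos_iff_notMem_closure, hU.isClosed_compl.closure_eq]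
      exact fun h' => h' (h ht)
    obtain ⟨n, hn⟩ := ENNReal.exists_inv_nat_lt hpos.ne'
    exact ⟨n, fun s hs => hn.le.trans (hmin (hDK hs))⟩
  · rintro ⟨n, hn⟩ s hs
    have hcl : IsClosed {s | ((n : ℝ≥0∞))⁻¹ ≤ Metric.infEDist (g s) Uᶜ} :=
      isClosed_le continuous_const hc
    have h1 : ((n : ℝ≥0∞))⁻¹ ≤ Metric.infEDist (g s) Uᶜ :=
      hcl.closure_subset_iff.2 hn (hD hs)
    by_contra hsU
    rw [Metric.infEDist_zero_of_mem (Set.mem_compl hsU)] at h1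
    simp at h1

variable [SecondCountableTopology V] [MeasurableSpace V] [BorelSpace V] {Ω : Type*}
  [MeasurableSpace Ω] {P : Measure Ω}

/-- The subbasic sets of the compact-open topology depend on countably many values. Random
continuous functions and their laws are therefore controlled by evaluations and finite dimensional
distributions. -/
theorem borel_continuousMap : borel C(Eucl d, V) =
    MeasurableSpace.comap (fun g s => g s) MeasurableSpace.pi := by
  refine le_antisymm ?_ ?_
  · rw [borel_eq_generateFrom_of_subbasis ContinuousMap.compactOpen_eq]
    refine MeasurableSpace.generateFrom_le ?_
    rintro _ ⟨K, hK, U, hU, rfl⟩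
    obtain ⟨D, hDK, hDc, hD⟩ :=
      (TopologicalSpace.IsSeparable.of_separableSpace K).exists_countable_dense_subset
    have e : {f : C(Eucl d, V) | Set.MapsTo f K U} = (fun (g : C(Eucl d, V)) s => g s) ⁻¹'
        ⋃ n : ℕ, ⋂ s ∈ D, {x | ((n : ℝ≥0∞))⁻¹ ≤ Metric.infEDist (x s) Uᶜ} := by
      ext g
      simp only [Set.mem_ofPred_eq, Set.mem_preimage, Set.mem_iUnion, Set.mem_iInter]
      exact mapsTo_iff_infEDist g.continuous hK hDK hD hU
    beta_reduce
    rw [e]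
    refine MeasurableSpace.measurableSet_comap.2 ⟨_, ?_, rfl⟩
    refine MeasurableSet.iUnion fun n => MeasurableSet.biInter hDc fun s _ => ?_
    exact measurableSet_le measurable_const
      (Metric.continuous_infEDist.measurable.comp (measurable_pi_apply s))
  · have h : Measurable fun (g : C(Eucl d, V)) s => g s :=
      measurable_pi_lambda _ fun s => (continuous_eval_const s).measurable
    exact h.comap_le

theorem measurable_continuousMap {F : Ω → C(Eucl d, V)} (hF : ∀ s, Measurable fun ω => F ω s) :
    Measurable F := by
  have h := measurable_pi_lambda (fun ω s => F ω s) hF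
  intro B hB
  change MeasurableSet[borel _] B at hB
  rw [borel_continuousMap] at hB
  obtain ⟨B', hB', rfl⟩ := MeasurableSpace.measurableSet_comap.1 hB
  exact h hB'

theorem map_continuousMap_eq [IsFiniteMeasure P] {F G : Ω → C(Eucl d, V)} (hF : Measurable F)
    (hG : Measurable G)
    (h : ∀ I : Finset (Eucl d), IdentDistrib (fun ω (i : I) => F ω i) (fun ω (i : I) => G ω i) P P) :
    P.map F = P.map G := by
  have hm : ∀ s, Measurable fun g : C(Eucl d, V) => g s := fun s =>
    (continuous_eval_const s).measurable
  have hF' : Measurable fun ω s => F ω s := measurable_pi_lambda _ fun s => (hm s).comp hF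
  have hG' : Measurable fun ω s => G ω s := measurable_pi_lambda _ fun s => (hm s).comp hG
  have h1 := (map_eq_iff_forall_finset_map_restrict_eq (P := P) (X := fun s ω => F ω s)
    (Y := fun s ω => G ω s) hF'.aemeasurable hG'.aemeasurable).2 fun I => (h I).map_eq
  ext B hB
  rw [Measure.map_apply hF hB, Measure.map_apply hG hB]
  change MeasurableSet[borel _] B at hB
  rw [borel_continuousMap] at hB
  obtain ⟨B', hB', rfl⟩ := MeasurableSpace.measurableSet_comap.1 hB
  have h2 := congrArg (fun m : Measure (Eucl d → V) => m B') h1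
  beta_reduce at h2
  rw [Measure.map_apply hF' hB', Measure.map_apply hG' hB'] at h2
  exact h2

end RandomFunctions

/-! ### Normalization of representations -/

section Normalization

variable (k d : ℕ)

/-- The points of the grid `{0, …, k}^d`. -/
noncomputable def gridPoint (j : Fin d → Fin (k + 1)) : Eucl d :=
  WithLp.toLp 2 fun i => ((j i : ℕ) : ℝ)

/-- The degree in each variable is at most `k`, and the grid has `k + 1` values in each coordinate.
-/
theorem eq_zero_of_polyEval_gridPoint {p : MvPolynomial (Fin d) ℂ} (hp : p.totalDegree ≤ k)
    (h : ∀ j, polyEval p (gridPoint k d j) = 0) : p = 0 := by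
  classical
  refine MvPolynomial.eq_zero_of_eval_zero_at_prod_finset p
    (fun _ => (Finset.range (k + 1)).image fun n : ℕ => (n : ℂ)) (fun i => ?_) fun x hx => ?_
  · rw [Finset.card_image_of_injective _ Nat.cast_injective, Finset.card_range]
    exact Nat.lt_succ_of_le ((MvPolynomial.degreeOf_le_totalDegree p i).trans hp)
  · have hx' : ∀ i, ∃ n : Fin (k + 1), ((n : ℕ) : ℂ) = x i := fun i => by
      obtain ⟨n, hn, e⟩ := Finset.mem_image.1 (hx i)
      exact ⟨⟨n, Finset.mem_range.1 hn⟩, e⟩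
    choose n hn using hx'
    have := h n
    rw [polyEval] at this
    have e : (fun i => ((gridPoint k d n i : ℝ) : ℂ)) = x := by
      funext i
      rw [← hn i]
      simp [gridPoint]
    rwa [e] at this

/-- Polynomials of degree at most `k` are determined by their values at finitely many points. -/
theorem exists_interpolation : ∃ c : (Fin d → Fin (k + 1)) → MvPolynomial (Fin d) ℂ,
    (∀ j, (c j).totalDegree ≤ k) ∧ ∀ p : MvPolynomial (Fin d) ℂ, p.totalDegree ≤ k → ∀ t,
      polyEval p t = ∑ j, polyEval p (gridPoint k d j) * polyEval (c j) t := by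
  classical
  set R := MvPolynomial.restrictTotalDegree (Fin d) ℂ k
  let ev : R →ₗ[ℂ] ((Fin d → Fin (k + 1)) → ℂ) :=
    LinearMap.pi fun j => (MvPolynomial.aeval fun i =>
      ((gridPoint k d j i : ℝ) : ℂ)).toLinearMap ∘ₗ R.subtype
  have hev : ∀ (p : R) j, ev p j = polyEval (p : MvPolynomial (Fin d) ℂ) (gridPoint k d j) :=
    fun p j => rfl
  have hinj : LinearMap.ker ev = ⊥ := by
    refine LinearMap.ker_eq_bot'.2 fun p hp => Subtype.ext ?_
    refine eq_zero_of_polyEval_gridPoint k d ((MvPolynomial.mem_restrictTotalDegree _ _ _).1 p.2)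
      fun j => ?_
    rw [← hev, hp]
    rfl
  -- A left inverse of evaluation on the grid reconstructs a polynomial from its values; its images
  -- of the unit vectors are the interpolation polynomials.
  obtain ⟨B, hB⟩ := ev.exists_leftInverse_of_injective hinj
  refine ⟨fun j => B (Pi.single j 1), fun j =>
    (MvPolynomial.mem_restrictTotalDegree _ _ _).1 (B (Pi.single j 1)).2, fun p hp t => ?_⟩
  have h1 := LinearMap.congr_fun hB ⟨p, (MvPolynomial.mem_restrictTotalDegree _ _ _).2 hp⟩
  have h2 : ev ⟨p, (MvPolynomial.mem_restrictTotalDegree _ _ _).2 hp⟩ =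
      ∑ j, polyEval p (gridPoint k d j) • (Pi.single j 1 : (Fin d → Fin (k + 1)) → ℂ) := by
    funext i
    rw [hev]
    simp [Finset.sum_apply, Pi.single_apply]
  rw [LinearMap.comp_apply, h2, map_sum] at h1
  have h3 := congrArg (fun q : R => polyEval (q : MvPolynomial (Fin d) ℂ) t) h1
  simp only [LinearMap.id_apply] at h3
  rw [← h3]
  simp [polyEval]

/-- The polynomials of an interpolation formula. -/
noncomputable def interpPoly : (Fin d → Fin (k + 1)) → MvPolynomial (Fin d) ℂ :=
  (exists_interpolation k d).choose

/-- The measure `δ_t - ∑ c_j(t) δ_{t_j}`. -/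
noncomputable def normalizedDirac (t : Eucl d) : Lam k d :=
  ⟨Finsupp.single t 1 - ∑ j, Finsupp.single (gridPoint k d j) (polyEval (interpPoly k d j) t),
    fun p hp => by
      have h := (exists_interpolation k d).choose_spec.2 p hp t
      rw [map_sub, map_sum, integ, Finsupp.linearCombination_single, one_smul, h, sub_eq_zero]
      refine Finset.sum_congr rfl fun j _ => ?_
      rw [Finsupp.linearCombination_single, smul_eq_mul, mul_comm]
      rfl⟩

variable {k d} {V : Type*} [NormedAddCommGroup V] [NormedSpace ℂ V]

theorem continuous_polyEval (p : MvPolynomial (Fin d) ℂ) : Continuous (polyEval p) :=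
  (MvPolynomial.continuous_eval p).comp (by fun_prop)

theorem integ_normalizedDirac (g : Eucl d → V) (t : Eucl d) :
    integ g (normalizedDirac k d t : FinMeas d) =
      g t - ∑ j, polyEval (interpPoly k d j) t • g (gridPoint k d j) := by
  simp [normalizedDirac, integ]

/-- The representation that is normalized to vanish at the interpolation points. -/
noncomputable def normalize (k : ℕ) (g : C(Eucl d, V)) : C(Eucl d, V) :=
  ⟨fun t => integ g (normalizedDirac k d t : FinMeas d), by
    simp only [integ_normalizedDirac]
    exact g.continuous.sub (continuous_finsetSum _ fun j _ =>
      (continuous_polyEval _).smul continuous_const)⟩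

theorem normalize_apply (g : C(Eucl d, V)) (t : Eucl d) :
    normalize k g t = integ g (normalizedDirac k d t : FinMeas d) := rfl

theorem integ_apply {E : Type*} [AddCommGroup E] [Module ℂ E] (g : Eucl d → E) (l : FinMeas d) :
    integ g l = ∑ t ∈ l.support, l t • g t := by
  rw [integ, Finsupp.linearCombination_apply, Finsupp.sum]

/-- The normalization subtracts a combination of polynomials of degree at most `k`, which elements
of `Λ_k` annihilate. -/
theorem ofRep_normalize (g : C(Eucl d, V)) :
    (ofRep (normalize k g) : PathSpace k d V) = ofRep g := by
  refine Subtype.ext (LinearMap.ext fun l => ?_)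
  change integ (⇑(normalize k g)) (l : FinMeas d) = integ (⇑g) (l : FinMeas d)
  have h0 : ∀ j, integ (polyEval (interpPoly k d j)) (l : FinMeas d) = 0 := fun j =>
    l.2 _ ((exists_interpolation k d).choose_spec.1 j)
  simp only [integ_apply, normalize_apply, smul_eq_mul] at h0 ⊢
  simp only [← integ_apply, integ_normalizedDirac, smul_sub, Finset.sum_sub_distrib,
    Finset.smul_sum]
  rw [Finset.sum_comm]
  simp only [smul_smul, ← Finset.sum_smul, h0]
  simp

theorem continuous_ofRep : Continuous (ofRep : C(Eucl d, V) → PathSpace k d V) :=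
  continuous_coinduced_rng

theorem measurable_ofRep : Measurable (ofRep : C(Eucl d, V) → PathSpace k d V) :=
  continuous_ofRep.measurable

theorem measurable_normalize [SecondCountableTopology V] [MeasurableSpace V] [BorelSpace V] :
    Measurable (normalize k : C(Eucl d, V) → C(Eucl d, V)) := by
  have hm : ∀ s, Measurable fun g : C(Eucl d, V) => g s := fun s =>
    (continuous_eval_const s).measurable
  refine measurable_continuousMap fun t => ?_
  simp only [normalize_apply, integ_apply]
  exact Finset.measurable_fun_sum _ fun s _ => (hm s).const_smul _

/-- Random elements of the path space with the same finite dimensional distributions have the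
same law. -/
theorem map_ofRep_eq [SecondCountableTopology V] [MeasurableSpace V] [BorelSpace V] {Ω : Type*}
    [MeasurableSpace Ω] {P : Measure Ω} [IsFiniteMeasure P] {F G : Ω → C(Eucl d, V)}
    (hF : Measurable F) (hG : Measurable G)
    (h : ∀ (n : ℕ) (l : Fin n → Lam k d), IdentDistrib
      (fun ω i => integ (F ω) (l i : FinMeas d)) (fun ω i => integ (G ω) (l i : FinMeas d)) P P) :
    P.map (fun ω => (ofRep (F ω) : PathSpace k d V)) = P.map (fun ω => ofRep (G ω)) := by
  -- Values of the normalized representation are values at `normalizedDirac`, an element of `Λ_k`,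
  -- so they are determined by the assumed distributions, although values of `F` itself are not.
  have h1 : P.map (fun ω => normalize k (F ω)) = P.map (fun ω => normalize k (G ω)) := by
    refine map_continuousMap_eq (measurable_normalize.comp hF) (measurable_normalize.comp hG)
      fun I => ?_
    have h2 := h I.card fun i => normalizedDirac k d (I.equivFin.symm i)
    have hm : Measurable fun (x : Fin I.card → V) (i : I) => x (I.equivFin i) :=
      measurable_pi_lambda _ fun i => measurable_pi_apply _
    have h3 := h2.comp hm
    convert! h3 using 1 <;>
    · funext ω i
      simp [normalize_apply]
  have h2 : ∀ {F : Ω → C(Eucl d, V)}, Measurable F →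
      P.map (fun ω => (ofRep (F ω) : PathSpace k d V)) =
        (P.map fun ω => normalize k (F ω)).map ofRep := fun hF => by
    have e := Measure.map_map (μ := P) (measurable_ofRep (k := k))
      (measurable_normalize (k := k).comp hF)
    simp only [Function.comp_def, ofRep_normalize] at e
    exact e.symm
  rw [h2 hF, h2 hG, h1]

end Normalization

/-! ### Random fields given by stochastic integrals -/

section Fields

variable {d : ℕ} {V : Type*} [NormedAddCommGroup V] [InnerProductSpace ℂ V] [CompleteSpace V]
  {Ω : Type*} [MeasurableSpace Ω] {P : Measure Ω} {μ : TraceClassMeasure V (USphere d)}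
  {W : BddBorel d → Ω → V} {k : ℕ} {ε γ : ℝ} {Φ : Polar d → V →L[ℂ] V}
  {w : Set.Ioi (0 : ℝ) → ℝ≥0∞} {a : USphere d → ℝ≥0∞}

/-- The norm of `weight k γ * w` in `L²(S, du)`. -/
noncomputable def radialNorm (k : ℕ) (γ : ℝ) (w : Set.Ioi (0 : ℝ) → ℝ≥0∞)
    (S : Set (Set.Ioi (0 : ℝ))) : ℝ≥0∞ :=
  (∫⁻ u in S, (weight k γ u * w u) ^ 2 ∂radial) ^ (2⁻¹ : ℝ)

theorem rpow_half_sq (x : ℝ≥0∞) : (x ^ (2⁻¹ : ℝ)) ^ 2 = x := by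
  rw [← ENNReal.rpow_natCast, ← ENNReal.rpow_mul]
  simp

theorem IsBaseKernel.radialNorm_ne_top (hΦ : IsBaseKernel μ k ε Φ w a) (hγ : γ < ε)
    (S : Set (Set.Ioi (0 : ℝ))) : radialNorm k γ w S ≠ ∞ :=
  ENNReal.rpow_ne_top_of_nonneg (by positivity)
    ((setLIntegral_le_lintegral _ _).trans_lt (hΦ.radial_lt_top γ hγ)).ne

/-- Dominated convergence, as the sets `{u < r}` shrink to the empty set. This is the source of
smallness in the tangent limit. -/
theorem IsBaseKernel.tendsto_radialNorm (hΦ : IsBaseKernel μ k ε Φ w a) (hγ : γ < ε) :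
    Tendsto (fun r : ℝ => radialNorm k γ w {u | (u : ℝ) < r}) (𝓝[>] 0) (𝓝 0) := by
  have h1 : Tendsto (fun r : ℝ => ∫⁻ u in {u : Set.Ioi (0 : ℝ) | (u : ℝ) < r},
      (weight k γ u * w u) ^ 2 ∂radial) (𝓝[>] 0) (𝓝 0) := by
    have hm : Measurable fun u => (weight k γ u * w u) ^ 2 :=
      ((measurable_weight k γ).mul hΦ.measurable_radial).pow_const 2
    have hS : ∀ r : ℝ, MeasurableSet {u : Set.Ioi (0 : ℝ) | (u : ℝ) < r} := fun r =>
      measurableSet_lt measurable_subtype_coe measurable_const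
    simp_rw [← lintegral_indicator (hS _)]
    rw [← lintegral_zero (μ := radial)]
    refine tendsto_lintegral_filter_of_dominated_convergence
      (fun u => (weight k γ u * w u) ^ 2) (Eventually.of_forall fun r => hm.indicator (hS r))
      (Eventually.of_forall fun r => Eventually.of_forall fun u => Set.indicator_le_self _ _ _)
      (hΦ.radial_lt_top γ hγ).ne (Eventually.of_forall fun u => ?_)
    have hu : Set.Iio (u : ℝ) ∈ 𝓝[>] (0 : ℝ) := nhdsWithin_le_nhds (Iio_mem_nhds u.2)
    refine tendsto_const_nhds.congr' ?_
    filter_upwards [hu] with r hr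
    rw [Set.indicator_of_notMem]
    exact fun h => lt_asymm (Set.mem_Iio.1 hr) h
  have h2 := h1.ennrpow_const (2⁻¹ : ℝ)
  rwa [ENNReal.zero_rpow_of_pos (by positivity)] at h2

/-- Families of multipliers that are Hölder continuous relative to the weights. -/
structure IsHolderMultiplier (k : ℕ) (m : Eucl d → Polar d → ℂ) : Prop where
  measurable : ∀ s, Measurable (m s)
  bound_zero : ∃ C : ℝ≥0∞, C ≠ ∞ ∧ ∀ x, ‖m 0 x‖ₑ ≤ C * weight k 0 x.1
  holder : ∀ M : ℝ, ∃ C : ℝ, 0 ≤ C ∧ ∀ γ : ℝ, 0 ≤ γ → γ ≤ 1 → ∀ s t, ‖s‖ ≤ M → ‖t‖ ≤ M → ∀ x,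
    ‖m s x - m t x‖ₑ ≤ ENNReal.ofReal (C * ‖s - t‖ ^ γ) * weight k γ x.1

theorem isHolderMultiplier_phase_mul_cutoff :
    IsHolderMultiplier k fun (s : Eucl d) x => phase s x * cutoff k 1 x :=
  ⟨fun s => (measurable_phase s).mul (measurable_cutoff k 1),
    ⟨1, by simp, fun x => by
      simpa [phase_zero] using enorm_cutoff_one_le k x le_rfl⟩,
    fun _ => ⟨2, by norm_num, fun _ h0 h1 s t _ _ x =>
      enorm_cutoff_mul_phase_sub_le k s t x h0 h1⟩⟩

theorem isHolderMultiplier_compPhase : IsHolderMultiplier k (compPhase (d := d) k) :=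
  ⟨measurable_compPhase k, ⟨0, by simp, fun x => by simp [compPhase_zero]⟩, fun M => by
    rcases le_or_gt 0 M with hM | hM
    · exact ⟨2 + M ^ k * Real.exp M * (1 + 2 * M), by positivity, fun γ h0 h1 s t hs ht x =>
        norm_compPhase_sub_le k hs ht x h0 h1⟩
    · exact ⟨0, le_rfl, fun γ h0 h1 s t hs => absurd ((norm_nonneg s).trans hs) (not_le.2 hM)⟩⟩

theorem IsHolderMultiplier.mul {m : Eucl d → Polar d → ℂ} (hm : IsHolderMultiplier k m)
    {c : Polar d → ℂ} (hc : Measurable c) (hc1 : ∀ x, ‖c x‖ ≤ 1) :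
    IsHolderMultiplier k fun s x => c x * m s x := by
  have hle : ∀ x (z : ℂ), ‖c x * z‖ₑ ≤ ‖z‖ₑ := fun x z => by
    rw [enorm_mul]
    refine mul_le_of_le_one_left' ?_
    rw [← ofReal_norm]
    exact ENNReal.ofReal_le_one.2 (hc1 x)
  refine ⟨fun s => hc.mul (hm.measurable s), ?_, fun M => ?_⟩
  · obtain ⟨C, hC, h⟩ := hm.bound_zero
    exact ⟨C, hC, fun x => (hle x _).trans (h x)⟩
  · obtain ⟨C, hC, h⟩ := hm.holder M
    refine ⟨C, hC, fun γ h0 h1 s t hs ht x => ?_⟩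
    rw [← mul_sub]
    exact (hle x _).trans (h γ h0 h1 s t hs ht x)

theorem IsHolderMultiplier.exists_enorm_le {m : Eucl d → Polar d → ℂ}
    (hm : IsHolderMultiplier k m) (s : Eucl d) :
    ∃ C : ℝ≥0∞, C ≠ ∞ ∧ ∀ x, ‖m s x‖ₑ ≤ C * weight k 0 x.1 := by
  obtain ⟨C, hC, h⟩ := hm.bound_zero
  obtain ⟨D, -, h'⟩ := hm.holder ‖s‖
  refine ⟨ENNReal.ofReal (D * ‖s - 0‖ ^ (0 : ℝ)) + C, by finiteness, fun x => ?_⟩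
  have h1 := h' 0 le_rfl zero_le_one s 0 le_rfl (by simp) x
  have h2 : ‖m s x‖ₑ ≤ ‖m s x - m 0 x‖ₑ + ‖m 0 x‖ₑ := by
    simpa using enorm_add_le (m s x - m 0 x) (m 0 x)
  rw [add_mul]
  exact h2.trans (add_le_add h1 (h x))

theorem IsHolderMultiplier.isL2Kernel {m : Eucl d → Polar d → ℂ} (hm : IsHolderMultiplier k m)
    (hΦ : IsBaseKernel μ k ε Φ w a) (hε : 0 < ε) (s : Eucl d) :
    IsL2Kernel μ (fun x => m s x • Φ x) := by
  obtain ⟨C, hC, h⟩ := hm.exists_enorm_le s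
  exact hΦ.isL2Kernel hε hC (hm.measurable s) h

/-! ### Annihilation of the compensating polynomials -/

section Integ

theorem IsCircularNoise.isStochInt_integ (hW : IsCircularNoise P μ W) {m : Eucl d → Polar d → ℂ}
    {X : Eucl d → Ω → V} (hX : ∀ s, IsStochInt μ W P (fun x => m s x • Φ x) (X s))
    (l : FinMeas d) :
    IsStochInt μ W P (fun x => integ (fun t => m t x) l • Φ x)
      (fun ω => integ (fun t => X t ω) l) := by
  have h := hW.isStochInt_sum l.support fun t _ => (hX t).smul (l t)
  simpa only [integ_apply, Finset.sum_smul, smul_eq_mul, mul_smul] using h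

theorem fourier_eq_integ_phase (l : FinMeas d) (x : Polar d) :
    fourier l ((x.1 : ℝ) • (x.2 : Eucl d)) = integ (fun t => phase t x) l := by
  rw [fourier]
  congr 2
  funext t
  rw [phase, real_inner_smul_left, real_inner_comm]

/-- In the variable `t` the Taylor polynomial is a polynomial of degree at most `k` in one linear
form. -/
theorem integ_taylor_eq_zero (l : Lam k d) (x : Polar d) :
    integ (fun t : Eucl d => ∑ j ∈ Finset.range (k + 1),
      (Complex.I * ((x.1 : ℝ) * inner ℝ t (x.2 : Eucl d) : ℝ)) ^ j / (j.factorial : ℂ))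
      (l : FinMeas d) = 0 := by
  set q : MvPolynomial (Fin d) ℂ := ∑ i, MvPolynomial.C (Complex.I * ((x.1 : ℝ) *
    (x.2 : Eucl d) i : ℝ)) * MvPolynomial.X i with hq
  have hqd : q.totalDegree ≤ 1 := by
    refine MvPolynomial.totalDegree_finsetSum_le fun i _ => ?_
    refine (MvPolynomial.totalDegree_mul _ _).trans ?_
    rw [MvPolynomial.totalDegree_C, MvPolynomial.totalDegree_X]
  have hqe : ∀ t : Eucl d, polyEval q t =
      Complex.I * ((x.1 : ℝ) * inner ℝ t (x.2 : Eucl d) : ℝ) := by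
    intro t
    simp only [polyEval, hq, map_sum, map_mul, MvPolynomial.eval_C, MvPolynomial.eval_X,
      PiLp.inner_apply]
    push_cast
    rw [Finset.mul_sum, Finset.mul_sum]
    refine Finset.sum_congr rfl fun i _ => ?_
    simp
    ring
  have h := l.2 (∑ j ∈ Finset.range (k + 1), MvPolynomial.C ((j.factorial : ℂ))⁻¹ * q ^ j) (by
    refine MvPolynomial.totalDegree_finsetSum_le fun j hj => ?_
    refine (MvPolynomial.totalDegree_mul _ _).trans ?_
    rw [MvPolynomial.totalDegree_C, zero_add]
    refine (MvPolynomial.totalDegree_pow _ _).trans ((Nat.mul_le_mul_left _ hqd).trans ?_)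
    have := Finset.mem_range.1 hj
    omega)
  rw [← h]
  congr 2
  funext t
  simp only [← hqe, polyEval, map_sum, map_mul, map_pow, MvPolynomial.eval_C]
  refine Finset.sum_congr rfl fun j _ => ?_
  ring

theorem integ_const_eq_zero (c : ℂ) (l : Lam k d) :
    integ (fun _ : Eucl d => c) (l : FinMeas d) = 0 := by
  have h := l.2 (MvPolynomial.C c) (by simp)
  rw [← h]
  congr 2
  funext t
  simp [polyEval]

theorem integ_compPhase (l : Lam k d) (x : Polar d) :
    integ (fun t => compPhase k t x) (l : FinMeas d) =
      fourier (l : FinMeas d) ((x.1 : ℝ) • (x.2 : Eucl d)) := by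
  rw [fourier_eq_integ_phase]
  have h : ∀ f g : Eucl d → ℂ, integ (fun t => f t - g t) (l : FinMeas d) =
      integ f (l : FinMeas d) - integ g (l : FinMeas d) := fun f g => by
    simp [integ_apply, mul_sub]
  simp only [compPhase]
  rw [h]
  split_ifs
  · rw [integ_taylor_eq_zero, sub_zero]
  · rw [integ_const_eq_zero, sub_zero]

end Integ

variable [SecondCountableTopology V]

theorem IsHolderMultiplier.exists_isStochInt {m : Eucl d → Polar d → ℂ}
    (hm : IsHolderMultiplier k m) (hW : IsCircularNoise P μ W) (hΦ : IsBaseKernel μ k ε Φ w a)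
    (hε : 0 < ε) : ∃ X : Eucl d → Ω → V, ∀ s, IsStochInt μ W P (fun x => m s x • Φ x) (X s) := by
  choose X hX using fun s => hW.exists_isStochInt (hm.isL2Kernel hΦ hε s)
  exact ⟨X, hX⟩

variable [IsProbabilityMeasure P]

/-- Moments of stochastic integrals of kernels that are supported on `S`. -/
theorem IsBaseKernel.exists_moment_bound (hΦ : IsBaseKernel μ k ε Φ w a) (hγ : γ < ε) {p : ℕ}
    (hp : p ≠ 0) : ∃ B : ℝ≥0∞, B ≠ ∞ ∧
    ∀ {Ω : Type*} [MeasurableSpace Ω] {P : Measure Ω} [IsProbabilityMeasure P]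
      {W : BddBorel d → Ω → V} (_ : IsCircularNoise P μ W) {S : Set (Set.Ioi (0 : ℝ))}
      (_ : MeasurableSet S) {m : Polar d → ℂ} (_ : Measurable m) {C : ℝ≥0∞} (_ : C ≠ ∞)
      (_ : ∀ x, ‖m x‖ₑ ≤ C * S.indicator (weight k γ) x.1) {I : Ω → V}
      (_ : IsStochInt μ W P (fun x => m x • Φ x) I),
      ∫⁻ ω, ‖I ω‖ₑ ^ p ∂P ≤ B * (C * radialNorm k γ w S) ^ p := by
  obtain ⟨c, hc, hcb⟩ := IsCircularNoise.exists_moment_bound (V := V) (μ := μ) hp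
  set α : ℝ≥0∞ := (∫⁻ θ, a θ ^ 2 ∂μ.traceMeasure) ^ (2⁻¹ : ℝ)
  have hα : α ≠ ∞ := ENNReal.rpow_ne_top_of_nonneg (by positivity) hΦ.angular_lt_top.ne
  -- The factor `2` is the square root of the constant `4` in `lintegral_sq_le`.
  refine ⟨c * (2 * α) ^ p, by finiteness, ?_⟩
  intro Ω _ P _ W hW S hS m hm C hC hmC I hI
  refine (hcb hW hI).trans ?_
  rw [mul_assoc, ← mul_pow]
  gcongr
  have hL2 := hΦ.isL2Kernel hγ hC hm fun x => (hmC x).trans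
    (mul_le_mul' le_rfl (Set.indicator_le_self _ _ _))
  have h1 := (hW.lintegral_sq_le hL2 hI).trans (mul_le_mul' le_rfl (hΦ.lintegral_le hC hS hmC))
  rw [lintegral_enorm_sq_eq_eLpNorm] at h1
  refine (ENNReal.pow_le_pow_left_iff two_ne_zero).1 (h1.trans (le_of_eq ?_))
  rw [mul_pow, mul_pow, mul_pow, radialNorm, rpow_half_sq, rpow_half_sq]
  norm_num
  ring

/-- Moments of the increments of fields given by stochastic integrals. -/
theorem IsHolderMultiplier.moment_bound {m : Eucl d → Polar d → ℂ} (hm : IsHolderMultiplier k m)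
    (hΦ : IsBaseKernel μ k ε Φ w a) (hW : IsCircularNoise P μ W) {X : Eucl d → Ω → V}
    (hX : ∀ s, IsStochInt μ W P (fun x => m s x • Φ x) (X s)) (h0 : 0 ≤ γ) (h1 : γ < min 1 ε)
    {p : ℕ} (hp : p ≠ 0) (M : ℝ) : ∃ C : ℝ≥0∞, C ≠ ∞ ∧ ∀ s t, ‖s‖ ≤ M → ‖t‖ ≤ M →
      ∫⁻ ω, ‖X s ω - X t ω‖ₑ ^ p ∂P ≤ C * ENNReal.ofReal (‖s - t‖ ^ (γ * p)) := by
  obtain ⟨B, hB, hb⟩ := hΦ.exists_moment_bound (h1.trans_le (min_le_right _ _)) hp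
  obtain ⟨D, hD, hd⟩ := hm.holder M
  have hη := hΦ.radialNorm_ne_top (h1.trans_le (min_le_right _ _)) Set.univ
  refine ⟨B * (ENNReal.ofReal D * radialNorm k γ w Set.univ) ^ p, by finiteness,
    fun s t hs ht => ?_⟩
  have hI := hW.isStochInt_sub (hX s) (hX t)
  simp only [← sub_smul] at hI
  refine (hb hW MeasurableSet.univ ((hm.measurable s).sub (hm.measurable t))
    (C := ENNReal.ofReal (D * ‖s - t‖ ^ γ)) (by finiteness) (fun x => ?_) hI).trans (le_of_eq ?_)
  · rw [Set.indicator_univ]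
    exact hd γ h0 (h1.trans_le (min_le_left _ _)).le s t hs ht x
  · rw [Real.rpow_mul (norm_nonneg _), Real.rpow_natCast, ENNReal.ofReal_pow (by positivity),
      ENNReal.ofReal_mul hD]
    ring

variable [MeasurableSpace V] [BorelSpace V]

theorem IsHolderMultiplier.exists_version {m : Eucl d → Polar d → ℂ}
    (hm : IsHolderMultiplier k m) (hΦ : IsBaseKernel μ k ε Φ w a) (hε : 0 < ε)
    (hW : IsCircularNoise P μ W) {X : Eucl d → Ω → V}
    (hX : ∀ s, IsStochInt μ W P (fun x => m s x • Φ x) (X s)) :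
    ∃ Xv : Eucl d → Ω → V, (∀ s, Measurable (Xv s)) ∧ (∀ s, Xv s =ᵐ[P] X s) ∧
      ∀ ω, ∀ γ : ℝ, 0 < γ → γ < min 1 ε → IsLocHolder γ fun s => Xv s ω :=
  exists_isLocHolder_version (fun s => (hX s).1.1) (lt_min one_pos hε)
    fun _ h0 h1 _ hp M => hm.moment_bound hΦ hW hX h0.le h1 hp M

theorem IsLocHolder.continuous {g : Eucl d → V} (hγ : 0 < γ) (hg : IsLocHolder γ g) :
    Continuous g := by
  refine continuous_iff_continuousAt.2 fun t => ?_
  obtain ⟨C, hC⟩ := hg (‖t‖ + 1)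
  have h1 : Tendsto (fun s => C * ‖s - t‖ ^ γ) (𝓝 t) (𝓝 0) := by
    have h2 : Continuous fun s : Eucl d => C * ‖s - t‖ ^ γ :=
      continuous_const.mul ((continuous_id.sub continuous_const).norm.rpow_const
        fun _ => Or.inr hγ.le)
    have h3 := h2.tendsto t
    rwa [sub_self, norm_zero, Real.zero_rpow hγ.ne', mul_zero] at h3
  refine tendsto_iff_norm_sub_tendsto_zero.2 (squeeze_zero' (Eventually.of_forall fun s =>
    norm_nonneg _) ?_ h1)
  filter_upwards [Metric.ball_mem_nhds t one_pos] with s hs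
  refine hC s t ?_ (by linarith)
  have := norm_sub_norm_le s t
  rw [Metric.mem_ball, dist_eq_norm] at hs
  linarith

/-- A random continuous function whose values are the given stochastic integrals. -/
theorem IsHolderMultiplier.exists_continuous {m : Eucl d → Polar d → ℂ}
    (hm : IsHolderMultiplier k m) (hΦ : IsBaseKernel μ k ε Φ w a) (hε : 0 < ε)
    (hW : IsCircularNoise P μ W) : ∃ F : Ω → C(Eucl d, V), Measurable F ∧
      ∀ s, IsStochInt μ W P (fun x => m s x • Φ x) (fun ω => F ω s) := by
  obtain ⟨X, hX⟩ := hm.exists_isStochInt hW hΦ hε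
  obtain ⟨Xv, h1, h2, h3⟩ := hm.exists_version hΦ hε hW hX
  have h4 : 0 < min 1 ε := lt_min one_pos hε
  exact ⟨fun ω => ⟨fun s => Xv s ω, (h3 ω _ (half_pos h4) (half_lt_self h4)).continuous
    (half_pos h4)⟩, measurable_continuousMap h1, fun s => (hX s).congr_ae (h2 s).symm⟩

/-- Finite dimensional distributions do not change when the integrands are multiplied by a
function of modulus one. -/
theorem IsCircularNoise.identDistrib_mul (hW : IsCircularNoise P μ W) {ι : Type*} [Fintype ι]
    {f : ι → Polar d → V →L[ℂ] V} {c : Polar d → ℂ} (hc : Measurable c) (hc1 : ∀ x, ‖c x‖ = 1)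
    {I J : ι → Ω → V} (hI : ∀ i, IsStochInt μ W P (f i) (I i))
    (hJ : ∀ i, IsStochInt μ W P (fun x => c x • f i x) (J i)) :
    IdentDistrib (fun ω i => J i ω) (fun ω i => I i ω) P P := by
  refine hW.identDistrib hJ hI fun T => ?_
  have h1 := hW.isStochInt_sum Finset.univ fun i _ => (hI i).comp (T i)
  have h2 := hW.isStochInt_sum Finset.univ fun i _ => (hJ i).comp (T i)
  refine hW.lintegral_sq_mul_eq hc hc1 h1 ?_
  simpa only [ContinuousLinearMap.comp_smul, ← Finset.smul_sum] using h2

/-- Finite dimensional distributions under a dilation of the integrands. -/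
theorem IsCircularNoise.identDistrib_dilate (hW : IsCircularNoise P μ W) {ι : Type*} [Fintype ι]
    {f : ι → Polar d → V →L[ℂ] V} {c : ℝ} (hc : 0 < c)
    {I J : ι → Ω → V} (hI : ∀ i, IsStochInt μ W P (f i) (I i))
    (hJ : ∀ i, IsStochInt μ W P (fun x => ((c ^ (2⁻¹ : ℝ) : ℝ) : ℂ) • f i (dilate c hc x)) (J i)) :
    IdentDistrib (fun ω i => J i ω) (fun ω i => I i ω) P P := by
  refine hW.identDistrib hJ hI fun T => ?_
  have h1 := hW.isStochInt_sum Finset.univ fun i _ => (hI i).comp (T i)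
  -- Removing `c^{1/2}` leaves a pure dilation, whose factor `c⁻¹` on second moments is then exactly
  -- compensated.
  have h2 := (hW.isStochInt_sum Finset.univ fun i _ => (hJ i).comp (T i)).smul
    ((c ^ (-(2⁻¹ : ℝ)) : ℝ) : ℂ)
  have e : ((c ^ (-(2⁻¹ : ℝ)) : ℝ) : ℂ) * ((c ^ (2⁻¹ : ℝ) : ℝ) : ℂ) = 1 := by
    rw [← Complex.ofReal_mul, ← Real.rpow_add hc]
    simp
  simp only [ContinuousLinearMap.comp_smul, ← Finset.smul_sum, smul_smul, e, one_smul] at h2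
  have h3 := hW.lintegral_sq_dilate c hc h1 h2
  simp only [enorm_smul, mul_pow] at h3
  rw [lintegral_const_mul' _ _ (by finiteness)] at h3
  have e2 : ‖((c ^ (-(2⁻¹ : ℝ)) : ℝ) : ℂ)‖ₑ ^ 2 = ENNReal.ofReal c⁻¹ := by
    rw [← ofReal_norm, Complex.norm_real, Real.norm_eq_abs, abs_of_nonneg (by positivity),
      ← ENNReal.ofReal_pow (by positivity), ← Real.rpow_natCast, ← Real.rpow_mul hc.le]
    norm_num [Real.rpow_neg_one]
  rw [e2] at h3
  exact (ENNReal.mul_right_inj (by simpa using hc) ENNReal.ofReal_ne_top).1 h3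

end Fields

/-! ### Laws of the rescaled fields -/

section Laws

variable {d k : ℕ} {V : Type*} [NormedAddCommGroup V] [InnerProductSpace ℂ V] [CompleteSpace V]
  {Ω : Type*} [MeasurableSpace Ω] {P : Measure Ω} {μ : TraceClassMeasure V (USphere d)}
  {W : BddBorel d → Ω → V} {H : V →L[ℂ] V} {A : USphere d → V →L[ℂ] V}

theorem baseKernel_dilate (c : ℝ) (hc : 0 < c) (x : Polar d) :
    baseKernel H A (dilate c hc x) =
      ((c ^ (-(2⁻¹ : ℝ)) : ℝ) : ℂ) • (opPow c (-H) ∘L baseKernel H A x) := by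
  have hx : (0 : ℝ) < x.1 := x.1.2
  simp only [baseKernel, dilate]
  rw [opPow_mul hc hx, opPow_neg_add_half hc, ContinuousLinearMap.mul_def,
    ContinuousLinearMap.smul_comp, ContinuousLinearMap.smul_comp, ContinuousLinearMap.comp_assoc]

theorem opPow_neg_comp_baseKernel (c : ℝ) (hc : 0 < c) (x : Polar d) :
    opPow c (-H) ∘L baseKernel H A x =
      ((c ^ (2⁻¹ : ℝ) : ℝ) : ℂ) • baseKernel H A (dilate c hc x) := by
  rw [baseKernel_dilate, smul_smul, ← Complex.ofReal_mul, ← Real.rpow_add hc]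
  simp

theorem integ_phase_affineFin (s : Eucl d) (r : ℝ) (hr : 0 < r) (l : FinMeas d) (x : Polar d) :
    integ (fun t => phase t x) (affineFin s r l) =
      phase s x * integ (fun t => phase t (dilate r hr x)) l := by
  rw [integ_affineFin]
  simp only [phase_add, phase_smul r hr, integ_apply, smul_eq_mul, Finset.mul_sum]
  exact Finset.sum_congr rfl fun t _ => by ring

theorem cutoff_dilate (r : ℝ) (hr : 0 < r) (x : Polar d) :
    cutoff k r (dilate r hr x) = cutoff k 1 x := by
  simp only [cutoff, dilate]
  rw [mul_div_cancel_left₀ _ hr.ne', div_one]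

theorem integ_mul_left (c : ℂ) (f : Eucl d → ℂ) (l : FinMeas d) :
    integ (fun t => c * f t) l = c * integ f l := by
  simp only [integ_apply, smul_eq_mul, Finset.mul_sum]
  exact Finset.sum_congr rfl fun t _ => by ring

variable [SecondCountableTopology V]

theorem isStochInt_integ_compPhase (hW : IsCircularNoise P μ W) {F : Ω → Eucl d → V}
    (hF : ∀ t, IsStochInt μ W P (fun x => compPhase k t x • baseKernel H A x) (fun ω => F ω t))
    (l : Lam k d) :
    IsStochInt μ W P (tangentKernel H A (l : FinMeas d)) (fun ω => integ (F ω) (l : FinMeas d)) := by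
  have h := hW.isStochInt_integ hF (l : FinMeas d)
  simp only [integ_compPhase] at h
  exact h

theorem isStochInt_integ_cutoff (hW : IsCircularNoise P μ W) {F : Ω → Eucl d → V} {r : ℝ}
    (hF : ∀ t, IsStochInt μ W P (fun x => (cutoff k r x * compPhase k t x) • baseKernel H A x)
      (fun ω => F ω t)) (l : Lam k d) :
    IsStochInt μ W P (fun x => (cutoff k r x * integ (fun t => phase t x) (l : FinMeas d)) •
      baseKernel H A x) (fun ω => integ (F ω) (l : FinMeas d)) := by
  have h := hW.isStochInt_integ hF (l : FinMeas d)
  simpa only [integ_mul_left, integ_compPhase, fourier_eq_integ_phase] using h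

/-- Up to a phase, rescaling the field dilates a kernel by `r` with the factor `r^{1/2}` that
preserves laws. The cutoff at frequency `1` is the dilation of the cutoff at frequency `r`, so the
undilated kernel is the tangent kernel damped below `r`. -/
theorem isStochInt_rescaled (hW : IsCircularNoise P μ W) {G : Ω → Eucl d → V}
    (hG : ∀ t, IsStochInt μ W P (fun x => (phase t x * cutoff k 1 x) • baseKernel H A x)
      (fun ω => G ω t)) (s : Eucl d) {r : ℝ} (hr : 0 < r) (l : FinMeas d) :
    IsStochInt μ W P (fun x => phase s x • (((r ^ (2⁻¹ : ℝ) : ℝ) : ℂ) •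
      ((cutoff k r (dilate r hr x) * integ (fun t => phase t (dilate r hr x)) l) •
        baseKernel H A (dilate r hr x))))
      (fun ω => opPow r (-H) (integ (G ω) (affineFin s r l))) := by
  have h := (hW.isStochInt_integ hG (affineFin s r l)).comp (opPow r (-H))
  convert! h using 2 with x
  simp only [mul_comm _ (cutoff k 1 x)]
  rw [integ_mul_left, integ_phase_affineFin s r hr, ContinuousLinearMap.comp_smul,
    opPow_neg_comp_baseKernel r hr, cutoff_dilate, smul_smul, smul_smul, smul_smul]
  congr 1
  ring

variable [IsProbabilityMeasure P] [MeasurableSpace V] [BorelSpace V]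

theorem identDistrib_rescaled (hW : IsCircularNoise P μ W) {G F : Ω → Eucl d → V} {r : ℝ}
    (hr : 0 < r)
    (hG : ∀ t, IsStochInt μ W P (fun x => (phase t x * cutoff k 1 x) • baseKernel H A x)
      (fun ω => G ω t))
    (hF : ∀ t, IsStochInt μ W P (fun x => (cutoff k r x * compPhase k t x) • baseKernel H A x)
      (fun ω => F ω t)) (s : Eucl d) {n : ℕ} (l : Fin n → Lam k d) :
    IdentDistrib (fun ω i => opPow r (-H) (integ (G ω) (affineFin s r (l i : FinMeas d))))
      (fun ω i => integ (F ω) (l i : FinMeas d)) P P := by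
  have h0 := fun i => isStochInt_rescaled hW hG 0 hr (l i : FinMeas d)
  simp only [phase_zero, one_smul] at h0
  exact (hW.identDistrib_mul (measurable_phase s) (norm_phase s) h0
    fun i => isStochInt_rescaled hW hG s hr (l i : FinMeas d)).trans
    (hW.identDistrib_dilate hr (fun i => isStochInt_integ_cutoff hW hF (l i)) h0)

/-- The kernel of `Y(c·λ)` is `c^{1/2}` times the dilation by `c` of the kernel of `c^H Y(λ)`: the
factor `c^{-H}` produced by the dilation cancels `c^H`. -/
theorem isSelfSimilar_of_isStochInt (hW : IsCircularNoise P μ W) {Y : Ω → PathSpace k d V}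
    (hY : ∀ l : Lam k d, IsStochInt μ W P (tangentKernel H A l) (fun ω => (Y ω).eval l)) :
    IsSelfSimilar P H Y := by
  intro c hc n l
  refine hW.identDistrib_dilate hc (fun i => (hY (l i)).comp (opPow c H)) fun i => ?_
  convert! hY (affine 0 c (l i)) using 2 with x
  change _ = fourier (affineFin 0 c (l i : FinMeas d)) ((x.1 : ℝ) • (x.2 : Eucl d)) •
    baseKernel H A x
  change ((c ^ (2⁻¹ : ℝ) : ℝ) : ℂ) • (opPow c H ∘L (fourier (l i : FinMeas d)
    (((dilate c hc x).1 : ℝ) • ((dilate c hc x).2 : Eucl d)) •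
      baseKernel H A (dilate c hc x))) = _
  rw [fourier_eq_integ_phase, fourier_eq_integ_phase, integ_phase_affineFin 0 c hc, phase_zero,
    one_mul, ContinuousLinearMap.comp_smul, smul_comm]
  congr 1
  rw [baseKernel_dilate, ContinuousLinearMap.comp_smul, smul_smul, ← Complex.ofReal_mul,
    ← Real.rpow_add hc, ← ContinuousLinearMap.comp_assoc,
    show opPow c H ∘L opPow c (-H) = 1 from opPow_mul_neg c H]
  simp [ContinuousLinearMap.one_def]

/-- Translation by `w` multiplies all kernels by the same phase, so pairs keep their joint law and,
in particular, their cross-covariance. -/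
theorem isIRF_of_isStochInt (hW : IsCircularNoise P μ W) {Y : Ω → PathSpace k d V}
    (hY : ∀ l : Lam k d, IsStochInt μ W P (tangentKernel H A l) (fun ω => (Y ω).eval l)) :
    IsIRF P Y := by
  refine ⟨fun l => ⟨(hY l).1, hW.integral_eq_zero (hY l)⟩, fun w l m => ?_⟩
  have hk : ∀ l : Lam k d, IsStochInt μ W P (fun x => phase w x • tangentKernel H A l x)
      (fun ω => (Y ω).eval (affine w 1 l)) := by
    intro l
    convert! hY (affine w 1 l) using 2 with x
    change phase w x • (fourier (l : FinMeas d) ((x.1 : ℝ) • (x.2 : Eucl d)) •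
      baseKernel H A x) = fourier (affineFin w 1 (l : FinMeas d))
        ((x.1 : ℝ) • (x.2 : Eucl d)) • baseKernel H A x
    rw [smul_smul, fourier_eq_integ_phase, fourier_eq_integ_phase,
      integ_phase_affineFin w 1 one_pos]
    congr 4
    funext t
    rw [← phase_smul, one_smul]
  have h := hW.identDistrib_mul (measurable_phase w) (norm_phase w) (ι := Fin 2)
    (fun i => hY (![l, m] i)) (fun i => hk (![l, m] i))
  refine ContinuousLinearMap.ext fun b => ext_inner_left ℂ fun a => ?_
  rw [inner_crossCov (hk l).1 (hk m).1, inner_crossCov (hY l).1 (hY m).1]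
  have hu : Measurable fun z : Fin 2 → V => (inner ℂ a (z 0) * inner ℂ (z 1) b : ℂ) := by
    fun_prop
  exact (h.comp hu).integral_eq

/-- The stationarity of the field. -/
theorem isStrictlyStationary_of_isStochInt (hW : IsCircularNoise P μ W) {c : Polar d → ℂ}
    {Φ : Polar d → V →L[ℂ] V} {X : Eucl d → Ω → V}
    (hX : ∀ s, IsStochInt μ W P (fun x => (phase s x * c x) • Φ x) (X s)) :
    IsStrictlyStationary P X := by
  intro h n s
  refine hW.identDistrib_mul (measurable_phase h) (norm_phase h) (fun i => hX (s i)) fun i => ?_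
  convert! hX (s i + h) using 2 with x
  rw [phase_add, smul_smul]
  congr 1
  ring

end Laws

/-! ### Convergence of the rescaled fields -/

section Convergence

variable {d k : ℕ} {V : Type*} [NormedAddCommGroup V] [InnerProductSpace ℂ V] [CompleteSpace V]
  [SecondCountableTopology V] [MeasurableSpace V] [BorelSpace V]
  {Ω : Type*} [MeasurableSpace Ω] {P : Measure Ω} [IsProbabilityMeasure P]
  {μ : TraceClassMeasure V (USphere d)}
  {W : BddBorel d → Ω → V} {ε : ℝ} {Φ : Polar d → V →L[ℂ] V}
  {w : Set.Ioi (0 : ℝ) → ℝ≥0∞} {a : USphere d → ℝ≥0∞}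

/-- Locally uniform bounds for the error of the cutoff of low frequencies. -/
theorem IsBaseKernel.exists_cutoff_error_bound (hΦ : IsBaseKernel μ k ε Φ w a) (hε : 0 < ε)
    (hW : IsCircularNoise P μ W) : ∃ p : ℕ, p ≠ 0 ∧ ∃ γ < ε, ∀ m : ℕ, ∃ c : ℝ≥0∞, c ≠ ∞ ∧
      ∀ r : ℝ, 0 < r → ∀ F G : Ω → C(Eucl d, V), Measurable F → Measurable G →
        (∀ t, IsStochInt μ W P (fun x => compPhase k t x • Φ x) (fun ω => F ω t)) →
        (∀ t, IsStochInt μ W P (fun x => (cutoff k r x * compPhase k t x) • Φ x)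
          (fun ω => G ω t)) →
        ∃ K : Ω → ℝ≥0∞, Measurable K ∧
          ∫⁻ ω, K ω ∂P ≤ c * radialNorm k γ w {u | (u : ℝ) < r} ^ p ∧
          ∀ᵐ ω ∂P, ∀ s, ‖s‖ < 2 ^ m → ‖G ω s - F ω s‖ₑ ^ p ≤ K ω := by
  have hε' : 0 < min 1 ε := lt_min one_pos hε
  -- Any exponent strictly between `0` and `min 1 ε` serves; `p` is then large enough for the
  -- maximal inequality, `γ p > 2d`.
  set γ : ℝ := min 1 ε / 2 with hγdef
  have hγ0 : 0 < γ := half_pos hε'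
  have hγ1 : γ < min 1 ε := half_lt_self hε'
  have hγε : γ < ε := hγ1.trans_le (min_le_right _ _)
  obtain ⟨p, hp⟩ := exists_nat_gt (2 * d / γ)
  have hq : 2 * d < γ * p := by
    rw [div_lt_iff₀ hγ0] at hp
    linarith
  have hp0 : p ≠ 0 := by
    rintro rfl
    have : (0 : ℝ) ≤ 2 * d := by positivity
    simp only [Nat.cast_zero, mul_zero] at hq
    linarith
  refine ⟨p, hp0, γ, hγε, fun m => ?_⟩
  obtain ⟨L, c, hc, hmax⟩ := exists_maximal_bound (V := V) (d := d) P m hp0 hq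
  obtain ⟨B, hB, hb⟩ := hΦ.exists_moment_bound hγε hp0
  obtain ⟨D, hD, hd⟩ := (isHolderMultiplier_compPhase (d := d) (k := k)).holder L
  refine ⟨c * (B * (ENNReal.ofReal (2 * D)) ^ p), by finiteness,
    fun r hr F G hF hG hFI hGI => ?_⟩
  have hS : MeasurableSet {u : Set.Ioi (0 : ℝ) | (u : ℝ) < r} :=
    measurableSet_lt measurable_subtype_coe measurable_const
  have hη := hΦ.radialNorm_ne_top hγε {u | (u : ℝ) < r}
  -- The multiplier `cutoff - 1` vanishes for `u ≥ r`, which confines the error to low frequencies.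
  have hZ : ∀ t, IsStochInt μ W P (fun x => ((cutoff k r x - 1) * compPhase k t x) • Φ x)
      (fun ω => G ω t - F ω t) := by
    intro t
    have := hW.isStochInt_sub (hGI t) (hFI t)
    simpa only [sub_mul, one_mul, sub_smul] using this
  have hev : ∀ s, Measurable fun g : C(Eucl d, V) => g s := fun s =>
    (continuous_eval_const s).measurable
  obtain ⟨K, hK, hKi, hKb⟩ := hmax (fun t ω => G ω t - F ω t)
    (fun t => ((hev t).comp hG).sub ((hev t).comp hF))
    (fun ω => (G ω).continuous.sub (F ω).continuous)
    (B * (ENNReal.ofReal (2 * D) * radialNorm k γ w {u | (u : ℝ) < r}) ^ p) (by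
      intro s t hs ht
      have hI := hW.isStochInt_sub (hZ s) (hZ t)
      simp only [← sub_smul, ← mul_sub] at hI
      refine (hb hW hS (m := fun x => (cutoff k r x - 1) * (compPhase k s x - compPhase k t x))
        (((measurable_cutoff k r).sub_const 1).mul
        ((measurable_compPhase k s).sub (measurable_compPhase k t)))
        (C := ENNReal.ofReal (2 * D * ‖s - t‖ ^ γ)) (by finiteness) (fun x => ?_) hI).trans
        (le_of_eq ?_)
      · by_cases hx : x.1 ∈ {u : Set.Ioi (0 : ℝ) | (u : ℝ) < r}
        · rw [Set.indicator_of_mem hx, enorm_mul, mul_assoc 2, ENNReal.ofReal_mul zero_le_two,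
            mul_assoc]
          refine mul_le_mul' ?_ (hd γ hγ0.le (hγ1.trans_le (min_le_left _ _)).le s t hs ht x)
          rw [← ofReal_norm]
          refine ENNReal.ofReal_le_ofReal ((norm_sub_le _ _).trans ?_)
          rw [norm_one]
          linarith [norm_cutoff_le k hr x]
        · rw [cutoff_of_le k hr (not_lt.1 hx)]
          simp
      · rw [Real.rpow_mul (norm_nonneg _), Real.rpow_natCast, ENNReal.ofReal_pow (by positivity),
          ENNReal.ofReal_mul (by positivity)]
        ring)
  refine ⟨K, hK, hKi.trans (le_of_eq (by ring)), ?_⟩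
  -- The compensated phase vanishes at `t = 0`, so the maximal bound for increments from `0` bounds
  -- the field itself.
  have h0 : (fun ω => G ω 0 - F ω 0) =ᵐ[P] fun _ => 0 := by
    refine hW.ae_eq (hZ 0) ?_
    simpa only [compPhase_zero, mul_zero, zero_smul] using isStochInt_zero
  filter_upwards [h0] with ω hω s hs
  have := hKb ω s hs
  rwa [hω, sub_zero] at this

theorem tendsto_continuousMap_of_pow_le {F : ℕ → C(Eucl d, V)} {G : C(Eucl d, V)} {p : ℕ}
    {K : ℕ → ℕ → ℝ≥0∞}
    (hK : ∀ m, Tendsto (K m) atTop (𝓝 0))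
    (h : ∀ m n s, ‖s‖ < 2 ^ m → ‖F n s - G s‖ₑ ^ p ≤ K m n) : Tendsto F atTop (𝓝 G) := by
  rw [ContinuousMap.tendsto_iff_forall_isCompact_tendstoUniformlyOn]
  intro S hS
  obtain ⟨R, hR⟩ := hS.isBounded.exists_norm_le
  obtain ⟨m, hm⟩ := pow_unbounded_of_one_lt R (one_lt_two (α := ℝ))
  rw [EMetric.tendstoUniformlyOn_iff]
  intro δ hδ
  have hδp : 0 < δ ^ p := ENNReal.pow_pos hδ p
  filter_upwards [(hK m).eventually (Iio_mem_nhds hδp)] with n hn s hs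
  rw [edist_comm, edist_eq_enorm_sub]
  exact lt_of_pow_lt_pow_left' p ((h m n s ((hR s hs).trans_lt hm)).trans_lt hn)

theorem ae_tendsto_zero_of_lintegral_le {K : ℕ → Ω → ℝ≥0∞} (hK : ∀ n, Measurable (K n))
    {c : ℝ≥0∞} (hc : c ≠ ∞) (h : ∀ n, ∫⁻ ω, K n ω ∂P ≤ c * 2⁻¹ ^ n) :
    ∀ᵐ ω ∂P, Tendsto (fun n => K n ω) atTop (𝓝 0) := by
  have h1 : ∫⁻ ω, ∑' n, K n ω ∂P ≠ ∞ := by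
    rw [lintegral_tsum fun n => (hK n).aemeasurable]
    refine ((ENNReal.tsum_le_tsum h).trans_lt ?_).ne
    rw [ENNReal.tsum_mul_left, ENNReal.tsum_geometric, ENNReal.one_sub_inv_two, inv_inv]
    finiteness
  filter_upwards [ae_lt_top (Measurable.ennreal_tsum hK) h1] with ω hω
  exact ENNReal.tendsto_atTop_zero_of_tsum_ne_top hω.ne

/-- Indices with radial norms bounded by `2^{-n}` after taking `p`-th powers make the controls
summable in mean, for every ball at once. The indices need not increase: the subsequence criterion
for convergence only requires some choice. -/
theorem IsBaseKernel.exists_seq_ae_tendsto (hΦ : IsBaseKernel μ k ε Φ w a) (hε : 0 < ε)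
    (hW : IsCircularNoise P μ W) {F : Ω → C(Eucl d, V)} (hF : Measurable F)
    (hFI : ∀ t, IsStochInt μ W P (fun x => compPhase k t x • Φ x) (fun ω => F ω t))
    {G : ℝ → Ω → C(Eucl d, V)} (hG : ∀ r, 0 < r → Measurable (G r))
    (hGI : ∀ r, 0 < r → ∀ t, IsStochInt μ W P (fun x => (cutoff k r x * compPhase k t x) • Φ x)
      (fun ω => G r ω t)) {r : ℕ → ℝ} (hr : Tendsto r atTop (𝓝[>] 0)) :
    ∃ φ : ℕ → ℕ, (∀ n, 0 < r (φ n)) ∧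
      ∀ᵐ ω ∂P, Tendsto (fun n => G (r (φ n)) ω) atTop (𝓝 (F ω)) := by
  obtain ⟨p, hp, γ, hγ, hb⟩ := hΦ.exists_cutoff_error_bound hε hW
  choose c hc hcb using hb
  have hη : Tendsto (fun n => radialNorm k γ w {u | (u : ℝ) < r n} ^ p) atTop (𝓝 0) := by
    have := ENNReal.Tendsto.pow (n := p) ((hΦ.tendsto_radialNorm hγ).comp hr)
    rwa [zero_pow hp] at this
  have hex : ∀ n : ℕ, ∃ j, 0 < r j ∧ radialNorm k γ w {u | (u : ℝ) < r j} ^ p ≤ 2⁻¹ ^ n := by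
    intro n
    have h1 : (0 : ℝ≥0∞) < 2⁻¹ ^ n := ENNReal.pow_pos (by simp) n
    have h2 := hr.eventually self_mem_nhdsWithin
    obtain ⟨j, h3, h4⟩ := (h2.and (hη.eventually (Iio_mem_nhds h1))).exists
    exact ⟨j, h3, le_of_lt h4⟩
  choose φ hφ0 hφ using hex
  refine ⟨φ, hφ0, ?_⟩
  choose K hK hKi hKb using fun m n => hcb m (r (φ n)) (hφ0 n) F (G (r (φ n))) hF
    (hG _ (hφ0 n)) hFI (hGI _ (hφ0 n))
  have h1 : ∀ m, ∀ᵐ ω ∂P, Tendsto (fun n => K m n ω) atTop (𝓝 0) := fun m =>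
    ae_tendsto_zero_of_lintegral_le (hK m) (hc m) fun n =>
      (hKi m n).trans (mul_le_mul' le_rfl (hφ n))
  have h2 : ∀ᵐ ω ∂P, ∀ m n s, ‖s‖ < 2 ^ m → ‖G (r (φ n)) ω s - F ω s‖ₑ ^ p ≤ K m n ω :=
    ae_all_iff.2 fun m => ae_all_iff.2 fun n => hKb m n
  filter_upwards [ae_all_iff.2 h1, h2] with ω h3 h4
  exact tendsto_continuousMap_of_pow_le h3 h4

/-- The representation `t ↦ r^{-H} g(s + r t)` of `rescaled k H s r g`. -/
noncomputable def rescaleMap (H : V →L[ℂ] V) (s : Eucl d) (r : ℝ) (g : C(Eucl d, V)) :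
    C(Eucl d, V) :=
  ⟨fun t => opPow r (-H) (g (s + r • t)), by fun_prop⟩

theorem rescaled_eq_ofRep (H : V →L[ℂ] V) (s : Eucl d) (r : ℝ) (g : C(Eucl d, V)) :
    rescaled k H s r g = ofRep (rescaleMap H s r g) := by
  refine Subtype.ext (LinearMap.ext fun l => ?_)
  change opPow r (-H) (integ g (affineFin s r (l : FinMeas d))) =
    integ (fun t => opPow r (-H) (g (s + r • t))) (l : FinMeas d)
  rw [integ_affineFin, integ_apply, integ_apply, map_sum]
  simp only [map_smul]

theorem measurable_rescaleMap (H : V →L[ℂ] V) (s : Eucl d) (r : ℝ) :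
    Measurable (rescaleMap H s r : C(Eucl d, V) → C(Eucl d, V)) :=
  measurable_continuousMap fun t => (opPow r (-H)).continuous.measurable.comp
    (continuous_eval_const (s + r • t)).measurable

theorem continuousMap_ae_eq {F G : Ω → C(Eucl d, V)}
    (h : ∀ s, (fun ω => F ω s) =ᵐ[P] fun ω => G ω s) : F =ᵐ[P] G := by
  obtain ⟨D, hDc, hD⟩ := TopologicalSpace.exists_countable_dense (Eucl d)
  filter_upwards [(ae_ball_iff hDc).2 fun s _ => h s] with ω hω
  exact DFunLike.coe_injective (Continuous.ext_on hD (F ω).continuous (G ω).continuous hω)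

/-- Only laws matter, so the rescaled fields are replaced by the copies `G r`, which live on the
same space as the limit and converge almost surely along suitable subsequences. -/
theorem tendstoInDistribution_rescaled {H : V →L[ℂ] V} {A : USphere d → V →L[ℂ] V}
    (hΦ : IsBaseKernel μ k ε (baseKernel H A) w a) (hε : 0 < ε) (hW : IsCircularNoise P μ W)
    {F : Ω → C(Eucl d, V)} (hF : Measurable F)
    (hFI : ∀ t, IsStochInt μ W P (fun x => compPhase k t x • baseKernel H A x) (fun ω => F ω t))
    {X : Ω → C(Eucl d, V)}
    (hX : ∀ t, IsStochInt μ W P (fun x => (phase t x * cutoff k 1 x) • baseKernel H A x)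
      (fun ω => X ω t)) (s : Eucl d) :
    TendstoInDistribution (fun (r : ℝ) ω => rescaled k H s r (X ω)) (𝓝[>] 0)
      (fun ω => (ofRep (F ω) : PathSpace k d V)) (fun _ => P) P := by
  -- A given continuous version need not be measurable as a map into `C(ℝ^d, V)`; it agrees almost
  -- surely with one that is.
  obtain ⟨X₀, hX₀, hXI⟩ := isHolderMultiplier_phase_mul_cutoff.exists_continuous hΦ hε hW
  have hXX : X =ᵐ[P] X₀ := continuousMap_ae_eq fun t => hW.ae_eq (hX t) (hXI t)
  have hex : ∀ r : ℝ, ∃ G : Ω → C(Eucl d, V), 0 < r → Measurable G ∧ ∀ t, IsStochInt μ W P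
      (fun x => (cutoff k r x * compPhase k t x) • baseKernel H A x) (fun ω => G ω t) := by
    intro r
    by_cases hr : 0 < r
    · obtain ⟨G, hG⟩ := (isHolderMultiplier_compPhase.mul (measurable_cutoff k r)
        (norm_cutoff_le k hr)).exists_continuous hΦ hε hW
      exact ⟨G, fun _ => hG⟩
    · exact ⟨0, fun h => absurd h hr⟩
  choose G hG using hex
  have hlaw : ∀ r, 0 < r → P.map (fun ω => rescaled k H s r (X ω)) =
      P.map (fun ω => (ofRep (G r ω) : PathSpace k d V)) := by
    intro r hr
    have h1 : (fun ω => rescaled k H s r (X ω)) =ᵐ[P]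
        fun ω => (ofRep (rescaleMap H s r (X₀ ω)) : PathSpace k d V) := by
      filter_upwards [hXX] with ω hω
      rw [hω, rescaled_eq_ofRep]
    rw [Measure.map_congr h1]
    refine map_ofRep_eq ((measurable_rescaleMap H s r).comp hX₀) (hG r hr).1 fun n l => ?_
    have h2 := identDistrib_rescaled hW hr hXI (hG r hr).2 s l
    convert! h2 using 3 with ω i
    exact (congrArg (fun f : PathSpace k d V => f.eval (l i)) (rescaled_eq_ofRep H s r (X₀ ω))).symm
  have hm : ∀ r, AEMeasurable (fun ω => rescaled k H s r (X ω)) P := fun r => by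
    refine ⟨fun ω => ofRep (rescaleMap H s r (X₀ ω)),
      measurable_ofRep.comp ((measurable_rescaleMap H s r).comp hX₀), ?_⟩
    filter_upwards [hXX] with ω hω
    rw [hω, rescaled_eq_ofRep]
  refine ⟨hm, (measurable_ofRep.comp hF).aemeasurable, tendsto_of_subseq_tendsto fun r hr => ?_⟩
  obtain ⟨φ, hφ, hlim⟩ := hΦ.exists_seq_ae_tendsto hε hW hF hFI (fun r hr => (hG r hr).1)
    (fun r hr => (hG r hr).2) hr
  refine ⟨φ, ?_⟩
  have h1 := (tendstoInDistribution_of_ae_tendsto (μ' := P) (l := atTop)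
    (X := fun (n : ℕ) ω => (ofRep (G (r (φ n)) ω) : PathSpace k d V))
    (Z := fun ω => (ofRep (F ω) : PathSpace k d V))
    (fun n => (measurable_ofRep.comp (hG _ (hφ n)).1).aemeasurable)
    (measurable_ofRep.comp hF).aemeasurable (by
      filter_upwards [hlim] with ω hω
      exact (continuous_ofRep.tendsto _).comp hω)).tendsto
  refine h1.congr fun n => Subtype.ext ?_
  exact (hlaw _ (hφ n)).symm

end Convergence

/-! ### Nonvanishing of the tangent field -/

section Differences

variable {d : ℕ}

/-- The restriction of a polynomial to the line spanned by `v`. -/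
noncomputable def linePoly (v : Eucl d) (p : MvPolynomial (Fin d) ℂ) : Polynomial ℂ :=
  MvPolynomial.aeval (fun i => Polynomial.C (v i : ℂ) * Polynomial.X) p

theorem eval_linePoly (v : Eucl d) (p : MvPolynomial (Fin d) ℂ) (m : ℕ) :
    (linePoly v p).eval (m : ℂ) = polyEval p ((m : ℝ) • v) := by
  have h : (Polynomial.evalRingHom (m : ℂ)).comp (MvPolynomial.aeval
      (fun i => Polynomial.C (v i : ℂ) * Polynomial.X) : MvPolynomial (Fin d) ℂ →ₐ[ℂ] _).toRingHom =
      MvPolynomial.eval fun i => ((((m : ℝ) • v) i : ℝ) : ℂ) := by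
    ext i
    · simp
    · simp
      ring
  exact RingHom.congr_fun h p

theorem natDegree_linePoly_le (v : Eucl d) (p : MvPolynomial (Fin d) ℂ) :
    (linePoly v p).natDegree ≤ p.totalDegree := by
  rw [linePoly, MvPolynomial.aeval_def, MvPolynomial.eval₂_eq]
  refine Polynomial.natDegree_sum_le_of_forall_le _ _ fun m hm => ?_
  refine Polynomial.natDegree_mul_le.trans ?_
  rw [Polynomial.algebraMap_eq, Polynomial.natDegree_C, zero_add]
  refine (Polynomial.natDegree_prod_le _ _).trans ?_
  refine le_trans (Finset.sum_le_sum fun i _ => ?_) (MvPolynomial.le_totalDegree hm)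
  refine Polynomial.natDegree_pow_le.trans ?_
  exact (Nat.mul_le_mul_left _ ((Polynomial.natDegree_C_mul_le _ _).trans
    Polynomial.natDegree_X_le)).trans (mul_one _).le

/-- The difference of order `k + 1` in direction `v`. -/
noncomputable def diffMeasure (k : ℕ) (v : Eucl d) : Lam k d :=
  ⟨∑ m ∈ Finset.range (k + 2), Finsupp.single ((m : ℝ) • v)
    ((-1 : ℂ) ^ (k + 1 - m) * ((k + 1).choose m : ℂ)), fun p hp => by
      have h := congrFun (Polynomial.fwdDiff_iter_eq_zero_of_degree_lt (P := linePoly v p)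
        (n := k + 1) (Nat.lt_succ_of_le ((natDegree_linePoly_le v p).trans hp))) 0
      rw [fwdDiff_iter_eq_sum_shift] at h
      rw [map_sum]
      refine Eq.trans (Finset.sum_congr rfl fun m _ => ?_) h
      rw [Finsupp.linearCombination_single, ← eval_linePoly]
      simp⟩

/-- The binomial theorem. The zeros are the frequencies whose phase in direction `v` is `1`, so
varying `v` leaves no common zero. -/
theorem fourier_diffMeasure (k : ℕ) (v : Eucl d) (x : Polar d) :
    fourier (diffMeasure k v : FinMeas d) ((x.1 : ℝ) • (x.2 : Eucl d)) =
      (phase v x - 1) ^ (k + 1) := by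
  have hp : ∀ m : ℕ, phase ((m : ℝ) • v) x = phase v x ^ m := by
    intro m
    rw [phase, phase, ← Complex.exp_nat_mul, real_inner_smul_left]
    congr 1
    push_cast
    ring
  rw [fourier_eq_integ_phase, sub_eq_add_neg, add_pow, diffMeasure, map_sum]
  refine Finset.sum_congr rfl fun m _ => ?_
  rw [Finsupp.linearCombination_single, hp, smul_eq_mul]
  ring

/-- Countably many directions suffice to separate each frequency from zero. -/
theorem exists_phase_denseSeq_ne_one (x : Polar d) :
    ∃ n, phase (TopologicalSpace.denseSeq (Eucl d) n) x ≠ 1 := by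
  have hx : (0 : ℝ) < x.1 := x.1.2
  have hc : Continuous fun v : Eucl d => phase v x := by
    unfold phase
    fun_prop
  have hopen : IsOpen {v : Eucl d | phase v x ≠ 1} := isOpen_ne_fun hc continuous_const
  have hne : {v : Eucl d | phase v x ≠ 1}.Nonempty := by
    refine ⟨(Real.pi / x.1) • (x.2 : Eucl d), ?_⟩
    have h1 : inner ℝ (x.2 : Eucl d) (x.2 : Eucl d) = 1 := by
      rw [real_inner_self_eq_norm_sq, norm_eq_of_mem_sphere, one_pow]
    simp only [Set.mem_ofPred_eq, phase, real_inner_smul_left, h1, mul_one]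
    rw [mul_div_cancel₀ _ hx.ne', mul_comm, Complex.exp_pi_mul_I]
    norm_num
  obtain ⟨_, hv, n, rfl⟩ := (TopologicalSpace.denseRange_denseSeq (Eucl d)).inter_open_nonempty
    _ hopen hne
  exact ⟨n, hv⟩

end Differences

/-! ### Recovering the field from vanishing differences -/

section Nonvanishing

variable {d k : ℕ} {V : Type*} [NormedAddCommGroup V] [InnerProductSpace ℂ V] [CompleteSpace V]
  [SecondCountableTopology V] {Ω : Type*} [MeasurableSpace Ω] {P : Measure Ω}
  {μ : TraceClassMeasure V (USphere d)} {W : BddBorel d → Ω → V} {Φ : Polar d → V →L[ℂ] V}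

theorem IsCircularNoise.isStochInt_mul_zero (hW : IsCircularNoise P μ W)
    {f : Polar d → V →L[ℂ] V} (hf : IsL2Kernel μ f) (h : IsStochInt μ W P f fun _ => 0)
    {m : Polar d → ℂ} (hm : Measurable m) {C : ℝ≥0} (hC : ∀ x, ‖m x‖ₑ ≤ C) :
    IsStochInt μ W P (fun x => m x • f x) fun _ => 0 := by
  obtain ⟨J, hJ⟩ := hW.exists_isStochInt (hf.mul hm hC)
  have h1 := hW.lintegral_sq_mul_le hm hC h hJ
  simp only [enorm_zero, ne_eq, OfNat.ofNat_ne_zero, not_false_eq_true, zero_pow, lintegral_const,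
    zero_mul, mul_zero, nonpos_iff_eq_zero] at h1
  rw [lintegral_eq_zero_iff' (hJ.1.1.enorm.pow_const 2)] at h1
  refine hJ.congr_ae ?_
  filter_upwards [h1] with ω hω
  simpa using hω

/-- If the integrals of `f n • Φ` vanish for all `n` and the functions `f n` have no common zero,
then the integrals of all multiples of `Φ` vanish. -/
theorem IsCircularNoise.ae_eq_zero_of_forall (hW : IsCircularNoise P μ W) {q : Polar d → ℂ}
    (hq : Measurable q) (hq1 : ∀ x, ‖q x‖ ≤ 1) (hqΦ : IsL2Kernel μ fun x => q x • Φ x)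
    {f : ℕ → Polar d → ℂ} (hf : ∀ n, Measurable (f n)) {C : ℝ} (hfC : ∀ n x, ‖f n x‖ ≤ C)
    (hfΦ : ∀ n, IsL2Kernel μ fun x => f n x • Φ x)
    (hf0 : ∀ n, IsStochInt μ W P (fun x => f n x • Φ x) fun _ => 0) (hne : ∀ x, ∃ n, f n x ≠ 0)
    {I : Ω → V} (hI : IsStochInt μ W P (fun x => q x • Φ x) I) : I =ᵐ[P] 0 := by
  set M : ℕ → Polar d → ℝ := fun n x => ∑ i ∈ Finset.range n, ‖f i x‖ ^ 2 with hM
  have hMm : ∀ n, Measurable (M n) := fun n =>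
    Finset.measurable_fun_sum _ fun i _ => (hf i).norm.pow_const 2
  -- Every point eventually lies in `S n`, since some `f N` does not vanish there, and on `S n`
  -- division by `M n` is bounded.
  set S : ℕ → Set (Polar d) := fun n => {x | ((n : ℝ) + 1)⁻¹ ≤ M n x} with hSdef
  have hS : ∀ n, MeasurableSet (S n) := fun n => measurableSet_le measurable_const (hMm n)
  have hSx : ∀ x, ∀ᶠ n in atTop, x ∈ S n := by
    intro x
    obtain ⟨N, hN⟩ := hne x
    have hpos : 0 < ‖f N x‖ ^ 2 := by positivity
    have h1 : Tendsto (fun n : ℕ => ((n : ℝ) + 1)⁻¹) atTop (𝓝 0) := by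
      simpa only [one_div] using tendsto_one_div_add_atTop_nhds_zero_nat (𝕜 := ℝ)
    filter_upwards [h1.eventually (Iio_mem_nhds hpos), eventually_gt_atTop N] with n hn hNn
    refine (le_of_lt hn).trans ?_
    exact Finset.single_le_sum (f := fun i => ‖f i x‖ ^ 2) (fun i _ => by positivity)
      (Finset.mem_range.2 hNn)
  have hzero : ∀ n, IsStochInt μ W P (fun x => (S n).indicator q x • Φ x) fun _ => 0 := by
    intro n
    -- On `S n` the identity `∑ c_i f_i = q` holds over `i < n`, because `∑ |f_i|² = M n`; the
    -- coefficients are bounded by `C (n + 1)`.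
    set c : ℕ → Polar d → ℂ := fun i =>
      (S n).indicator fun x => q x * (starRingEnd ℂ) (f i x) / (M n x : ℂ) with hc
    have hcm : ∀ i, Measurable (c i) := fun i =>
      ((hq.mul (Complex.continuous_conj.measurable.comp (hf i))).div
        (Complex.measurable_ofReal.comp (hMm n))).indicator (hS n)
    have hcb : ∀ i x, ‖c i x‖ₑ ≤ ((C * ((n : ℝ) + 1)).toNNReal : ℝ≥0) := by
      intro i x
      rw [← ofReal_norm, ENNReal.ofReal]
      refine ENNReal.coe_le_coe.2 (Real.toNNReal_le_toNNReal ?_)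
      have hC0 : 0 ≤ C := (norm_nonneg _).trans (hfC i x)
      by_cases hx : x ∈ S n
      · have hx' : ((n : ℝ) + 1)⁻¹ ≤ M n x := hx
        have hMpos : 0 < M n x := lt_of_lt_of_le (by positivity) hx'
        simp only [hc, Set.indicator_of_mem hx]
        rw [norm_div, norm_mul, RCLike.norm_conj, Complex.norm_real, Real.norm_eq_abs,
          abs_of_pos hMpos, div_eq_mul_inv]
        have h1 : (M n x)⁻¹ ≤ (n : ℝ) + 1 := inv_le_of_inv_le₀ (by positivity) hx'
        have h2 : ‖q x‖ * ‖f i x‖ ≤ C := by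
          calc ‖q x‖ * ‖f i x‖ ≤ 1 * C := by gcongr; exacts [hq1 x, hfC i x]
            _ = C := one_mul C
        gcongr
      · simp only [hc, Set.indicator_of_notMem hx, norm_zero]
        positivity
    have h1 := hW.isStochInt_sum (Finset.range n) fun i _ =>
      hW.isStochInt_mul_zero (hfΦ i) (hf0 i) (hcm i) (hcb i)
    simp only [Finset.sum_const_zero] at h1
    convert! h1 using 2 with x
    simp only [smul_smul, ← Finset.sum_smul]
    congr 1
    by_cases hx : x ∈ S n
    · have hx' : ((n : ℝ) + 1)⁻¹ ≤ M n x := hx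
      have hMpos : 0 < M n x := lt_of_lt_of_le (by positivity) hx'
      have hM0 : (M n x : ℂ) ≠ 0 := by exact_mod_cast hMpos.ne'
      simp only [hc, Set.indicator_of_mem hx]
      have h2 : ∀ i, q x * (starRingEnd ℂ) (f i x) / (M n x : ℂ) * f i x =
          q x / (M n x : ℂ) * ((‖f i x‖ ^ 2 : ℝ) : ℂ) := by
        intro i
        have h3 : (starRingEnd ℂ) (f i x) * f i x = ((‖f i x‖ ^ 2 : ℝ) : ℂ) := by
          rw [mul_comm, Complex.mul_conj, Complex.normSq_eq_norm_sq]
        rw [← h3]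
        ring
      simp only [h2, ← Finset.mul_sum, ← Complex.ofReal_sum]
      rw [div_mul_cancel₀ _ hM0]
    · simp [hc, Set.indicator_of_notMem hx]
  -- As the part over `S n` vanishes, `I` is for every `n` the integral over the complement, whose
  -- kernel tends to zero in `L²`.
  have hdiff : ∀ n, IsStochInt μ W P (fun x => (S n)ᶜ.indicator (1 : Polar d → ℂ) x • (q x • Φ x))
      I := by
    intro n
    have h := hW.isStochInt_sub hI (hzero n)
    simp only [sub_zero] at h
    convert! h using 2 with x
    by_cases hx : x ∈ S n
    · simp [hx]
    · simp [hx]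
  have hle : ∀ n, ∫⁻ ω, ‖I ω‖ₑ ^ 2 ∂P ≤
      4 * ∫⁻ x, (S n)ᶜ.indicator (fun x => ‖q x • Φ x‖ₑ ^ 2) x ∂(controlTrace μ) := by
    intro n
    have hL2 := hqΦ.mul (m := (S n)ᶜ.indicator (1 : Polar d → ℂ))
      (measurable_one.indicator (hS n).compl) (C := 1) fun x => by
        by_cases hx : x ∈ S n <;> simp [hx]
    refine (hW.lintegral_sq_le hL2 (hdiff n)).trans (le_of_eq ?_)
    congr 2
    funext x
    by_cases hx : x ∈ S n <;> simp [hx]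
  have hmeas : Measurable fun x => ‖q x • Φ x‖ₑ ^ 2 :=
    (measurable_enorm_of_apply hqΦ.measurable).pow_const 2
  have hlim : Tendsto (fun n => ∫⁻ x, (S n)ᶜ.indicator (fun x => ‖q x • Φ x‖ₑ ^ 2) x
      ∂(controlTrace μ)) atTop (𝓝 0) := by
    rw [← lintegral_zero (μ := controlTrace μ)]
    refine tendsto_lintegral_of_dominated_convergence (fun x => ‖q x • Φ x‖ₑ ^ 2)
      (fun n => hmeas.indicator (hS n).compl)
      (fun n => Eventually.of_forall fun x => Set.indicator_le_self _ _ _) hqΦ.lt_top.ne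
      (Eventually.of_forall fun x => tendsto_const_nhds.congr' ?_)
    filter_upwards [hSx x] with n hn
    rw [Set.indicator_of_notMem (Set.notMem_compl_iff.2 hn)]
  have hlim4 := ENNReal.Tendsto.const_mul (a := 4) hlim (Or.inr (by simp))
  rw [mul_zero] at hlim4
  have h0 : ∫⁻ ω, ‖I ω‖ₑ ^ 2 ∂P = 0 := le_antisymm (ge_of_tendsto' hlim4 hle) zero_le
  rw [lintegral_eq_zero_iff' (hI.1.1.enorm.pow_const 2)] at h0
  filter_upwards [h0] with ω hω
  simpa using hω

variable {ε : ℝ} {w : Set.Ioi (0 : ℝ) → ℝ≥0∞} {a : USphere d → ℝ≥0∞}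

theorem IsHolderMultiplier.exists_enorm_integ_le {m : Eucl d → Polar d → ℂ}
    (hm : IsHolderMultiplier k m) (l : FinMeas d) :
    ∃ C : ℝ≥0∞, C ≠ ∞ ∧ ∀ x, ‖integ (fun t => m t x) l‖ₑ ≤ C * weight k 0 x.1 := by
  choose C hC h using hm.exists_enorm_le
  refine ⟨∑ t ∈ l.support, ‖l t‖ₑ * C t, ?_, fun x => ?_⟩
  · exact (ENNReal.sum_lt_top.2 fun t _ => ENNReal.mul_lt_top (by simp) (hC t).lt_top).ne
  · rw [integ_apply, Finset.sum_mul]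
    refine (enorm_sum_le _ _).trans (Finset.sum_le_sum fun t _ => ?_)
    rw [enorm_smul, mul_assoc]
    exact mul_le_mul' le_rfl (h t x)

theorem isL2Kernel_fourier (hΦ : IsBaseKernel μ k ε Φ w a) (hε : 0 < ε) (l : Lam k d) :
    IsL2Kernel μ fun x =>
      fourier (l : FinMeas d) ((x.1 : ℝ) • (x.2 : Eucl d)) • Φ x := by
  obtain ⟨C, hC, h⟩ := isHolderMultiplier_compPhase.exists_enorm_integ_le (k := k) (l : FinMeas d)
  simp only [integ_compPhase] at h
  refine hΦ.isL2Kernel hε hC ?_ h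
  simp only [fourier_eq_integ_phase, integ_apply]
  exact Finset.measurable_fun_sum _ fun t _ => (measurable_phase t).const_smul (l.1 t)

/-- If the tangent field vanishes almost surely, then so does the field. -/
theorem ae_eq_zero_of_tangent (hW : IsCircularNoise P μ W) (hΦ : IsBaseKernel μ k ε Φ w a)
    (hε : 0 < ε)
    (h0 : ∀ l : Lam k d, IsStochInt μ W P
      (fun x => fourier (l : FinMeas d) ((x.1 : ℝ) • (x.2 : Eucl d)) • Φ x) fun _ => 0)
    {s : Eucl d} {I : Ω → V} (hI : IsStochInt μ W P (fun x => (phase s x * cutoff k 1 x) • Φ x) I) :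
    I =ᵐ[P] 0 := by
  set v := TopologicalSpace.denseSeq (Eucl d)
  have hL2 := fun n => isL2Kernel_fourier hΦ hε (diffMeasure k (v n))
  have h0' := fun n => h0 (diffMeasure k (v n))
  simp only [fourier_diffMeasure] at hL2 h0'
  refine hW.ae_eq_zero_of_forall ((measurable_phase s).mul (measurable_cutoff k 1))
    (fun x => ?_) (isHolderMultiplier_phase_mul_cutoff.isL2Kernel hΦ hε s)
    (f := fun n x => (phase (v n) x - 1) ^ (k + 1)) (C := 2 ^ (k + 1))
    (fun n => ((measurable_phase (v n)).sub_const 1).pow_const _) (fun n x => ?_) hL2 h0'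
    (fun x => ?_) hI
  · change ‖phase s x * cutoff k 1 x‖ ≤ 1
    rw [norm_mul, norm_phase, one_mul]
    exact norm_cutoff_le k one_pos x
  · rw [norm_pow]
    refine pow_le_pow_left₀ (norm_nonneg _) ((norm_sub_le _ _).trans ?_) _
    rw [norm_phase, norm_one]
    norm_num
  · obtain ⟨n, hn⟩ := exists_phase_denseSeq_ne_one x
    exact ⟨n, pow_ne_zero _ (sub_ne_zero.2 hn)⟩

end Nonvanishing

end TangentField
-- The proposition
open TangentField
theorem proposition5p2 {d k : ℕ}
    {V : Type*} [NormedAddCommGroup V] [InnerProductSpace ℂ V] [CompleteSpace V]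
    [SecondCountableTopology V] [MeasurableSpace V] [BorelSpace V]
    (conj : V ≃ₗᵢ⋆[ℂ] V) (hconj : ∀ x, conj (conj x) = x)
    {Ω : Type*} [MeasurableSpace Ω] (P : Measure Ω) [IsProbabilityMeasure P]
    (μ : TraceClassMeasure V (USphere d)) (hμ : ∀ B x, conj (μ.toVec B x) = μ.toVec B (conj x))
    (WR WI : BddBorel d → Ω → V)
    (hWR : IsRealGaussianMeasure conj P μ WR) (hWI : IsRealGaussianMeasure conj P μ WI)
    (hind : IndepFun (fun ω B => WR B ω) (fun ω B => WI B ω) P)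
    (W : BddBorel d → Ω → V) (hW : ∀ B ω, W B ω = WR B ω + Complex.I • WI B ω)
    (H : V →L[ℂ] V) (ε : ℝ) (hε : 0 < ε)
    (hH : ∀ z ∈ spectrum ℂ H, ε < z.re ∧ z.re < k + 1)
    (A : USphere d → V →L[ℂ] V) (hA : ∀ v, Measurable fun θ => A θ v)
    (hAint : ∫⁻ θ, ‖A θ‖ₑ ^ 2 ∂μ.traceMeasure < ∞) :
    -- the stochastic integrals exist, and are unique almost surely
    (∀ s, ∃ I, IsStochInt μ W P (fieldKernel k H A s) I) ∧
    (∀ s I J, IsStochInt μ W P (fieldKernel k H A s) I →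
      IsStochInt μ W P (fieldKernel k H A s) J → I =ᵐ[P] J) ∧
    ∀ X : Eucl d → Ω → V, (∀ s, IsStochInt μ W P (fieldKernel k H A s) (X s)) →
      -- stationary, centered Gaussian field
      (IsGaussianProcess X P ∧ (∀ s, ∫ ω, X s ω ∂P = 0) ∧ IsStrictlyStationary P X) ∧
      -- version with Hölder continuous paths
      (∃ Xv : Eucl d → Ω → V, (∀ s, Xv s =ᵐ[P] X s) ∧
        ∀ ω, ∀ γ : ℝ, 0 < γ → γ < min 1 ε → IsLocHolder γ (fun s => Xv s ω)) ∧
      -- tangent field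
      ∃ Y : Ω → PathSpace k d V, Measurable Y ∧
        (∀ l : Lam k d, IsStochInt μ W P (tangentKernel H A l) (fun ω => (Y ω).eval l)) ∧
        IsSelfSimilar P H Y ∧ IsIRF P Y ∧
        (∀ Xv : Ω → C(Eucl d, V), (∀ s, (fun ω => Xv ω s) =ᵐ[P] X s) →
          ∀ s₀ : Eucl d, TendstoInDistribution (fun (r : ℝ) ω => rescaled k H s₀ r (Xv ω))
            (𝓝[>] 0) Y (fun _ => P) P) ∧
        ((∃ s, ¬ X s =ᵐ[P] 0) → ∃ l, ¬ (fun ω => (Y ω).eval l) =ᵐ[P] 0) := by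
  have hWc : IsCircularNoise P μ W := isCircularNoise_of_isRealGaussianMeasure hWR hWI hind hW
  obtain ⟨w, hΦ⟩ := exists_isBaseKernel (μ := μ) hH hA hAint
  have hker : ∀ s, fieldKernel k H A s =
      fun x => (phase s x * cutoff k 1 x) • baseKernel H A x := by
    intro s
    funext x
    simp only [fieldKernel, phase, cutoff, baseKernel, div_one]
  have hmul : IsHolderMultiplier k fun (s : Eucl d) x => phase s x * cutoff k 1 x :=
    isHolderMultiplier_phase_mul_cutoff
  simp only [hker]
  refine ⟨fun s => hWc.exists_isStochInt (hmul.isL2Kernel hΦ hε s),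
    fun s I J hI hJ => hWc.ae_eq hI hJ, fun X hX => ⟨⟨hWc.isGaussianProcess hX,
      fun s => hWc.integral_eq_zero (hX s), isStrictlyStationary_of_isStochInt hWc hX⟩, ?_, ?_⟩⟩
  · obtain ⟨Xv, -, h1, h2⟩ := hmul.exists_version hΦ hε hWc hX
    exact ⟨Xv, h1, h2⟩
  -- The compensated field is the continuous representation of `Y`; its values at points depend on
  -- the chosen compensator, its class in the path space has the required kernels.
  · obtain ⟨F, hF, hFI⟩ := isHolderMultiplier_compPhase.exists_continuous hΦ hε hWc
    have hY : ∀ l : Lam k d, IsStochInt μ W P (tangentKernel H A l)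
        (fun ω => (ofRep (F ω) : PathSpace k d V).eval l) := fun l =>
      isStochInt_integ_compPhase hWc hFI l
    refine ⟨fun ω => ofRep (F ω), measurable_ofRep.comp hF, hY,
      isSelfSimilar_of_isStochInt hWc hY, isIRF_of_isStochInt hWc hY,
      fun Xv hXv s₀ => tendstoInDistribution_rescaled hΦ hε hWc hF hFI
        (fun t => (hX t).congr_ae (hXv t).symm) s₀, ?_⟩
    rintro ⟨s, hs⟩
    by_contra! h
    exact hs (ae_eq_zero_of_tangent hWc hΦ hε (fun l => (hY l).congr_ae (h l)) (hX s))
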